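/- Let $G$ be a connected simply-connected nilpotent (real) Lie group of dimension $2n$ with Lie algebra $\mathfrak g$, let $\Gamma\subset G$ be a lattice (a discrete subgroup with $\Gamma\backslash G$ compact), and let $\Gamma\backslash G$ be the corresponding nilmanifold. Let $\rho\in\wedge^\bullet\mathfrak g^*_{\mathbb C}$ be a pure form of type $k$, $\rho=e^{B+i\omega}\,\Omega$ with $B,\omega\in\wedge^2\mathfrak g^*$ and $\Omega=\theta_1\wedge\dots\wedge\theta_k$, $\theta_i\in\mathfrak g^*_{\mathbb C}$, which is non-degenerate, $\omega^{n-k}\wedge\Omega\wedge\overline\Omega\neq 0$, and integrable, $d\rho=(X+\zeta)\cdot\rho:=\iota_X\rho+\zeta\wedge\rho$ for some $X+\zeta\in\mathfrak g\oplus\mathfrak g^*$, where $d$ is the Chevalley–Eilenberg differential. Put $\mathfrak L=\{v\in(\mathfrak g\oplus\mathfrak g^*)\otimes\mathbb C: v\cdot\rho=0\}$ and $\mathfrak U^{n-r}=\wedge^r\overline{\mathfrak L}\cdot\rho$, so that $\wedge^\bullet\mathfrak g^*_{\mathbb C}=\bigoplus_j\mathfrak U^j$ and $d=\partial+\overline\partial$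 with $\partial\colon\mathfrak U^j\to\mathfrak U^{j+1}$, $\overline\partial\colon\mathfrak U^j\to\mathfrak U^{j-1}$. On $\Gamma\backslash G$ consider the left-invariant generalized complex structure whose canonical line bundle $K$ is spanned by the form induced by $\rho$; let $L=\mathrm{Ann}(K)$, let $\mathcal U^{n-r}$ be the space of smooth sections of $\wedge^r\overline L\cdot K$, and let $d=\partial+\overline\partial$ be the analogous decomposition of the exterior derivative on the smooth complex-valued forms $\bigoplus_j\mathcal U^j$ on $\Gamma\backslash G$. Put $$GH^j_{\overline\partial}(\mathfrak g)=\frac{\ker(\overline\partial\colon\mathfrak U^j\to\mathfrak U^{j-1})}{\mathrm{im}(\overline\partial\colon\mathfrak U^{j+1}\to\mathfrak U^{j})},\qquad GH^j_{\overline\partial}(\Gamma\backslash G)=\frac{\ker(\overline\partial\colon\mathcal U^j\to\mathcal U^{j-1})}{\mathrm{im}(\overline\partial\colon\mathcal U^{j+1}\to\mathcal U^{j})}.$$ Then the inclusion $\iota$ of $\wedge^\bullet\mathfrak g^*_{\mathbb C}$, regarded as the left-invariant forms, into the smooth complex-valued forms on $\Gamma\backslash G$ is a homomorphism $(\mathfrak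 U^\bullet,\partial,\overline\partial)\to(\mathcal U^\bullet,\partial,\overline\partial)$ of bi-differential $\mathbb Z$-graded complexes, and there exist a Borel probability measure $\nu$ on $\Gamma\backslash G$ invariant under all right translations $\Gamma g\mapsto\Gamma gh$, $h\in G$, and a homomorphism $\mu\colon(\mathcal U^\bullet,\partial,\overline\partial)\to(\mathfrak U^\bullet,\partial,\overline\partial)$ of bi-differential $\mathbb Z$-graded complexes, given by averaging, $$\mu(\alpha)(X_1,\dots,X_p)=\int_{\Gamma\backslash G}\alpha(\tilde X_1,\dots,\tilde X_p)\,d\nu$$ for the degree $p$ part of a form $\alpha$ and $X_1,\dots,X_p\in\mathfrak g$, where $\tilde X$ is the vector field on $\Gamma\backslash G$ induced by the left-invariant vector field $X$, such that $\mu\circ\iota=\mathrm{id}$. Hence the map $GH^j_{\overline\partial}(\mathfrak g)\to GH^j_{\overline\partial}(\Gamma\backslash G)$ induced by $\iota$ is injective for every $j\in\mathbb Z$. -/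

import Mathlib

open scoped TensorProduct

noncomputable section

namespace GenCx

section LinearAlgebra

variable {V W : Type*} [AddCommGroup V] [Module ℝ V] [AddCommGroup W] [Module ℝ W]

/-- Complex-valued forms of mixed degree on a real vector space `V`. -/
abbrev Form (V : Type*) [AddCommGroup V] [Module ℝ V] : Type _ :=
  ∀ p : ℕ, V [⋀^Fin p]→ₗ[ℝ] ℂ

namespace Form

/-- Pullback of forms along a linear map. -/
def pullback (f : V →ₗ[ℝ] W) : Form W →ₗ[ℂ] Form V where
  toFun a p := (a p).compLinearMap f
  map_add' _ _ := rfl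
  map_smul' _ _ := rfl

/-- The wedge product of two homogeneous forms (sum over shuffles). -/
def wedge {p q : ℕ} (a : V [⋀^Fin p]→ₗ[ℝ] ℂ) (b : V [⋀^Fin q]→ₗ[ℝ] ℂ) :
    V [⋀^Fin (p + q)]→ₗ[ℝ] ℂ :=
  ((LinearMap.mul' ℝ ℂ).compAlternatingMap (a.domCoprod b)).domDomCongr finSumFinEquiv

/-- The wedge product of two forms of mixed degree. -/
def mul (a b : Form V) : Form V := fun p =>
  ∑ x : Finset.HasAntidiagonal.antidiagonal p,
    (wedge (a x.1.1) (b x.1.2)).domDomCongr (finCongr (Finset.HasAntidiagonal.mem_antidiagonal.mp x.2))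

/-- A homogeneous form as a form of mixed degree. -/
def ofDegree {p : ℕ} (a : V [⋀^Fin p]→ₗ[ℝ] ℂ) : Form V := Pi.single p a

/-- The constant form `1`. -/
def one : Form V := ofDegree (AlternatingMap.constOfIsEmpty ℝ V (Fin 0) (1 : ℂ))

/-- Wedge powers. -/
def pow (a : Form V) (m : ℕ) : Form V := (mul a)^[m] one

/-- The exponential `e^c = ∑ c^m / m!` of a form `c` of degree two; as `c^m` has degree `2 m`, only
the terms with `m ≤ p` matter in degree `p`. -/
def exp (c : V [⋀^Fin 2]→ₗ[ℝ] ℂ) : Form V := fun p =>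
  ∑ m ∈ Finset.range (p + 1), ((m.factorial : ℂ)⁻¹) • pow (ofDegree c) m p

/-- The product `θ₁ ∧ ⋯ ∧ θₖ` of complex-valued one-forms. -/
def prodOneForms {k : ℕ} (θ : Fin k → (V →ₗ[ℝ] ℂ)) : Form V :=
  ((List.ofFn θ).map fun ξ => ofDegree (AlternatingMap.ofSubsingleton ℝ V ℂ (0 : Fin 1) ξ)).foldr
    mul one

/-- Complex conjugation of forms. -/
def conj (a : Form V) : Form V := fun p => Complex.conjAe.toLinearMap.compAlternatingMap (a p)

/-- A real form, seen as a complex-valued one. -/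
def complexify {p : ℕ} (a : V [⋀^Fin p]→ₗ[ℝ] ℝ) : V [⋀^Fin p]→ₗ[ℝ] ℂ :=
  Complex.ofRealCLM.toLinearMap.compAlternatingMap a

/-- Contraction `ι_X a`, where `(ι_X a) (v₁, …) = a (X, v₁, …)`. -/
def contract : V →ₗ[ℝ] Module.End ℂ (Form V) where
  toFun X :=
    { toFun := fun a p => (a (p + 1)).curryLeft X
      map_add' := fun _ _ => rfl
      map_smul' := fun _ _ => rfl }
  map_add' X Y := by
    ext a p v
    exact congrArg (fun f => f v) (map_add (a (p + 1)).curryLeft X Y)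
  map_smul' c X := by
    ext a p v
    exact congrArg (fun f => f v) (map_smul (a (p + 1)).curryLeft c X)

/-- Exterior multiplication by a real one-form,
`(ξ ∧ a) (v₀, …, vₚ) = ∑ i, (-1)ⁱ ξ (vᵢ) a (v₀, …, v̂ᵢ, …, vₚ)`. -/
def extMul : Module.Dual ℝ V →ₗ[ℝ] Module.End ℂ (Form V) where
  toFun ξ :=
    { toFun := fun a p => match p with
        | 0 => 0
        | p + 1 => AlternatingMap.alternatizeUncurryFin (ξ.smulRight (a p))
      map_add' := fun a b => by
        funext p
        cases p with
        | zero => simp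
        | succ p => ext v; simp [AlternatingMap.alternatizeUncurryFin_apply, Finset.sum_add_distrib]
      map_smul' := fun c a => by
        funext p
        cases p with
        | zero => simp
        | succ p =>
          ext v
          simp [AlternatingMap.alternatizeUncurryFin_apply, Finset.mul_sum, mul_left_comm] }
  map_add' ξ η := by
    ext a p v
    cases p with
    | zero => simp
    | succ p => simp [AlternatingMap.alternatizeUncurryFin_apply, add_mul, Finset.sum_add_distrib]
  map_smul' c ξ := by
    ext a p v
    cases p with
    | zero => simp
    | succ p => simp [AlternatingMap.alternatizeUncurryFin_apply, Finset.mul_sum, mul_left_comm, mul_assoc]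

end Form

/-- `V ⊕ V*`. -/
abbrev Dbl (V : Type*) [AddCommGroup V] [Module ℝ V] : Type _ := V × Module.Dual ℝ V

/-- `(V ⊕ V*) ⊗ ℂ`. -/
abbrev DblC (V : Type*) [AddCommGroup V] [Module ℝ V] : Type _ := ℂ ⊗[ℝ] Dbl V

/-- The action of `V ⊕ V*` on forms, `(X + ξ) · a = ι_X a + ξ ∧ a`. -/
def act : Dbl V →ₗ[ℝ] Module.End ℂ (Form V) := Form.contract.coprod Form.extMul

/-- The complex-linear extension of the action to `(V ⊕ V*) ⊗ ℂ`. -/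
def actC : DblC V →ₗ[ℂ] Module.End ℂ (Form V) := act.liftBaseChange ℂ

/-- Complex conjugation on `(V ⊕ V*) ⊗ ℂ`. -/
def conjD : DblC V →ₗ[ℝ] DblC V := LinearMap.rTensor (Dbl V) Complex.conjAe.toLinearMap

/-- `L = Ann ρ ⊆ (V ⊕ V*) ⊗ ℂ`. -/
def Ann (ρ : Form V) : Submodule ℂ (DblC V) := LinearMap.ker (actC.flip ρ)

/-- `Uʲ = ∧ⁿ⁻ʲ L̄ · ρ` with `L = Ann ρ`, that is, the span of all `v₁ · (v₂ · ⋯ (vᵣ · ρ))` with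
`r = n - j` and `vᵢ ∈ L̄`. -/
def U (n : ℕ) (ρ : Form V) (j : ℤ) : Submodule ℂ (Form V) :=
  Submodule.span ℂ {a | ∃ (r : ℕ) (v : Fin r → DblC V), (n : ℤ) - r = j ∧
    (∀ i, conjD (v i) ∈ Ann ρ) ∧ a = (List.ofFn fun i => actC (v i)).prod ρ}

/-- `ρ` is a non-degenerate pure form of type `k` on a space of dimension `2 n`:
`ρ = e^{B + i ω} Ω` and `ω^{n - k} ∧ Ω ∧ Ω̄ ≠ 0`, with `B`, `ω` real two-forms and
`Ω = θ₁ ∧ ⋯ ∧ θₖ`. (For `k > n` the second condition would fail anyway, as `Ω ∧ Ω̄ = 0`.) -/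
def IsNondegeneratePure (n k : ℕ) (ρ : Form V) : Prop :=
  k ≤ n ∧ ∃ (B ω : V [⋀^Fin 2]→ₗ[ℝ] ℝ) (θ : Fin k → (V →ₗ[ℝ] ℂ)),
    ρ = (Form.exp (Form.complexify B + Complex.I • Form.complexify ω)).mul (Form.prodOneForms θ) ∧
    ((Form.ofDegree (Form.complexify ω)).pow (n - k)).mul
      ((Form.prodOneForms θ).mul (Form.prodOneForms θ).conj) ≠ 0

end LinearAlgebra

section LieAlgebra

variable {𝔤 : Type*} [LieRing 𝔤] [LieAlgebra ℝ 𝔤]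

/-- The bilinear map `(X, Y) ↦ ι_{[X, Y]} a`. -/
def contractLie {q : ℕ} (a : 𝔤 [⋀^Fin (q + 1)]→ₗ[ℝ] ℂ) : 𝔤 →ₗ[ℝ] 𝔤 →ₗ[ℝ] 𝔤 [⋀^Fin q]→ₗ[ℝ] ℂ :=
  LinearMap.compr₂ (LieModule.toEnd ℝ 𝔤 𝔤 : 𝔤 →ₗ[ℝ] 𝔤 →ₗ[ℝ] 𝔤) a.curryLeft

/-- The differential of a form of positive degree on a Lie algebra; see `ceDiffPos_apply`. -/
def ceDiffPos {q : ℕ} (a : 𝔤 [⋀^Fin (q + 1)]→ₗ[ℝ] ℂ) : 𝔤 [⋀^Fin (q + 2)]→ₗ[ℝ] ℂ :=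
  (-(1 / 2 : ℝ)) • AlternatingMap.alternatizeUncurryFin
    (AlternatingMap.alternatizeUncurryFinLM ∘ₗ contractLie a)

/-- `da (v₀, …) = ∑_{i < j} (-1)^{i + j} a ([vᵢ, vⱼ], v₀, …, v̂ᵢ, …, v̂ⱼ, …)`; the pair `(i, j)` of the
usual formula is `(i, j + 1)` here, whence the sign. -/
theorem ceDiffPos_apply {q : ℕ} (a : 𝔤 [⋀^Fin (q + 1)]→ₗ[ℝ] ℂ) (v : Fin (q + 2) → 𝔤) :
    ceDiffPos a v = -∑ i : Fin (q + 1), ∑ j ≥ i, (-1 : ℤ) ^ (i + j : ℕ) •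
      a (Matrix.vecCons ⁅v i.castSucc, v j.succ⁆ (j.removeNth <| i.castSucc.removeNth v)) := by
  have h : ∀ x y : 𝔤, contractLie a x y = a.curryLeft ⁅x, y⁆ := fun _ _ => rfl
  have h2 : ∀ x y : 𝔤, contractLie a y x = -contractLie a x y := fun x y => by
    rw [h, h, ← lie_skew, map_neg]
  rw [ceDiffPos, AlternatingMap.smul_apply,
    AlternatingMap.alternatizeUncurryFin_alternatizeUncurryFinLM_comp_apply, Finset.smul_sum,
    ← Finset.sum_neg_distrib]
  refine Finset.sum_congr rfl fun i _ => ?_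
  rw [Finset.smul_sum, ← Finset.sum_neg_distrib]
  refine Finset.sum_congr rfl fun j _ => ?_
  rw [h2 (v i.castSucc), AlternatingMap.neg_apply, h, AlternatingMap.curryLeft_apply_apply,
    sub_neg_eq_add, ← two_smul ℝ, smul_comm (_ : ℝ), smul_smul, ← smul_neg]
  norm_num

/-- The differential of the complex `∧ 𝔤*_ℂ` of the Lie algebra `𝔤`. It vanishes on constants. -/
def ceDiff : Form 𝔤 →ₗ[ℂ] Form 𝔤 where
  toFun a p := match p with
    | 0 => 0
    | 1 => 0
    | q + 2 => ceDiffPos (a (q + 1))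
  map_add' a b := by
    funext p
    match p with
    | 0 => simp
    | 1 => simp
    | q + 2 =>
      ext v
      simp [ceDiffPos_apply, Finset.sum_add_distrib]
      abel
  map_smul' c a := by
    funext p
    match p with
    | 0 => simp
    | 1 => simp
    | q + 2 =>
      ext v
      simp [ceDiffPos_apply, Finset.mul_sum, mul_left_comm]

/-- A form `ρ` on the Lie algebra `𝔤` is integrable if `dρ = (X + ζ) · ρ` for some
`X + ζ ∈ 𝔤 ⊕ 𝔤*`. -/
def IsIntegrable (ρ : Form 𝔤) : Prop := ∃ v : Dbl 𝔤, ceDiff ρ = act v ρ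

end LieAlgebra

section GradedComplex

variable {A : Type*} [AddCommGroup A] [Module ℂ A]

open Classical in
/-- The projection of `A = ⨁ j, 𝒰 j` onto the summand `𝒰 j` (it is only meaningful, and only used, for
families of submodules that decompose `A`). -/
def component (𝒰 : ℤ → Submodule ℂ A) (j : ℤ) : A →ₗ[ℂ] 𝒰 j :=
  if h : DirectSum.IsInternal 𝒰 then
    DirectSum.component ℂ ℤ (fun i => 𝒰 i) j ∘ₗ
      (LinearEquiv.ofBijective (DirectSum.coeLinearMap 𝒰) h).symm.toLinearMap
  else 0

/-- The component `𝒰 i → 𝒰 j` of an endomorphism `d` of `A = ⨁ j, 𝒰 j`. -/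
def dComp (d : A →ₗ[ℂ] A) (𝒰 : ℤ → Submodule ℂ A) (i j : ℤ) : 𝒰 i →ₗ[ℂ] 𝒰 j :=
  component 𝒰 j ∘ₗ d ∘ₗ (𝒰 i).subtype

/-- `∂ : 𝒰 j → 𝒰 (j + 1)`. -/
abbrev del (d : A →ₗ[ℂ] A) (𝒰 : ℤ → Submodule ℂ A) (j : ℤ) : 𝒰 j →ₗ[ℂ] 𝒰 (j + 1) :=
  dComp d 𝒰 j (j + 1)

/-- `∂̄ : 𝒰 j → 𝒰 (j - 1)`. -/
abbrev delbar (d : A →ₗ[ℂ] A) (𝒰 : ℤ → Submodule ℂ A) (j : ℤ) : 𝒰 j →ₗ[ℂ] 𝒰 (j - 1) :=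
  dComp d 𝒰 j (j - 1)

/-- `GHʲ_∂̄ = ker (∂̄ : 𝒰 j → 𝒰 (j - 1)) / im (∂̄ : 𝒰 (j + 1) → 𝒰 j)`. -/
abbrev GHdelbar (d : A →ₗ[ℂ] A) (𝒰 : ℤ → Submodule ℂ A) (j : ℤ) : Type _ :=
  LinearMap.ker (delbar d 𝒰 j) ⧸
    (LinearMap.range (dComp d 𝒰 (j + 1) j)).submoduleOf (LinearMap.ker (delbar d 𝒰 j))

variable {B : Type*} [AddCommGroup B] [Module ℂ B]

/-- `f` is a homomorphism of the bi-differential `ℤ`-graded complexes `(𝒰, ∂, ∂̄) → (𝒱, ∂, ∂̄)` defined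
by `(A, d)` and `(B, d)`: it respects the gradings and commutes with `∂`, with `∂̄` and with
`d = ∂ + ∂̄`. -/
structure IsBiHom (dA : A →ₗ[ℂ] A) (𝒰 : ℤ → Submodule ℂ A) (dB : B →ₗ[ℂ] B)
    (𝒱 : ℤ → Submodule ℂ B) (f : A →ₗ[ℂ] B) : Prop where
  map_mem : ∀ j, ∀ a ∈ 𝒰 j, f a ∈ 𝒱 j
  map_d : ∀ a, f (dA a) = dB (f a)
  map_del : ∀ (j : ℤ) (a : 𝒰 j), f (del dA 𝒰 j a) = del dB 𝒱 j ⟨f a, map_mem j a a.2⟩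
  map_delbar : ∀ (j : ℤ) (a : 𝒰 j), f (delbar dA 𝒰 j a) = delbar dB 𝒱 j ⟨f a, map_mem j a a.2⟩

namespace IsBiHom

variable {dA : A →ₗ[ℂ] A} {𝒰 : ℤ → Submodule ℂ A} {dB : B →ₗ[ℂ] B} {𝒱 : ℤ → Submodule ℂ B}
  {f : A →ₗ[ℂ] B}

/-- The degree `j` part of a homomorphism of bi-differential complexes. -/
def degree (hf : IsBiHom dA 𝒰 dB 𝒱 f) (j : ℤ) : 𝒰 j →ₗ[ℂ] 𝒱 j := f.restrict (hf.map_mem j)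

theorem degree_dComp (hf : IsBiHom dA 𝒰 dB 𝒱 f) {i j : ℤ} (h : j = i - 1) (a : 𝒰 i) :
    hf.degree j (dComp dA 𝒰 i j a) = dComp dB 𝒱 i j (hf.degree i a) := by
  subst h
  exact Subtype.ext (hf.map_delbar i a)

/-- The restriction of `f` to the kernels of `∂̄`. -/
def kerMap (hf : IsBiHom dA 𝒰 dB 𝒱 f) (j : ℤ) :
    LinearMap.ker (delbar dA 𝒰 j) →ₗ[ℂ] LinearMap.ker (delbar dB 𝒱 j) :=
  (hf.degree j).restrict fun a ha => by
    rw [LinearMap.mem_ker] at ha ⊢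
    rw [← hf.degree_dComp rfl a, ha, map_zero]

/-- The map induced by `f` on the cohomology of `∂̄`. -/
def mapGH (hf : IsBiHom dA 𝒰 dB 𝒱 f) (j : ℤ) : GHdelbar dA 𝒰 j →ₗ[ℂ] GHdelbar dB 𝒱 j :=
  Submodule.mapQ _ _ (hf.kerMap j) fun a ha => by
    obtain ⟨b, hb⟩ := Submodule.mem_comap.mp ha
    refine Submodule.mem_comap.mpr (Submodule.mem_comap.mpr ⟨hf.degree (j + 1) b, ?_⟩)
    rw [← hf.degree_dComp (by ring) b, hb]
    rfl

end IsBiHom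

end GradedComplex

section Manifold

open scoped Manifold ContDiff Topology

variable {E : Type*} [NormedAddCommGroup E] [NormedSpace ℝ E]
variable {M : Type*} [TopologicalSpace M] [ChartedSpace E M]

variable (E M) in
/-- Not necessarily smooth complex-valued differential forms of mixed degree on a manifold. -/
abbrev RoughForm : Type _ := ∀ x : M, Form (TangentSpace 𝓘(ℝ, E) x)

theorem RoughForm.congr_point {p : ℕ} (α : RoughForm E M) {x x' : M} (h : x = x')
    (v : Fin p → TangentSpace 𝓘(ℝ, E) x) (v' : Fin p → TangentSpace 𝓘(ℝ, E) x')
    (hv : HEq v v') : α x p v = α x' p v' := by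
  subst h
  rw [eq_of_heq hv]

theorem hasMFDerivAt_congr_point {N : Type*} [TopologicalSpace N] [ChartedSpace E N] {f : M → N}
    {x x' : M} (h : x = x') (f' : E →L[ℝ] E) (H : HasMFDerivAt 𝓘(ℝ, E) 𝓘(ℝ, E) f x f') :
    HasMFDerivAt 𝓘(ℝ, E) 𝓘(ℝ, E) f x' f' := by
  subst h
  exact H

variable [FiniteDimensional ℝ E]

theorem continuous_alternating {p : ℕ} (a : E [⋀^Fin p]→ₗ[ℝ] ℂ) : Continuous a := by
  classical
  let b := Module.finBasis ℝ E
  have h : ∀ v : Fin p → E, a v = ∑ r : Fin p → Fin (Module.finrank ℝ E),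
      (∏ i, b.repr (v i) (r i)) • a (fun i => b (r i)) := by
    intro v
    conv_lhs => rw [show v = fun i => ∑ j, b.repr (v i) j • b j from
      funext fun i => (b.sum_repr (v i)).symm]
    change a.toMultilinearMap _ = _
    rw [MultilinearMap.map_sum]
    refine Finset.sum_congr rfl fun r _ => ?_
    rw [MultilinearMap.map_smul_univ]
    rfl
  rw [show (a : (Fin p → E) → ℂ) = _ from funext h]
  have hc : ∀ j, Continuous fun x : E => b.repr x j := fun j =>
    (b.coord j).continuous_of_finiteDimensional
  refine continuous_finsetSum _ fun r _ => ?_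
  have h1 : Continuous fun v : Fin p → E => ∏ i, b.repr (v i) (r i) :=
    continuous_finsetProd _ fun i _ => (hc (r i)).comp (continuous_apply i)
  exact h1.smul continuous_const

theorem inverse_comp_eq {Φ A D : E →L[ℝ] E} (hD : Function.Injective D) (h : D = Φ.comp A) :
    Φ.inverse.comp D = A := by
  have hDs : Function.Surjective D := (LinearMap.injective_iff_surjective (f := D.toLinearMap)).mp hD
  have hΦs : Function.Surjective Φ := fun v => by
    obtain ⟨w, rfl⟩ := hDs v
    exact ⟨A w, by rw [h]; rfl⟩
  have hΦi : Function.Injective Φ :=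
    (LinearMap.injective_iff_surjective (f := Φ.toLinearMap)).mpr hΦs
  let e : E ≃L[ℝ] E :=
    (LinearEquiv.ofBijective Φ.toLinearMap ⟨hΦi, hΦs⟩).toContinuousLinearEquiv
  have he : Φ = (e : E →L[ℝ] E) := by ext v; rfl
  rw [h, he, ContinuousLinearMap.inverse_equiv]
  ext v
  exact e.symm_apply_apply (A v)

/-- On a finite-dimensional space, alternating maps are continuous. -/
def toCont {p : ℕ} (a : E [⋀^Fin p]→ₗ[ℝ] ℂ) : E [⋀^Fin p]→L[ℝ] ℂ :=
  { a with cont := continuous_alternating a }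


/-- The expression of the degree `p` part of a differential form in the preferred chart at `x₀`,
that is, its pullback by the inverse of the chart. -/
def chartRep (α : RoughForm E M) (x₀ : M) (p : ℕ) (y : E) : E [⋀^Fin p]→L[ℝ] ℂ :=
  toCont ((α ((chartAt E x₀).symm y) p).compLinearMap
    (mfderiv 𝓘(ℝ, E) 𝓘(ℝ, E) (chartAt E x₀).symm y).toLinearMap)

/-- Smoothness of a differential form. -/
def IsSmooth (α : RoughForm E M) : Prop :=
  ∀ (x₀ : M) (p : ℕ), ContDiffOn ℝ ∞ (chartRep α x₀ p) (chartAt E x₀).target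

variable (E M) in
/-- The space of smooth complex-valued differential forms of mixed degree on a manifold. -/
def SmoothForm : Submodule ℂ (RoughForm E M) where
  carrier := {α | IsSmooth α}
  add_mem' hα hβ x₀ p := (hα x₀ p).add (hβ x₀ p)
  zero_mem' _ p := contDiffOn_const (c := (0 : E [⋀^Fin p]→L[ℝ] ℂ))
  smul_mem' c _ hα x₀ p := (hα x₀ p).const_smul c

/-- The exterior derivative: at `x`, it is the exterior derivative of the expression of the form in
the preferred chart at `x`, pulled back by the chart. -/
def extD (α : RoughForm E M) : RoughForm E M := fun x p => match p with
  | 0 => 0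
  | q + 1 => (extDeriv (chartRep α x q) (chartAt E x x)).toAlternatingMap.compLinearMap
      (mfderiv 𝓘(ℝ, E) 𝓘(ℝ, E) (chartAt E x) x).toLinearMap

theorem chartRep_extD [IsManifold 𝓘(ℝ, E) ∞ M] {α : RoughForm E M} (hα : IsSmooth α) (x₀ : M)
    (q : ℕ) {y : E} (hy : y ∈ (chartAt E x₀).target) :
    chartRep (extD α) x₀ (q + 1) y = extDeriv (chartRep α x₀ q) y := by
  set φ₀ := chartAt E x₀ with hφ₀
  set x := φ₀.symm y with hx
  set φ := chartAt E x with hφ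
  have hxs : x ∈ φ.source := mem_chart_source E x
  let τ : E → E := φ ∘ φ₀.symm
  have hs₀ : ∀ z ∈ φ₀.target, MDifferentiableAt 𝓘(ℝ, E) 𝓘(ℝ, E) φ₀.symm z := fun z hz =>
    mdifferentiableAt_atlas_symm (chart_mem_atlas E x₀) hz
  have hs : ∀ z ∈ φ.target, MDifferentiableAt 𝓘(ℝ, E) 𝓘(ℝ, E) φ.symm z := fun z hz =>
    mdifferentiableAt_atlas_symm (chart_mem_atlas E x) hz
  have hd : ∀ z ∈ φ.source, MDifferentiableAt 𝓘(ℝ, E) 𝓘(ℝ, E) φ z := fun z hz =>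
    mdifferentiableAt_atlas (chart_mem_atlas E x) hz
  have hW : (φ₀.symm.trans φ).source ∈ 𝓝 y :=
    (φ₀.symm.trans φ).open_source.mem_nhds ⟨hy, hxs⟩
  have hWt : ∀ z ∈ (φ₀.symm.trans φ).source, z ∈ φ₀.target ∧ φ₀.symm z ∈ φ.source :=
    fun z hz => hz
  have hτ : ContDiffAt ℝ ∞ τ y := by
    have h1 := contMDiffAt_of_mem_maximalAtlas (n := ∞) (I := 𝓘(ℝ, E))
      (IsManifold.chart_mem_maximalAtlas x) hxs
    have h2 := contMDiffOn_symm_of_mem_maximalAtlas (n := ∞) (I := 𝓘(ℝ, E))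
      (IsManifold.chart_mem_maximalAtlas x₀)
    have h3 := (h2 y hy).contMDiffAt (φ₀.open_target.mem_nhds hy)
    exact (h1.comp y h3).contDiffAt
  have hrep : DifferentiableAt ℝ (chartRep α x q) (τ y) := by
    have ht : τ y ∈ φ.target := φ.map_source hxs
    exact ((hα x q).contDiffAt (φ.open_target.mem_nhds ht)).differentiableAt (by simp)
  have hpull := extDeriv_pullback hrep hτ (r := ∞) (by simpa using ENat.LEInfty.out)
  have hev : (fun z => (chartRep α x q (τ z)).compContinuousLinearMap (fderiv ℝ τ z)) =ᶠ[𝓝 y]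
      chartRep α x₀ q := by
    filter_upwards [hW] with z hz
    obtain ⟨hz₀, hz₁⟩ := hWt z hz
    have hpt : φ.symm (τ z) = φ₀.symm z := φ.left_inv hz₁
    have ht : τ z ∈ φ.target := φ.map_source hz₁
    have hτz : MDifferentiableAt 𝓘(ℝ, E) 𝓘(ℝ, E) τ z := (hd _ hz₁).comp z (hs₀ z hz₀)
    have hcomp : mfderiv 𝓘(ℝ, E) 𝓘(ℝ, E) (φ.symm ∘ τ) z =
        (mfderiv 𝓘(ℝ, E) 𝓘(ℝ, E) φ.symm (τ z)).comp (mfderiv 𝓘(ℝ, E) 𝓘(ℝ, E) τ z) :=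
      mfderiv_comp z (hs _ ht) hτz
    have hloc : (φ.symm ∘ τ) =ᶠ[𝓝 z] φ₀.symm := by
      filter_upwards [(φ₀.symm.trans φ).open_source.mem_nhds hz] with w hw
      exact φ.left_inv (hWt w hw).2
    have h1 := hloc.mfderiv_eq (I := 𝓘(ℝ, E)) (I' := 𝓘(ℝ, E))
    rw [mfderiv_eq_fderiv] at hcomp
    ext v
    refine RoughForm.congr_point α hpt _ _ (heq_of_eq (funext fun i => ?_))
    exact (congrArg (fun f : E →L[ℝ] E => f (v i)) hcomp).symm.trans
      (congrArg (fun f : E →L[ℝ] E => f (v i)) h1)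
  rw [← hev.extDeriv_eq, hpull]
  have hcomp : mfderiv 𝓘(ℝ, E) 𝓘(ℝ, E) τ y =
      (mfderiv 𝓘(ℝ, E) 𝓘(ℝ, E) φ x).comp (mfderiv 𝓘(ℝ, E) 𝓘(ℝ, E) φ₀.symm y) :=
    mfderiv_comp y (hd _ hxs) (hs₀ y hy)
  rw [mfderiv_eq_fderiv] at hcomp
  ext v
  rw [hcomp]
  rfl

theorem IsSmooth.extD [IsManifold 𝓘(ℝ, E) ∞ M] {α : RoughForm E M} (hα : IsSmooth α) :
    IsSmooth (extD α) := by
  intro x₀ p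
  cases p with
  | zero => exact contDiffOn_const (c := (0 : E [⋀^Fin 0]→L[ℝ] ℂ))
  | succ q =>
    refine ContDiffOn.congr ?_ fun y hy => chartRep_extD hα x₀ q hy
    have := (hα x₀ q).fderiv_of_isOpen (m := ∞) (chartAt E x₀).open_target (by simp)
    exact (ContinuousAlternatingMap.alternatizeUncurryFinCLM ℝ E ℂ).contDiff.comp_contDiffOn this

theorem differentiableAt_chartRep {α : RoughForm E M} (hα : IsSmooth α) (x₀ : M) (q : ℕ) {y : E}
    (hy : y ∈ (chartAt E x₀).target) : DifferentiableAt ℝ (chartRep α x₀ q) y :=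
  ((hα x₀ q).contDiffAt ((chartAt E x₀).open_target.mem_nhds hy)).differentiableAt (by simp)

variable (E M) in
/-- The exterior derivative on smooth forms. -/
def smoothD [IsManifold 𝓘(ℝ, E) ∞ M] : SmoothForm E M →ₗ[ℂ] SmoothForm E M where
  toFun α := ⟨extD α.1, IsSmooth.extD α.2⟩
  map_add' α β := by
    refine Subtype.ext (funext fun x => funext fun p => ?_)
    cases p with
    | zero => exact (add_zero _).symm
    | succ q =>
      have hx : chartAt E x x ∈ (chartAt E x).target := mem_chart_target E x
      have h := extDeriv_add (differentiableAt_chartRep α.2 x q hx)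
        (differentiableAt_chartRep β.2 x q hx)
      ext v
      exact congrArg (fun f : E [⋀^Fin (q + 1)]→L[ℝ] ℂ =>
        f (fun i => mfderiv 𝓘(ℝ, E) 𝓘(ℝ, E) (chartAt E x) x (v i))) h
  map_smul' c α := by
    refine Subtype.ext (funext fun x => funext fun p => ?_)
    cases p with
    | zero => exact (smul_zero c).symm
    | succ q =>
      have h : extDeriv (c • chartRep α.1 x q) (chartAt E x x) =
          c • extDeriv (chartRep α.1 x q) (chartAt E x x) := by
        rw [extDeriv, fderiv_const_smul
          (differentiableAt_chartRep α.2 x q (mem_chart_target E x))]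
        exact ContinuousAlternatingMap.alternatizeUncurryFin_smul c _
      ext v
      exact congrArg (fun f : E [⋀^Fin (q + 1)]→L[ℝ] ℂ =>
        f (fun i => mfderiv 𝓘(ℝ, E) 𝓘(ℝ, E) (chartAt E x) x (v i))) h


/-- `𝒰ʲ`: the smooth forms with values in the bundle `Uʲ = ∧ⁿ⁻ʲ L̄ · K`, where the canonical line
bundle `K` is spanned by the nowhere vanishing form `ρ` and `L = Ann K`. -/
def sectionU (n : ℕ) (ρ : RoughForm E M) (j : ℤ) : Submodule ℂ (SmoothForm E M) where
  carrier := {α | ∀ x, α.1 x ∈ U n (ρ x) j}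
  add_mem' hα hβ x := (U n (ρ x) j).add_mem (hα x) (hβ x)
  zero_mem' x := (U n (ρ x) j).zero_mem
  smul_mem' c _ hα x := (U n (ρ x) j).smul_mem c (hα x)

theorem contDiff_pullback {p : ℕ} (a : E [⋀^Fin p]→L[ℝ] ℂ) :
    ContDiff ℝ ∞ fun f : E →L[ℝ] E => a.compContinuousLinearMap f := by
  let J : (E [⋀^Fin p]→L[ℝ] ℂ) →ₗ[ℝ] ContinuousMultilinearMap ℝ (fun _ : Fin p => E) ℂ :=
    ContinuousAlternatingMap.toContinuousMultilinearMapLinear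
  have hJ : LinearMap.ker J = ⊥ := LinearMap.ker_eq_bot.mpr
    ContinuousAlternatingMap.toContinuousMultilinearMap_injective
  let K : ContinuousMultilinearMap ℝ (fun _ : Fin p => E) ℂ →ₗ[ℝ]
      MultilinearMap ℝ (fun _ : Fin p => E) ℂ :=
    { toFun := fun f => f.toMultilinearMap, map_add' := fun _ _ => rfl, map_smul' := fun _ _ => rfl }
  have : FiniteDimensional ℝ (ContinuousMultilinearMap ℝ (fun _ : Fin p => E) ℂ) :=
    FiniteDimensional.of_injective K ContinuousMultilinearMap.toMultilinearMap_injective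
  obtain ⟨L, hL⟩ := J.exists_leftInverse_of_injective hJ
  have h1 : ContDiff ℝ ∞ fun f : E →L[ℝ] E => J (a.compContinuousLinearMap f) := by
    have h2 := ContinuousMultilinearMap.contDiff (𝕜 := ℝ) (n := ∞) (ι := Fin p)
      (E := fun _ => E →L[ℝ] E)
      (F := ContinuousMultilinearMap ℝ (fun _ : Fin p => E) ℂ →L[ℝ]
        ContinuousMultilinearMap ℝ (fun _ : Fin p => E) ℂ)
      (ContinuousMultilinearMap.compContinuousLinearMapContinuousMultilinear ℝ
        (fun _ : Fin p => E) (fun _ : Fin p => E) ℂ)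
    have h3 : ContDiff ℝ ∞ fun f : E →L[ℝ] E => fun _ : Fin p => f := contDiff_pi.mpr fun _ => contDiff_id
    exact (h2.comp h3).clm_apply contDiff_const
  have h4 := (LinearMap.toContinuousLinearMap L).contDiff (n := ∞) |>.comp h1
  convert h4 using 1
  funext f
  exact (congrArg (fun l => l (a.compContinuousLinearMap f)) hL).symm

end Manifold

section Nilmanifold

open scoped Manifold ContDiff Topology

variable {G : Type*} [Group G]

/-- The quotient `Γ \ G`, the space of cosets `Γ g`. -/
def Nilmanifold (Γ : Subgroup G) : Type _ := Quotient (QuotientGroup.rightRel Γ)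

/-- The projection `G → Γ \ G`. -/
def proj (Γ : Subgroup G) (g : G) : Nilmanifold Γ := Quotient.mk _ g

/-- The right translation `Γ g ↦ Γ g h`. -/
def rightMul {Γ : Subgroup G} (q : Nilmanifold Γ) (h : G) : Nilmanifold Γ :=
  Quotient.map' (s₁ := QuotientGroup.rightRel Γ) (s₂ := QuotientGroup.rightRel Γ) (fun g => g * h)
    (fun a b hab => by
      rw [QuotientGroup.rightRel_apply] at hab ⊢
      simpa [mul_assoc] using hab) q

theorem proj_eq_iff (Γ : Subgroup G) {a b : G} : proj Γ a = proj Γ b ↔ b * a⁻¹ ∈ Γ :=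
  Quotient.eq''.trans QuotientGroup.rightRel_apply

variable [TopologicalSpace G] (Γ : Subgroup G)

instance : TopologicalSpace (Nilmanifold Γ) :=
  inferInstanceAs (TopologicalSpace (Quotient (QuotientGroup.rightRel Γ)))

theorem isLocalHomeomorph_proj [IsTopologicalGroup G] [DiscreteTopology Γ] :
    IsLocalHomeomorph (proj Γ) :=
  (isQuotientMap_quotient_mk'.isQuotientCoveringMap_of_subgroup (f := proj Γ) Γ
    (isDiscrete_iff_discreteTopology.mpr inferInstance)
    (Quotient.eq''.trans QuotientGroup.rightRel_apply)).isCoveringMap.isLocalHomeomorph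

variable {E : Type*} [NormedAddCommGroup E] [NormedSpace ℝ E] [ChartedSpace E G]
  [LieGroup 𝓘(ℝ, E) ∞ G] [DiscreteTopology Γ]

/-- The charts of `Γ \ G` are the local inverses of the projection composed with charts of `G`. -/
instance : ChartedSpace E (Nilmanifold Γ) :=
  have : IsTopologicalGroup G := topologicalGroup_of_lieGroup 𝓘(ℝ, E) ∞
  (isLocalHomeomorph_proj Γ).chartedSpaceOfRightInverse (g := Quotient.out) Quotient.out_eq

theorem mem_atlas_nilmanifold {e : OpenPartialHomeomorph (Nilmanifold Γ) E}
    (he : e ∈ atlas E (Nilmanifold Γ)) :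
    ∃ (s : OpenPartialHomeomorph (Nilmanifold Γ) G) (g : G), (s.symm : G → Nilmanifold Γ) = proj Γ ∧
      e = s.trans (chartAt E g) := by
  have : IsTopologicalGroup G := topologicalGroup_of_lieGroup 𝓘(ℝ, E) ∞
  obtain ⟨q, rfl⟩ := he
  exact ⟨_, _, (isLocalHomeomorph_proj Γ).localInverseAt_symm _, rfl⟩

instance : IsManifold 𝓘(ℝ, E) ∞ (Nilmanifold Γ) := by
  have : IsTopologicalGroup G := topologicalGroup_of_lieGroup 𝓘(ℝ, E) ∞
  refine isManifold_of_contDiffOn _ _ _ fun e e' he he' => ?_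
  obtain ⟨s, g, hs, rfl⟩ := mem_atlas_nilmanifold Γ he
  obtain ⟨s', g', hs', rfl⟩ := mem_atlas_nilmanifold Γ he'
  intro y hy
  refine ContDiffAt.contDiffWithinAt ?_
  set ψ := chartAt E g
  set ψ' := chartAt E g'
  obtain ⟨⟨hy1, hy2⟩, hy3, hy4⟩ : (y ∈ ψ.target ∧ ψ.symm y ∈ s.target) ∧
      (s.symm (ψ.symm y) ∈ s'.source ∧ s' (s.symm (ψ.symm y)) ∈ ψ'.source) := by
    simpa using hy
  rw [hs] at hy3 hy4
  set h₀ := ψ.symm y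
  have h1 : proj Γ (s' (proj Γ h₀)) = proj Γ h₀ := by
    rw [← hs']; exact s'.left_inv (by rw [hs']; exact hy3)
  have hγ := (proj_eq_iff Γ).mp h1.symm
  set γ := s' (proj Γ h₀) * h₀⁻¹ with hγdef
  have hγ0 : γ * h₀ = s' (proj Γ h₀) := by simp [hγdef]
  have hev : ∀ᶠ h in 𝓝 h₀, s' (proj Γ h) = γ * h := by
    have hc : ContinuousAt (fun h => γ * h) h₀ := by fun_prop
    have : s'.target ∈ 𝓝 (γ * h₀) := by
      rw [hγ0]; exact s'.open_target.mem_nhds (s'.map_source hy3)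
    filter_upwards [hc this] with h hh
    have h2 : proj Γ h = s'.symm (γ * h) := by
      rw [hs']; exact (proj_eq_iff Γ).mpr (by simpa using hγ)
    rw [h2]; exact s'.right_inv hh
  have hψ : ContMDiffAt 𝓘(ℝ, E) 𝓘(ℝ, E) ∞ ψ.symm y :=
    (contMDiffOn_symm_of_mem_maximalAtlas (IsManifold.chart_mem_maximalAtlas g) y hy1).contMDiffAt
      (ψ.open_target.mem_nhds hy1)
  have hψ' : ContMDiffAt 𝓘(ℝ, E) 𝓘(ℝ, E) ∞ ψ' (γ * h₀) :=
    contMDiffAt_of_mem_maximalAtlas (IsManifold.chart_mem_maximalAtlas g') (by rw [hγ0]; exact hy4)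
  have hm : ContMDiffAt 𝓘(ℝ, E) 𝓘(ℝ, E) ∞ (fun h => γ * h) h₀ := contMDiffAt_mul_left
  have hmain : ContMDiffAt 𝓘(ℝ, E) 𝓘(ℝ, E) ∞ (fun z => ψ' (γ * ψ.symm z)) y :=
    hψ'.comp y (hm.comp y hψ)
  refine hmain.contDiffAt.congr_of_eventuallyEq ?_
  filter_upwards [(ψ.continuousAt_symm hy1).eventually hev] with z hz
  change ψ' (s' (s.symm (ψ.symm z))) = _
  rw [hs, hz]

instance : LieGroup 𝓘(ℝ, E) (minSmoothness ℝ 3) G :=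
  LieGroup.of_le (n := ∞) (by simpa using ENat.LEInfty.out)

/-- The derivative at `1` of `g ↦ q g`. It sends `X` in the Lie algebra to the value at `q` of the
vector field on `Γ \ G` induced by the left-invariant vector field `X` on `G`. -/
def frame (q : Nilmanifold Γ) : GroupLieAlgebra 𝓘(ℝ, E) G →L[ℝ] TangentSpace 𝓘(ℝ, E) q :=
  mfderiv 𝓘(ℝ, E) 𝓘(ℝ, E) (rightMul q) (1 : G)

/-- The form on `Γ \ G` induced by the left-invariant form on `G` given by `a`: it is the form whose
pullback by `frame q` is `a`, for all `q`. -/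
def invForm (a : Form (GroupLieAlgebra 𝓘(ℝ, E) G)) : RoughForm E (Nilmanifold Γ) := fun q =>
  Form.pullback (frame Γ q).inverse.toLinearMap a

variable [FiniteDimensional ℝ E]

theorem isSmooth_invForm (a : Form (GroupLieAlgebra 𝓘(ℝ, E) G)) : IsSmooth (invForm Γ a) := by
  have : IsTopologicalGroup G := topologicalGroup_of_lieGroup 𝓘(ℝ, E) ∞
  intro x₀ p y₀ hy₀
  refine ContDiffAt.contDiffWithinAt ?_
  obtain ⟨s, g, hs, he⟩ := mem_atlas_nilmanifold Γ (chart_mem_atlas E x₀)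
  set φ := chartAt E x₀ with hφ
  set ψ := chartAt E g
  set c := chartAt E (1 : G)
  have hsymm : ∀ z, φ.symm z = proj Γ (ψ.symm z) := fun z => by
    rw [he, ← hs]; rfl
  have htgt : ∀ z ∈ φ.target, z ∈ ψ.target := fun z hz => by
    rw [he] at hz
    exact hz.1
  let F : E → E → E := fun y z => c ((ψ.symm y)⁻¹ * ψ.symm z)
  let C : E →L[ℝ] E := mfderiv 𝓘(ℝ, E) 𝓘(ℝ, E) c.symm (c 1)
  have hψ : ∀ z ∈ ψ.target, ContMDiffAt 𝓘(ℝ, E) 𝓘(ℝ, E) ∞ ψ.symm z := fun z hz =>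
    (contMDiffOn_symm_of_mem_maximalAtlas (IsManifold.chart_mem_maximalAtlas g) z hz).contMDiffAt
      (ψ.open_target.mem_nhds hz)
  have hc1 : (1 : G) ∈ c.source := mem_chart_source E 1
  have hc : ContMDiffAt 𝓘(ℝ, E) 𝓘(ℝ, E) ∞ c 1 :=
    contMDiffAt_of_mem_maximalAtlas (IsManifold.chart_mem_maximalAtlas 1) hc1
  have hF : ∀ y ∈ ψ.target, ContDiffAt ℝ ∞ (Function.uncurry F) (y, y) := fun y hy => by
    have h1 : ContMDiffAt 𝓘(ℝ, E × E) 𝓘(ℝ, E) ∞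
        (fun w : E × E => (ψ.symm w.1)⁻¹ * ψ.symm w.2) (y, y) := by
      have hf : ContMDiffAt 𝓘(ℝ, E × E) 𝓘(ℝ, E) ∞ (Prod.fst : E × E → E) (y, y) :=
        contDiff_fst.contMDiff.contMDiffAt
      have hg : ContMDiffAt 𝓘(ℝ, E × E) 𝓘(ℝ, E) ∞ (Prod.snd : E × E → E) (y, y) :=
        contDiff_snd.contMDiff.contMDiffAt
      exact (((hψ y hy).comp (y, y) hf).inv).mul ((hψ y hy).comp (y, y) hg)
    have h2 : ContMDiffAt 𝓘(ℝ, E × E) 𝓘(ℝ, E) ∞ (Function.uncurry F) (y, y) := by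
      refine ContMDiffAt.comp (g := c) (f := fun w : E × E => (ψ.symm w.1)⁻¹ * ψ.symm w.2) (y, y)
        ?_ h1
      simpa using hc
    exact h2.contDiffAt
  have key : ∀ y ∈ φ.target, ((frame Γ (φ.symm y)).inverse.comp
      (mfderiv 𝓘(ℝ, E) 𝓘(ℝ, E) φ.symm y) : E →L[ℝ] E) = C.comp (fderiv ℝ (F y) y) := by
    intro y hy
    have hyψ := htgt y hy
    set h := ψ.symm y with hh
    have hFyy : F y y = c 1 := by simp [F]
    have hFd : MDifferentiableAt 𝓘(ℝ, E) 𝓘(ℝ, E) (F y) y := by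
      have h1 : ContDiffAt ℝ ∞ (F y) y :=
        (hF y hyψ).comp y (contDiffAt_const.prodMk contDiffAt_id)
      exact (h1.differentiableAt (by simp)).mdifferentiableAt
    have hcs : MDifferentiableAt 𝓘(ℝ, E) 𝓘(ℝ, E) c.symm (F y y) := by
      rw [hFyy]
      exact mdifferentiableAt_atlas_symm (chart_mem_atlas E 1) (mem_chart_target E 1)
    have hφd : MDifferentiableAt 𝓘(ℝ, E) 𝓘(ℝ, E) φ.symm y :=
      mdifferentiableAt_atlas_symm (chart_mem_atlas E x₀) hy
    have hhs : h ∈ ψ.source := ψ.map_target hyψ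
    have hψh : ψ h = y := ψ.right_inv hyψ
    let P : G → Nilmanifold Γ := rightMul (φ.symm y)
    have hPdef : ∀ k, P k = proj Γ (h * k) := fun k => by
      change rightMul (φ.symm y) k = _
      rw [hsymm]; rfl
    have hPd : MDifferentiableAt 𝓘(ℝ, E) 𝓘(ℝ, E) P 1 := by
      have h1 : MDifferentiableAt 𝓘(ℝ, E) 𝓘(ℝ, E) (fun k : G => ψ (h * k)) 1 := by
        refine MDifferentiableAt.comp (g := ψ) (f := fun k : G => h * k) 1 ?_
          ((contMDiffAt_mul_left (n := ∞)).mdifferentiableAt (by simp))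
        exact mdifferentiableAt_atlas (chart_mem_atlas E g) (by simpa using hhs)
      have h2 : MDifferentiableAt 𝓘(ℝ, E) 𝓘(ℝ, E) (fun k : G => φ.symm (ψ (h * k))) 1 := by
        refine MDifferentiableAt.comp (g := φ.symm) (f := fun k : G => ψ (h * k)) 1 ?_ h1
        simpa [hψh] using hφd
      refine h2.congr_of_eventuallyEq ?_
      have hcont : ContinuousAt (fun k : G => h * k) 1 := by fun_prop
      have hnhds : ψ.source ∈ 𝓝 (h * 1) := by
        rw [mul_one]; exact ψ.open_source.mem_nhds hhs
      filter_upwards [hcont hnhds] with k hk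
      rw [hPdef, hsymm, ψ.left_inv hk]
    have hc1' : c.symm (F y y) = 1 := by rw [hFyy, c.left_inv hc1]
    have hP' : HasMFDerivAt 𝓘(ℝ, E) 𝓘(ℝ, E) P (c.symm (F y y))
        (frame Γ (φ.symm y) : E →L[ℝ] E) :=
      hasMFDerivAt_congr_point hc1'.symm _ hPd.hasMFDerivAt
    have hC' : HasMFDerivAt 𝓘(ℝ, E) 𝓘(ℝ, E) c.symm (F y y) (C : E →L[ℝ] E) := by
      have := hcs
      rw [hFyy] at this
      exact hasMFDerivAt_congr_point hFyy.symm _ this.hasMFDerivAt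
    have hF' : HasMFDerivAt 𝓘(ℝ, E) 𝓘(ℝ, E) (F y) y (fderiv ℝ (F y) y) :=
      (mdifferentiableAt_iff_differentiableAt.mp hFd).hasFDerivAt.hasMFDerivAt
    have hcomp := hP'.comp y (hC'.comp y hF')
    have hev : (P ∘ c.symm ∘ F y) =ᶠ[𝓝 y] φ.symm := by
      have hcont : ContinuousAt (fun z => h⁻¹ * ψ.symm z) y :=
        continuousAt_const.mul (ψ.continuousAt_symm hyψ)
      have hnhds : c.source ∈ 𝓝 (h⁻¹ * ψ.symm y) := by
        rw [← hh, inv_mul_cancel]; exact c.open_source.mem_nhds hc1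
      filter_upwards [hcont hnhds] with z hz
      change P (c.symm (c (h⁻¹ * ψ.symm z))) = _
      rw [c.left_inv hz, hPdef, mul_inv_cancel_left, hsymm]
    have hD := hφd.hasMFDerivAt
    have heq := hasMFDerivAt_unique hD (hcomp.congr_of_eventuallyEq hev.symm)
    refine inverse_comp_eq (E := E) ?_ heq
    have hφy : MDifferentiableAt 𝓘(ℝ, E) 𝓘(ℝ, E) φ (φ.symm y) :=
      mdifferentiableAt_atlas (chart_mem_atlas E x₀) (φ.map_target hy)
    have hid : (φ ∘ φ.symm) =ᶠ[𝓝 y] id := by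
      filter_upwards [φ.open_target.mem_nhds hy] with z hz
      exact φ.right_inv hz
    have hid' := hasMFDerivAt_unique (hφy.hasMFDerivAt.comp y hD)
      ((hasMFDerivAt_id y).congr_of_eventuallyEq hid)
    refine Function.LeftInverse.injective (g := mfderiv 𝓘(ℝ, E) 𝓘(ℝ, E) φ (φ.symm y)) fun v => ?_
    exact congrArg (fun l : E →L[ℝ] E => l v) hid'
  have hFs : ContDiffAt ℝ ∞ (fun y => C.comp (fderiv ℝ (F y) y)) y₀ := by
    have h1 : ContDiffAt ℝ ∞ (fun y => fderiv ℝ (F y) y) y₀ :=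
      ContDiffAt.fderiv (g := fun y => y) (hF y₀ (htgt y₀ hy₀)) contDiffAt_id (by simp)
    exact contDiffAt_const.clm_comp h1
  refine ((contDiff_pullback (toCont (E := E) (a p))).contDiffAt.comp y₀ hFs).congr_of_eventuallyEq
    ?_
  filter_upwards [φ.open_target.mem_nhds hy₀] with y hy
  ext v
  exact congrArg (fun l : E →L[ℝ] E => (a p : E [⋀^Fin p]→ₗ[ℝ] ℂ) fun i => l (v i)) (key y hy)

/-- The inclusion of forms on the Lie algebra, seen as left-invariant forms, into the forms on
`Γ \ G`. -/
def incl : Form (GroupLieAlgebra 𝓘(ℝ, E) G) →ₗ[ℂ] SmoothForm E (Nilmanifold Γ) where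
  toFun a := ⟨invForm Γ a, isSmooth_invForm Γ a⟩
  map_add' _ _ := rfl
  map_smul' _ _ := rfl

end Nilmanifold
end GenCx

end

noncomputable section

namespace GenCx

/-! ### The invariant probability measure on `Γ \ G` -/

section InvariantMeasure

open MeasureTheory Set
open scoped Topology ENNReal

variable {G : Type*} [Group G] (Γ : Subgroup G)

/-! The left-invariant vector fields descend to a global frame of the tangent bundle of `Γ \ G`. In
this frame a smooth form is a smooth function from `Γ \ G` to the finite-dimensional space of forms
on the Lie algebra (`coeff`, `contMDiff_coeff`), and the left-invariant forms are the constant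
functions (`coeff_invForm`). Averaging is integration of this function against `ν`, so it is a left
inverse of the inclusion as soon as `ν` has total mass one.

Averaging commutes with `d`. By Koszul's formula (`coeff_extD`) the coefficients of `dα` are
derivatives of coefficients of `α` along frame fields plus the Chevalley–Eilenberg differential
applied pointwise. The second part is linear and passes through the integral. The first part
integrates to zero: frame fields generate right translations, which preserve `ν`
(`integral_fieldDeriv_eq_zero`). The measure is a Haar measure of `G` restricted to a fundamental
domain and pushed down; finite covolume forces Haar measure to be right-invariant
(`exists_invariant_probabilityMeasure`). For the inclusion the coefficients are constant, so only
the algebraic part of the formula survives (`extD_invForm`).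

Both maps respect the gradings. The frame carries `ρ` to its induced form at every point, so lying
in `𝒰ʲ` means that the coefficient function takes values in the linear subspace `𝔘ʲ`
(`mem_sectionU_invForm`), and the integral of such a function stays in `𝔘ʲ` (`average_mem_U`). Since
`∂` and `∂̄` are components of `d` for the direct sum decompositions, a graded chain map commutes
with them (`IsBiHom.of_isInternal`). Injectivity on cohomology is then functoriality.

What remains is that the `𝔘ʲ` do decompose the forms (`IsNondegeneratePure.isInternal_U`).
Nondegeneracy gives `L + L̄ = (V ⊕ V*) ⊗ ℂ` (`IsNondegeneratePure.Ann_sup_Ann_conj`). Then the sum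
of the `𝔘ʲ` is a nonzero Clifford submodule, hence everything by irreducibility, and the `𝔘ʲ` lie in
eigenspaces of a number operator for distinct eigenvalues, hence are independent (`iSup_U_eq_top`,
`iSupIndep_U`). The decomposition passes to `Γ \ G` by expanding forms in invariant ones with
function coefficients (`isInternal_sectionU`). -/

theorem surjective_proj : Function.Surjective (proj Γ) := Quotient.exists_rep

variable {Γ} in
theorem rightMul_proj (g h : G) : rightMul (proj Γ g) h = proj Γ (g * h) := rfl

variable {Γ} in
theorem rightMul_mul (q : Nilmanifold Γ) (h k : G) :
    rightMul q (h * k) = rightMul (rightMul q h) k := by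
  obtain ⟨g, rfl⟩ := surjective_proj Γ q
  simp [rightMul_proj, mul_assoc]

variable {Γ} in
theorem rightMul_one (q : Nilmanifold Γ) : rightMul q 1 = q := by
  obtain ⟨g, rfl⟩ := surjective_proj Γ q
  simp [rightMul_proj]

variable {Γ} in
theorem proj_smul (γ : Γ) (g : G) : proj Γ (γ • g) = proj Γ g :=
  (proj_eq_iff Γ).mpr (by
    have : g * (γ • g)⁻¹ = ((γ⁻¹ : Γ) : G) := by simp [Subgroup.smul_def]
    rw [this]
    exact (γ⁻¹).2)

variable {Γ} in
theorem exists_smul_eq_of_proj_eq {a b : G} (h : proj Γ a = proj Γ b) : ∃ γ : Γ, γ • a = b :=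
  ⟨⟨b * a⁻¹, (proj_eq_iff Γ).mp h⟩, by simp [Subgroup.smul_def]⟩

variable [TopologicalSpace G]

theorem continuous_proj : Continuous (proj Γ) := continuous_quotient_mk'

variable [IsTopologicalGroup G]

theorem continuous_rightMul (h : G) : Continuous fun q : Nilmanifold Γ => rightMul q h :=
  continuous_quot_lift _ ((continuous_proj Γ).comp (continuous_mul_const h))

variable [DiscreteTopology Γ]

/-- A Borel set of representatives for `Γ \ G`, contained in a compact set. -/
theorem exists_strict_fundamentalDomain [LocallyCompactSpace G] [CompactSpace (Nilmanifold Γ)]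
    [MeasurableSpace G] [BorelSpace G] :
    ∃ F K : Set G, MeasurableSet F ∧ IsCompact K ∧ F ⊆ K ∧ ∀ x : G, ∃! γ : Γ, γ • x ∈ F := by
  have hloc := isLocalHomeomorph_proj Γ
  have hU : ∀ g : G, ∃ U K : Set G, g ∈ U ∧ IsOpen U ∧ U ⊆ K ∧ IsCompact K ∧
      InjOn (proj Γ) U := fun g => by
    obtain ⟨e, hg, he⟩ := hloc g
    obtain ⟨K, hK, hgK⟩ := exists_compact_mem_nhds g
    refine ⟨e.source ∩ interior K, K, ⟨hg, mem_interior_iff_mem_nhds.mpr hgK⟩,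
      e.open_source.inter isOpen_interior, inter_subset_right.trans interior_subset, hK, ?_⟩
    rw [he]
    exact e.injOn.mono inter_subset_left
  choose U K hgU hUo hUK hK hinj using hU
  obtain ⟨t, ht⟩ := isCompact_univ.elim_finite_subcover (fun g => proj Γ '' U g)
    (fun g => hloc.isOpenMap _ (hUo g)) (fun q _ => by
      obtain ⟨g, rfl⟩ := surjective_proj Γ q
      exact mem_iUnion.mpr ⟨g, g, hgU g, rfl⟩)
  let e := t.equivFin.symm
  let W : Fin t.card → Set (Nilmanifold Γ) := fun i => proj Γ '' U (e i)
  let _ : MeasurableSpace (Nilmanifold Γ) := borel _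
  have : BorelSpace (Nilmanifold Γ) := ⟨rfl⟩
  have hWm : ∀ i, MeasurableSet (disjointed W i) := fun i =>
by
    rw [disjointed_eq_inter_compl]
    exact (hloc.isOpenMap _ (hUo _)).measurableSet.inter (MeasurableSet.iInter fun j =>
      MeasurableSet.iInter fun _ => (hloc.isOpenMap _ (hUo _)).measurableSet.compl)
  have hW : ∀ q, ∃ i, q ∈ disjointed W i := fun q => by
    have h1 : q ∈ ⋃ i, W i := by
      obtain ⟨g, hg, hq⟩ := mem_iUnion₂.mp (ht (mem_univ q))
      exact mem_iUnion.mpr ⟨t.equivFin ⟨g, hg⟩, by simpa [W, e] using hq⟩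
    rw [← iUnion_disjointed] at h1
    exact mem_iUnion.mp h1
  -- The images in the quotient are made disjoint, not the sets `U` themselves: each orbit then
  -- meets only the piece of one index `i`, and meets it once because `proj` is injective on `U (e
  -- i)`.
  refine ⟨⋃ i, U (e i) ∩ proj Γ ⁻¹' disjointed W i, ⋃ i, K (e i),
    MeasurableSet.iUnion fun i => (hUo _).measurableSet.inter
      ((continuous_proj Γ).measurable (hWm i)),
    isCompact_iUnion fun i => hK _,
    iUnion_mono fun i => inter_subset_left.trans (hUK _), fun x => ?_⟩
  obtain ⟨i, hi⟩ := hW (proj Γ x)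
  obtain ⟨u, hu, hux⟩ := disjointed_subset W i hi
  obtain ⟨γ, rfl⟩ := exists_smul_eq_of_proj_eq hux.symm
  have key : ∀ γ' : Γ, γ' • x ∈ ⋃ i, U (e i) ∩ proj Γ ⁻¹' disjointed W i → γ' • x ∈ U (e i) := by
    intro γ' hγ'
    obtain ⟨j, hj1, hj2⟩ := mem_iUnion.mp hγ'
    rw [mem_preimage, proj_smul] at hj2
    have hij : i = j := by
      by_contra hne
      exact (disjoint_left.mp (disjoint_disjointed W hne)) hi hj2
    exact hij ▸ hj1
  refine ⟨γ, mem_iUnion.mpr ⟨i, hu, by rwa [mem_preimage, proj_smul]⟩, fun γ' hγ' => ?_⟩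
  have := hinj (e i) (key γ' hγ') hu (by rw [proj_smul, proj_smul])
  exact Subtype.ext (mul_right_cancel this)

/-- A compact quotient of a group by a discrete subgroup carries an invariant probability
measure. -/
theorem exists_invariant_probabilityMeasure [T2Space G] [SecondCountableTopology G]
    [LocallyCompactSpace G] [CompactSpace (Nilmanifold Γ)]
    [MeasurableSpace (Nilmanifold Γ)] [BorelSpace (Nilmanifold Γ)] :
    ∃ ν : Measure (Nilmanifold Γ), IsProbabilityMeasure ν ∧
      ∀ h : G, ν.map (fun q => rightMul q h) = ν := by
  let _ : MeasurableSpace G := borel G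
  have : BorelSpace G := ⟨rfl⟩
  obtain ⟨F, K, hFm, hK, hFK, hF⟩ := exists_strict_fundamentalDomain Γ
  let m : Measure G := Measure.haar
  have : Countable Γ := TopologicalSpace.separableSpace_iff_countable.mp inferInstance
  -- Right translation commutes with the left action of `Γ`, so right translates of `F` are again
  -- fundamental domains and have the same left Haar measure as `F`.
  have hFd : ∀ h : G, IsFundamentalDomain Γ ((fun x => x * h) ⁻¹' F) m := fun h =>
    IsFundamentalDomain.mk' ((measurable_mul_const h) hFm).nullMeasurableSet fun x => by
      obtain ⟨γ, h1, h2⟩ := hF (x * h)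
      exact ⟨γ, by simpa [smul_mul_assoc] using h1,
        fun γ' h' => h2 γ' (by simpa [smul_mul_assoc] using h')⟩
  have hFd1 : IsFundamentalDomain Γ F m := by simpa using hFd 1
  have hF0 : m F ≠ 0 := hFd1.measure_ne_zero (NeZero.ne m)
  have hFt : m F ≠ ∞ := ((measure_mono hFK).trans_lt hK.measure_lt_top).ne
  -- Unimodularity: the right translate of `m` is left-invariant, hence equal to `c • m`, and
  -- comparing values on `F`, of finite nonzero measure, gives `c = 1`.
  have hright : ∀ h : G, m.map (fun x => x * h) = m := fun h => by
    have h1 := Measure.isMulLeftInvariant_eq_smul (m.map (fun x => x * h)) m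
    set c := Measure.haarScalarFactor (m.map (fun x => x * h)) m
    have h2 := congrArg (fun l : Measure G => l F) h1
    simp only [Measure.smul_apply] at h2
    rw [Measure.map_apply (measurable_mul_const h) hFm, (hFd h).measure_eq hFd1] at h2
    have h3 : (c : ℝ≥0∞) = 1 := by
      have h4 : (c : ℝ≥0∞) * m F = 1 * m F := by rw [one_mul]; exact h2.symm
      exact (ENNReal.mul_left_inj hF0 hFt).mp h4
    rw [h1, show c = 1 by exact_mod_cast h3, one_smul]
  have hpm : Measurable (proj Γ) := (continuous_proj Γ).measurable
  have hrm : ∀ h : G, Measurable fun q : Nilmanifold Γ => rightMul q h := fun h =>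
    (continuous_rightMul Γ h).measurable
  refine ⟨(m F)⁻¹ • (m.restrict F).map (proj Γ), ⟨?_⟩, fun h => ?_⟩
  · rw [Measure.smul_apply, Measure.map_apply hpm MeasurableSet.univ]
    simp [ENNReal.inv_mul_cancel hF0 hFt]
  · rw [Measure.map_smul]
    congr 1
    ext A hA
    rw [Measure.map_apply (hrm h) hA, Measure.map_apply hpm (hrm h hA), Measure.map_apply hpm hA,
      Measure.restrict_apply (hpm (hrm h hA)), Measure.restrict_apply (hpm hA)]
    -- Translating the set moves `F` to another fundamental domain. The set `proj Γ ⁻¹' A` is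
    -- `Γ`-invariant, so its measure can be computed in either domain.
    have h1 : proj Γ ⁻¹' ((fun q => rightMul q h) ⁻¹' A) ∩ F =
        (fun x => x * h) ⁻¹' (proj Γ ⁻¹' A ∩ (fun x => x * h⁻¹) ⁻¹' F) := by
      ext x
      simp [rightMul_proj]
    rw [h1, ← Measure.map_apply (measurable_mul_const h)
      ((hpm hA).inter ((measurable_mul_const h⁻¹) hFm)), hright]
    exact (hFd h⁻¹).measure_set_eq hFd1 (hpm hA) fun γ => by
      ext x
      simp [proj_smul]

end InvariantMeasure

/-! ### The projection and the frame of left-invariant vector fields -/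

section Frame

open scoped Manifold ContDiff Topology

variable {E : Type*} [NormedAddCommGroup E] [NormedSpace ℝ E]
  {G : Type*} [Group G] [TopologicalSpace G] [ChartedSpace E G] [LieGroup 𝓘(ℝ, E) ∞ G]
  (Γ : Subgroup G) [DiscreteTopology Γ]

/-- The preferred chart at `q` is the local inverse of `proj` at the representative `Quotient.out
q`, followed by the chart of `G` there. Hence the two charts provide the same coordinates. -/
theorem chartAt_symm_nilmanifold (q : Nilmanifold Γ) (z : E) :
    (chartAt E q).symm z = proj Γ ((chartAt E (Quotient.out q : G)).symm z) := by
  have : IsTopologicalGroup G := topologicalGroup_of_lieGroup 𝓘(ℝ, E) ∞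
  have h := (isLocalHomeomorph_proj Γ).localInverseAt_symm (Quotient.out q : G)
  rw [← h]
  rfl

theorem chartAt_nilmanifold_self (q : Nilmanifold Γ) :
    chartAt E q q = chartAt E (Quotient.out q : G) (Quotient.out q : G) := by
  have : IsTopologicalGroup G := topologicalGroup_of_lieGroup 𝓘(ℝ, E) ∞
  have h : (isLocalHomeomorph_proj Γ).localInverseAt (Quotient.out q : G) q = Quotient.out q :=
    (congrArg ((isLocalHomeomorph_proj Γ).localInverseAt (Quotient.out q : G))
      (Quotient.out_eq q).symm).trans (isLocalHomeomorph_proj Γ).localInverseAt_apply_self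
  exact congrArg (chartAt E (Quotient.out q : G)) h

theorem target_chartAt_nilmanifold_subset (q : Nilmanifold Γ) :
    (chartAt E q).target ⊆ (chartAt E (Quotient.out q : G)).target := fun _ hz => hz.1

/-- Near every point, the projection `G → Γ \ G` has the form `g ↦ φ⁻¹ (ψ (γ g))` in terms of the
preferred charts of `Γ \ G` and `G`. -/
theorem exists_proj_eventuallyEq (g : G) : ∃ γ : G, γ * g = (Quotient.out (proj Γ g) : G) ∧
    (∀ h, proj Γ (γ * h) = proj Γ h) ∧
    ∀ᶠ h in 𝓝 g, proj Γ h =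
      (chartAt E (proj Γ g)).symm (chartAt E (Quotient.out (proj Γ g) : G) (γ * h)) := by
  have : IsTopologicalGroup G := topologicalGroup_of_lieGroup 𝓘(ℝ, E) ∞
  -- The chart at `proj Γ g` is built from the chosen representative, which differs from `g` by an
  -- element of `Γ`.
  obtain ⟨γ, hγ⟩ := exists_smul_eq_of_proj_eq
    (show proj Γ g = proj Γ (Quotient.out (proj Γ g) : G) from (Quotient.out_eq _).symm)
  refine ⟨γ, hγ, fun h => proj_smul γ h, ?_⟩
  have hc : ContinuousAt (fun h => (γ : G) * h) g := by fun_prop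
  have hn : (chartAt E (Quotient.out (proj Γ g) : G)).source ∈ 𝓝 ((γ : G) * g) := by
    have : (γ : G) * g = Quotient.out (proj Γ g) := hγ
    rw [this]
    exact chart_source_mem_nhds E _
  filter_upwards [hc hn] with h hh
  rw [chartAt_symm_nilmanifold, (chartAt E _).left_inv hh]
  exact (proj_smul γ h).symm

theorem contMDiff_proj : ContMDiff 𝓘(ℝ, E) 𝓘(ℝ, E) ∞ (proj Γ) := by
  intro g
  obtain ⟨γ, hγ, -, hev⟩ := exists_proj_eventuallyEq (E := E) Γ g
  refine ContMDiffAt.congr_of_eventuallyEq ?_ hev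
  have h1 : ContMDiffAt 𝓘(ℝ, E) 𝓘(ℝ, E) ∞ (fun h => γ * h) g := contMDiffAt_mul_left
  have h2 : ContMDiffAt 𝓘(ℝ, E) 𝓘(ℝ, E) ∞
      (fun h => chartAt E (Quotient.out (proj Γ g) : G) (γ * h)) g :=
    ContMDiffAt.comp (g := chartAt E (Quotient.out (proj Γ g) : G)) g
      (contMDiffAt_of_mem_maximalAtlas (IsManifold.chart_mem_maximalAtlas _)
        (by rw [hγ]; exact mem_chart_source E _)) h1
  refine ContMDiffAt.comp (g := (chartAt E (proj Γ g)).symm) g ?_ h2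
  rw [hγ, ← chartAt_nilmanifold_self]
  exact (contMDiffOn_symm_of_mem_maximalAtlas (IsManifold.chart_mem_maximalAtlas (proj Γ g)) _
    (mem_chart_target E _)).contMDiffAt ((chartAt E _).open_target.mem_nhds (mem_chart_target E _))

/-- Inverts the local expression of `exists_proj_eventuallyEq`. It serves to show that the frame has
a left inverse, so differentiability at one point suffices. -/
theorem exists_local_section (g : G) : ∃ σ : Nilmanifold Γ → G,
    MDifferentiableAt 𝓘(ℝ, E) 𝓘(ℝ, E) σ (proj Γ g) ∧ ∀ᶠ h in 𝓝 g, σ (proj Γ h) = h := by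
  have : IsTopologicalGroup G := topologicalGroup_of_lieGroup 𝓘(ℝ, E) ∞
  obtain ⟨γ, hγ, -, hev⟩ := exists_proj_eventuallyEq (E := E) Γ g
  set q := proj Γ g
  set ψ := chartAt E (Quotient.out q : G)
  refine ⟨fun x => γ⁻¹ * ψ.symm (chartAt E q x), ?_, ?_⟩
  · have h1 : MDifferentiableAt 𝓘(ℝ, E) 𝓘(ℝ, E) (chartAt E q) q :=
      mdifferentiableAt_atlas (chart_mem_atlas E q) (mem_chart_source E q)
    have h2 : MDifferentiableAt 𝓘(ℝ, E) 𝓘(ℝ, E) ψ.symm (chartAt E q q) :=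
      mdifferentiableAt_atlas_symm (chart_mem_atlas E _)
        (target_chartAt_nilmanifold_subset Γ q (mem_chart_target E q))
    have h3 : MDifferentiableAt 𝓘(ℝ, E) 𝓘(ℝ, E) (fun k : G => γ⁻¹ * k)
        (ψ.symm (chartAt E q q)) := (contMDiffAt_mul_left (n := ∞)).mdifferentiableAt (by simp)
    exact h3.comp q (h2.comp q h1)
  · have hc : ContinuousAt (fun h => ψ (γ * h)) g := by
      have h1 : ContinuousAt ψ (γ * g) := ψ.continuousAt (by rw [hγ]; exact mem_chart_source E _)
      exact h1.comp (by fun_prop)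
    have hn : (chartAt E q).target ∈ 𝓝 (ψ (γ * g)) := by
      rw [hγ, ← chartAt_nilmanifold_self]
      exact (chartAt E q).open_target.mem_nhds (mem_chart_target E q)
    have hc' : ContinuousAt (fun h => γ * h) g := by fun_prop
    have hn' : ψ.source ∈ 𝓝 (γ * g) := by
      rw [hγ]; exact chart_source_mem_nhds E _
    filter_upwards [hev, hc hn, hc' hn'] with h h1 h2 h3
    rw [h1, (chartAt E q).right_inv h2, ψ.left_inv h3, inv_mul_cancel_left]

variable {Γ}

theorem contMDiff_rightMul (q : Nilmanifold Γ) : ContMDiff 𝓘(ℝ, E) 𝓘(ℝ, E) ∞ (rightMul q) := by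
  obtain ⟨g, rfl⟩ := surjective_proj Γ q
  exact (contMDiff_proj Γ).comp (contMDiff_mul_left (a := g))

/-- Differentiate `(q h) k = q (h k)` in `k` at `1`: left translation by `h` sends `X` to the value
at `h` of the left-invariant field. -/
theorem mfderiv_rightMul_apply (q : Nilmanifold Γ) (h : G) (X : GroupLieAlgebra 𝓘(ℝ, E) G) :
    (mfderiv 𝓘(ℝ, E) 𝓘(ℝ, E) (rightMul q) h : E →L[ℝ] E) (mulInvariantVectorField X h) =
      frame Γ (rightMul q h) X := by
  have h1 : rightMul (rightMul q h) = rightMul q ∘ fun k => h * k := by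
    funext k
    exact (rightMul_mul q h k).symm
  have h2 : MDifferentiableAt 𝓘(ℝ, E) 𝓘(ℝ, E) (rightMul q) (h * 1) :=
    (contMDiff_rightMul q).contMDiffAt.mdifferentiableAt (by simp)
  have h3 : MDifferentiableAt 𝓘(ℝ, E) 𝓘(ℝ, E) (fun k : G => h * k) 1 :=
    (contMDiffAt_mul_left (n := ∞)).mdifferentiableAt (by simp)
  have h4 := mfderiv_comp (1 : G) h2 h3
  rw [← h1] at h4
  have h5 : (mfderiv 𝓘(ℝ, E) 𝓘(ℝ, E) (rightMul q) (h * 1) : E →L[ℝ] E) =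
      mfderiv 𝓘(ℝ, E) 𝓘(ℝ, E) (rightMul q) h := by rw [mul_one]
  rw [frame, h4]
  exact congrArg (fun l : E →L[ℝ] E =>
    l ((mfderiv 𝓘(ℝ, E) 𝓘(ℝ, E) (fun k : G => h * k) 1 : E →L[ℝ] E) X)) h5.symm

theorem mfderiv_proj_apply (g : G) (X : GroupLieAlgebra 𝓘(ℝ, E) G) :
    (mfderiv 𝓘(ℝ, E) 𝓘(ℝ, E) (proj Γ) g : E →L[ℝ] E) (mulInvariantVectorField X g) =
      frame Γ (proj Γ g) X := by
  have h1 : rightMul (proj Γ (1 : G)) = proj Γ := by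
    funext k
    simp [rightMul_proj]
  have h2 := mfderiv_rightMul_apply (E := E) (proj Γ (1 : G)) g X
  rw [h1] at h2
  exact h2

/-- With a local section `σ` of the projection, `g⁻¹ σ (Γ g k) = k` for `k` near `1`; the derivative
of this identity provides a left inverse. -/
theorem frame_injective (q : Nilmanifold Γ) :
    Function.Injective (frame Γ q : GroupLieAlgebra 𝓘(ℝ, E) G → E) := by
  have : IsTopologicalGroup G := topologicalGroup_of_lieGroup 𝓘(ℝ, E) ∞
  obtain ⟨g, rfl⟩ := surjective_proj Γ q
  obtain ⟨σ, hσ, hev⟩ := exists_local_section (E := E) Γ g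
  have h1 : (fun k => g⁻¹ * σ (rightMul (proj Γ g) k)) =ᶠ[𝓝 (1 : G)] id := by
    have hc : Filter.Tendsto (fun k => g * k) (𝓝 1) (𝓝 g) := by
      have : ContinuousAt (fun k => g * k) 1 := by fun_prop
      simpa [ContinuousAt] using this
    filter_upwards [hc hev] with k hk
    rw [rightMul_proj]
    change g⁻¹ * σ (proj Γ (g * k)) = k
    rw [show σ (proj Γ (g * k)) = g * k from hk, inv_mul_cancel_left]
  have hf : HasMFDerivAt 𝓘(ℝ, E) 𝓘(ℝ, E) (rightMul (proj Γ g)) (1 : G) (frame Γ (proj Γ g)) :=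
    ((contMDiff_rightMul (proj Γ g)).contMDiffAt.mdifferentiableAt (by simp)).hasMFDerivAt
  have hs : MDifferentiableAt 𝓘(ℝ, E) 𝓘(ℝ, E) (fun x => g⁻¹ * σ x) (proj Γ g) :=
    MDifferentiableAt.comp (g := fun k : G => g⁻¹ * k) _
      ((contMDiffAt_mul_left (n := ∞)).mdifferentiableAt (by simp)) hσ
  have hs' := hasMFDerivAt_congr_point (rightMul_one (proj Γ g)).symm _ hs.hasMFDerivAt
  have h2 := hasMFDerivAt_unique ((hs'.comp (1 : G) hf).congr_of_eventuallyEq h1.symm)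
    (hasMFDerivAt_id (1 : G))
  refine Function.LeftInverse.injective
    (g := (mfderiv 𝓘(ℝ, E) 𝓘(ℝ, E) (fun x => g⁻¹ * σ x) (proj Γ g) : E →L[ℝ] E)) fun v => ?_
  exact congrArg (fun l : E →L[ℝ] E => l v) h2

end Frame

/-! ### Coefficients of forms in the frame, and their smoothness -/

section Coefficients

open scoped Manifold ContDiff Topology

variable {E : Type*} [NormedAddCommGroup E] [NormedSpace ℝ E]
  {G : Type*} [Group G] [TopologicalSpace G] [ChartedSpace E G] [LieGroup 𝓘(ℝ, E) ∞ G]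
  {Γ : Subgroup G} [DiscreteTopology Γ]

/-- The pullback of a form on `Γ \ G` by the frame of left-invariant vector fields. -/
def coeff (α : RoughForm E (Nilmanifold Γ)) (q : Nilmanifold Γ) :
    Form (GroupLieAlgebra 𝓘(ℝ, E) G) :=
  Form.pullback (frame Γ q).toLinearMap (α q)

theorem mfderiv_chartAt_symm_injective {M : Type*} [TopologicalSpace M] [ChartedSpace E M]
    [IsManifold 𝓘(ℝ, E) ∞ M] (q : M) {y : E} (hy : y ∈ (chartAt E q).target) :
    Function.Injective (mfderiv 𝓘(ℝ, E) 𝓘(ℝ, E) (chartAt E q).symm y : E → E) := by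
  have : IsManifold 𝓘(ℝ, E) 1 M := .of_le (n := ∞) (by simp)
  exact (((mdifferentiable_chart (I := 𝓘(ℝ, E)) q).symm).mfderiv hy).injective

variable [FiniteDimensional ℝ E]

theorem isInvertible_of_injective {A : E →L[ℝ] E} (h : Function.Injective A) : A.IsInvertible :=
  ⟨(LinearEquiv.ofInjectiveEndo A.toLinearMap h).toContinuousLinearEquiv, by ext; rfl⟩

theorem frame_inverse_apply (q : Nilmanifold Γ) (X : GroupLieAlgebra 𝓘(ℝ, E) G) :
    (frame Γ q).inverse (frame Γ q X) = X :=
  (isInvertible_of_injective (E := E) (frame_injective q)).inverse_apply_eq.mpr rfl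

theorem frame_apply_inverse (q : Nilmanifold Γ) (v : TangentSpace 𝓘(ℝ, E) q) :
    frame Γ q ((frame Γ q).inverse v) = v :=
  ((isInvertible_of_injective (E := E) (frame_injective q)).inverse_apply_eq.mp rfl).symm

theorem coeff_invForm (a : Form (GroupLieAlgebra 𝓘(ℝ, E) G)) (q : Nilmanifold Γ) :
    coeff (invForm Γ a) q = a := by
  funext p
  ext X
  exact congrArg (a p) (funext fun i => frame_inverse_apply q (X i))

theorem pullback_inverse_coeff (α : RoughForm E (Nilmanifold Γ)) (q : Nilmanifold Γ) :
    Form.pullback (frame Γ q).inverse.toLinearMap (coeff α q) = α q := by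
  funext p
  ext X
  exact congrArg (α q p) (funext fun i => frame_apply_inverse q (X i))

theorem coeff_injective : Function.Injective
    (coeff : RoughForm E (Nilmanifold Γ) → Nilmanifold Γ → Form (GroupLieAlgebra 𝓘(ℝ, E) G)) :=
  fun α β h => funext fun q => by
    rw [← pullback_inverse_coeff α q, h, pullback_inverse_coeff]

/-- The matrix of left-invariant one-forms in the preferred chart at `q`. -/
def chartCoframe (q : Nilmanifold Γ) (y : E) : E →L[ℝ] E :=
  (frame Γ ((chartAt E q).symm y)).inverse.comp
    (mfderiv 𝓘(ℝ, E) 𝓘(ℝ, E) (chartAt E q).symm y)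

/-- The expression of a left-invariant vector field in the preferred chart at `q`. -/
def chartField (q : Nilmanifold Γ) (X : GroupLieAlgebra 𝓘(ℝ, E) G) (y : E) : E :=
  (chartCoframe q y).inverse X

theorem chartCoframe_isInvertible (q : Nilmanifold Γ) {y : E} (hy : y ∈ (chartAt E q).target) :
    (chartCoframe q y).IsInvertible := by
  refine isInvertible_of_injective fun v w h => ?_
  refine mfderiv_chartAt_symm_injective q hy ?_
  have h1 := congrArg (frame Γ ((chartAt E q).symm y)) h
  exact (frame_apply_inverse _ _).symm.trans (Eq.trans h1 (frame_apply_inverse _ _))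

theorem mfderiv_symm_chartField (q : Nilmanifold Γ) {y : E} (hy : y ∈ (chartAt E q).target)
    (X : GroupLieAlgebra 𝓘(ℝ, E) G) :
    (mfderiv 𝓘(ℝ, E) 𝓘(ℝ, E) (chartAt E q).symm y : E →L[ℝ] E) (chartField (E := E) q X y) =
      frame Γ ((chartAt E q).symm y) X := by
  have h1 : ∀ x : E, chartCoframe q y ((chartCoframe q y).inverse x) = x := fun x =>
    ((chartCoframe_isInvertible q hy).inverse_apply_eq.mp rfl).symm
  have h2 := congrArg (frame Γ ((chartAt E q).symm y)) (h1 X)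
  exact (frame_apply_inverse _ _).symm.trans h2

theorem chartRep_chartField (α : RoughForm E (Nilmanifold Γ)) (q : Nilmanifold Γ) {y : E}
    (hy : y ∈ (chartAt E q).target) (p : ℕ) (X : Fin p → GroupLieAlgebra 𝓘(ℝ, E) G) :
    chartRep α q p y (fun i => chartField q (X i) y) = coeff α ((chartAt E q).symm y) p X :=
  congrArg (α ((chartAt E q).symm y) p) (funext fun i => mfderiv_symm_chartField q hy (X i))

theorem contDiffOn_of_forall_functional {F : Type*} [NormedAddCommGroup F] [NormedSpace ℝ F]
    {n : WithTop ℕ∞} {s : Set F} {f : F → E} (h : ∀ ξ : E →ₗ[ℝ] ℝ, ContDiffOn ℝ n (ξ ∘ f) s) :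
    ContDiffOn ℝ n f s := by
  let b := Module.finBasis ℝ E
  have h1 : ContDiffOn ℝ n (fun x => b.equivFun (f x)) s := contDiffOn_pi.mpr fun i =>
    (h (b.coord i)).congr fun x _ => by simp
  have h2 : ContDiff ℝ n b.equivFun.symm := (LinearMap.toContinuousLinearMap b.equivFun.symm.toLinearMap).contDiff
  exact (h2.comp_contDiffOn h1).congr fun x _ => by simp

/-- Composed with a functional `ξ`, this matrix is the chart expression of the invariant one-form
`ξ`, whose smoothness is `isSmooth_invForm`. Forms are complex-valued, so the real functional is
recovered as a real part. -/
theorem contDiffOn_chartCoframe (q : Nilmanifold Γ) :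
    ContDiffOn ℝ ∞ (chartCoframe (E := E) q) (chartAt E q).target := by
  refine contDiffOn_clm_apply.mpr fun v => contDiffOn_of_forall_functional fun ξ => ?_
  let a : Form (GroupLieAlgebra 𝓘(ℝ, E) G) := Form.ofDegree
    (AlternatingMap.ofSubsingleton ℝ _ ℂ (0 : Fin 1) (Complex.ofRealCLM.toLinearMap ∘ₗ ξ))
  have h1 := isSmooth_invForm Γ a q 1
  have h2 : ContDiffOn ℝ ∞ (fun y => chartRep (invForm Γ a) q 1 y (fun _ => v))
      (chartAt E q).target :=
    (ContinuousAlternatingMap.apply ℝ E ℂ (fun _ : Fin 1 => v)).contDiff.comp_contDiffOn h1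
  have h3 := Complex.reCLM.contDiff.comp_contDiffOn (n := ∞) h2
  refine h3.congr fun y _ => ?_
  have h4 : a 1 = AlternatingMap.ofSubsingleton ℝ _ ℂ (0 : Fin 1)
      (Complex.ofRealCLM.toLinearMap ∘ₗ ξ) := Pi.single_eq_same _ _
  change ξ (chartCoframe q y v) = (a 1 (fun _ => chartCoframe q y v)).re
  rw [h4]
  exact (Complex.ofReal_re _).symm

/-- The frame is inverse to the coframe, and inversion is smooth on invertible operators. -/
theorem contDiffOn_chartField (q : Nilmanifold Γ) (X : GroupLieAlgebra 𝓘(ℝ, E) G) :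
    ContDiffOn ℝ ∞ (chartField q X) (chartAt E q).target := by
  intro y hy
  have h1 : ContDiffAt ℝ ∞ (chartCoframe q) y :=
    (contDiffOn_chartCoframe q).contDiffAt ((chartAt E q).open_target.mem_nhds hy)
  have h2 : ContDiffAt ℝ ∞ (fun z => ((chartCoframe q z).inverse : E →L[ℝ] E)) y :=
    ((chartCoframe_isInvertible q hy).contDiffAt_map_inverse (n := ∞)).comp y h1
  have h3 : ∀ x : E, ContDiffAt ℝ ∞ (fun z => (chartCoframe q z).inverse x) y := fun x =>
    h2.clm_apply contDiffAt_const
  exact (h3 X).contDiffWithinAt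

/-- Expanding the arguments in a basis writes the value as a finite sum of products of coordinates
with values of the form on basis vectors. -/
theorem contDiffOn_alternating_apply {F : Type*} [NormedAddCommGroup F] [NormedSpace ℝ F]
    {n : WithTop ℕ∞} {s : Set F} {p : ℕ} {a : F → E [⋀^Fin p]→L[ℝ] ℂ} {v : Fin p → F → E}
    (ha : ContDiffOn ℝ n a s) (hv : ∀ i, ContDiffOn ℝ n (v i) s) :
    ContDiffOn ℝ n (fun x => a x (fun i => v i x)) s := by
  let b := Module.finBasis ℝ E
  have h1 : ∀ x, a x (fun i => v i x) = ∑ r : Fin p → Fin (Module.finrank ℝ E),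
      (∏ i, b.repr (v i x) (r i)) • a x (fun i => b (r i)) := fun x => by
    conv_lhs => rw [show (fun i => v i x) = fun i => ∑ j, b.repr (v i x) j • b j from
      funext fun i => (b.sum_repr (v i x)).symm]
    change (a x).toMultilinearMap _ = _
    rw [MultilinearMap.map_sum]
    exact Finset.sum_congr rfl fun r _ => MultilinearMap.map_smul_univ _ _ _
  rw [funext h1]
  refine ContDiffOn.sum fun r _ => ContDiffOn.fun_smul (contDiffOn_prod fun i _ => ?_) ?_
  · exact (LinearMap.toContinuousLinearMap (b.coord (r i))).contDiff.comp_contDiffOn (hv i)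
  · exact (ContinuousAlternatingMap.apply ℝ E ℂ (fun i => b (r i))).contDiff.comp_contDiffOn ha

theorem contMDiff_coeff {α : RoughForm E (Nilmanifold Γ)} (hα : IsSmooth α) (p : ℕ)
    (X : Fin p → GroupLieAlgebra 𝓘(ℝ, E) G) :
    ContMDiff 𝓘(ℝ, E) 𝓘(ℝ, ℂ) ∞ (fun q => coeff α q p X) := by
  intro q
  have h1 := contDiffOn_alternating_apply (hα q p) fun i => contDiffOn_chartField q (X i)
  have h2 : ContDiffAt ℝ ∞ (fun y => chartRep α q p y (fun i => chartField q (X i) y))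
      (chartAt E q q) :=
    h1.contDiffAt ((chartAt E q).open_target.mem_nhds (mem_chart_target E q))
  have h3 : ContMDiffAt 𝓘(ℝ, E) 𝓘(ℝ, E) ∞ (chartAt E q) q :=
    contMDiffAt_of_mem_maximalAtlas (IsManifold.chart_mem_maximalAtlas q) (mem_chart_source E q)
  refine (h2.contMDiffAt.comp q h3).congr_of_eventuallyEq ?_
  filter_upwards [chart_source_mem_nhds E q] with x hx
  have h4 := chartRep_chartField α q ((chartAt E q).map_source hx) p X
  rw [(chartAt E q).left_inv hx] at h4
  exact h4.symm

end Coefficients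

/-! ### The bracket of frame fields is the Lie algebra bracket -/

section Bracket

open VectorField
open scoped Manifold ContDiff Topology

variable {E : Type*} [NormedAddCommGroup E] [NormedSpace ℝ E]
  {G : Type*} [Group G] [TopologicalSpace G] [ChartedSpace E G] [LieGroup 𝓘(ℝ, E) ∞ G]
  {Γ : Subgroup G} [DiscreteTopology Γ]

theorem mfderiv_chartAt_symm_nilmanifold (q : Nilmanifold Γ) {y : E}
    (hy : y ∈ (chartAt E (Quotient.out q : G)).target) :
    (mfderiv 𝓘(ℝ, E) 𝓘(ℝ, E) (chartAt E q).symm y : E →L[ℝ] E) =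
      (mfderiv 𝓘(ℝ, E) 𝓘(ℝ, E) (proj Γ) ((chartAt E (Quotient.out q : G)).symm y) :
        E →L[ℝ] E).comp
      (mfderiv 𝓘(ℝ, E) 𝓘(ℝ, E) (chartAt E (Quotient.out q : G)).symm y : E →L[ℝ] E) := by
  have h1 : ((chartAt E q).symm : E → Nilmanifold Γ) =
      proj Γ ∘ (chartAt E (Quotient.out q : G)).symm := funext (chartAt_symm_nilmanifold Γ q)
  rw [h1]
  exact mfderiv_comp y ((contMDiff_proj Γ).contMDiffAt.mdifferentiableAt (by simp))
    (mdifferentiableAt_atlas_symm (chart_mem_atlas E _) hy)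

variable [FiniteDimensional ℝ E]

/-- The charts of `Γ \ G` and of `G` differ by `proj`, which maps left-invariant fields to frame
fields. So a frame field has the same coordinates as the left-invariant field it comes from. -/
theorem chartField_eq_inverse (q : Nilmanifold Γ) (X : GroupLieAlgebra 𝓘(ℝ, E) G) {y : E}
    (hy : y ∈ (chartAt E q).target) :
    chartField q X y =
      (mfderiv 𝓘(ℝ, E) 𝓘(ℝ, E) (chartAt E (Quotient.out q : G)).symm y : E →L[ℝ] E).inverse
        (mulInvariantVectorField X ((chartAt E (Quotient.out q : G)).symm y)) := by
  have hy' := target_chartAt_nilmanifold_subset Γ q hy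
  have : IsManifold 𝓘(ℝ, E) ∞ G := inferInstance
  have hi : (mfderiv 𝓘(ℝ, E) 𝓘(ℝ, E) (chartAt E (Quotient.out q : G)).symm y :
      E →L[ℝ] E).IsInvertible :=
    isInvertible_of_injective (E := E) (mfderiv_chartAt_symm_injective _ hy')
  have h2 : ∀ v : E, (mfderiv 𝓘(ℝ, E) 𝓘(ℝ, E) (chartAt E (Quotient.out q : G)).symm y :
      E →L[ℝ] E) ((mfderiv 𝓘(ℝ, E) 𝓘(ℝ, E) (chartAt E (Quotient.out q : G)).symm y :
      E →L[ℝ] E).inverse v) = v := fun v => (hi.inverse_apply_eq.mp rfl).symm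
  refine mfderiv_chartAt_symm_injective q hy ?_
  refine (mfderiv_symm_chartField q hy X).trans ?_
  rw [mfderiv_chartAt_symm_nilmanifold q hy']
  refine Eq.trans ?_ (congrArg (mfderiv 𝓘(ℝ, E) 𝓘(ℝ, E) (proj Γ)
    ((chartAt E (Quotient.out q : G)).symm y) : E →L[ℝ] E) (h2 _)).symm
  refine Eq.trans ?_ (mfderiv_proj_apply _ X).symm
  rw [chartAt_symm_nilmanifold]

/-- The coordinate bracket of the chart fields is that of the left-invariant fields in a chart of
`G`. On `G` the bracket of left-invariant fields is the left-invariant field of `⁅X, Y⁆`, and `proj`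
sends it to the frame. -/
theorem mfderiv_symm_lieBracket_chartField (q : Nilmanifold Γ)
    (X Y : GroupLieAlgebra 𝓘(ℝ, E) G) :
    (mfderiv 𝓘(ℝ, E) 𝓘(ℝ, E) (chartAt E q).symm (chartAt E q q) : E →L[ℝ] E)
      (lieBracket (E := E) ℝ (chartField q X) (chartField q Y) (chartAt E q q)) = frame Γ q ⁅X, Y⁆ := by
  set y₀ := chartAt E q q with hy₀
  have hyt : y₀ ∈ (chartAt E q).target := mem_chart_target E q
  set g : G := Quotient.out q with hg
  have hgy : (chartAt E g).symm y₀ = g := by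
    rw [hy₀, chartAt_nilmanifold_self, (chartAt E g).left_inv (mem_chart_source E g)]
  have hyt' := target_chartAt_nilmanifold_subset Γ q hyt
  let F : GroupLieAlgebra 𝓘(ℝ, E) G → E → E := fun Z =>
    mpullbackWithin 𝓘(ℝ, E) 𝓘(ℝ, E) (extChartAt 𝓘(ℝ, E) g).symm (mulInvariantVectorField Z)
      (Set.range 𝓘(ℝ, E))
  have hev : ∀ Z : GroupLieAlgebra 𝓘(ℝ, E) G, chartField q Z =ᶠ[𝓝 y₀] F Z := fun Z => by
    filter_upwards [(chartAt E q).open_target.mem_nhds hyt] with y hy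
    rw [chartField_eq_inverse q Z hy]
    simp only [F, mpullbackWithin, modelWithCornersSelf_coe, Set.range_id, mfderivWithin_univ,
      extChartAt_coe_symm, modelWithCornersSelf_coe_symm, Function.comp_id]
    rfl
  -- The definition of the bracket on a manifold: pull the fields back to the model space by the
  -- chart, take the bracket there, and transport it to the manifold.
  have hF : mlieBracket 𝓘(ℝ, E) (mulInvariantVectorField X) (mulInvariantVectorField Y) g =
      (mfderiv 𝓘(ℝ, E) 𝓘(ℝ, E) (extChartAt 𝓘(ℝ, E) g) g : E →L[ℝ] E).inverse
        (lieBracketWithin (E := E) ℝ (F X) (F Y)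
          ((extChartAt 𝓘(ℝ, E) g).symm ⁻¹' (Set.univ : Set G) ∩ Set.range 𝓘(ℝ, E))
          (extChartAt 𝓘(ℝ, E) g g)) := by
    rw [← mlieBracketWithin_univ]
    rfl
  have hbr : mulInvariantVectorField ⁅X, Y⁆ g =
      (mfderiv 𝓘(ℝ, E) 𝓘(ℝ, E) (chartAt E g) g : E →L[ℝ] E).inverse
        (lieBracket (E := E) ℝ (chartField q X) (chartField q Y) y₀) := by
    rw [(hev X).lieBracket_vectorField_eq (hev Y), GroupLieAlgebra.bracket_def,
      mulInvariantVector_mlieBracket]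
    refine hF.trans ?_
    have he : (extChartAt 𝓘(ℝ, E) g : G → E) = chartAt E g := by simp [extChartAt]
    have hs : ((extChartAt 𝓘(ℝ, E) g).symm ⁻¹' (Set.univ : Set G)) ∩ Set.range 𝓘(ℝ, E) =
        (Set.univ : Set E) := by simp
    rw [hs, lieBracketWithin_univ, he, hy₀, chartAt_nilmanifold_self]
  have hinv : (mfderiv 𝓘(ℝ, E) 𝓘(ℝ, E) (chartAt E g) g : E →L[ℝ] E).inverse =
      (mfderiv 𝓘(ℝ, E) 𝓘(ℝ, E) (chartAt E g).symm y₀ : E →L[ℝ] E) := by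
    have : IsManifold 𝓘(ℝ, E) 1 G := .of_le (n := ∞) (by simp)
    have hm := mdifferentiable_chart (I := 𝓘(ℝ, E)) g
    have h1 := hm.symm_comp_deriv (mem_chart_source E g)
    have h2 := hm.comp_symm_deriv hyt'
    have hy₁ : chartAt E g g = y₀ := (chartAt_nilmanifold_self Γ q).symm
    rw [hy₁] at h1
    rw [hgy] at h2
    exact ContinuousLinearMap.inverse_eq h2 h1
  have h3 := congrArg (mfderiv 𝓘(ℝ, E) 𝓘(ℝ, E) (proj Γ) g : E →L[ℝ] E) hbr
  rw [hinv] at h3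
  rw [mfderiv_chartAt_symm_nilmanifold q hyt']
  have h4 : frame Γ (proj Γ g) ⁅X, Y⁆ = (frame Γ q ⁅X, Y⁆ : E) := by
    rw [show proj Γ g = q from Quotient.out_eq q]
  have h5 : (mfderiv 𝓘(ℝ, E) 𝓘(ℝ, E) (proj Γ) ((chartAt E g).symm y₀) : E →L[ℝ] E) =
      mfderiv 𝓘(ℝ, E) 𝓘(ℝ, E) (proj Γ) g := by rw [hgy]
  rw [h5]
  exact h3.symm.trans ((mfderiv_proj_apply g _).trans h4)

end Bracket

/-! ### Koszul's formula for the exterior derivative -/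

section ExteriorDerivative

open VectorField
open scoped Manifold ContDiff Topology

variable {E : Type*} [NormedAddCommGroup E] [NormedSpace ℝ E]
  {G : Type*} [Group G] [TopologicalSpace G] [ChartedSpace E G] [LieGroup 𝓘(ℝ, E) ∞ G]
  {Γ : Subgroup G} [DiscreteTopology Γ]

/-- The derivative of a function on `Γ \ G` along the vector field induced by `X`. -/
def fieldDeriv (f : Nilmanifold Γ → ℂ) (X : GroupLieAlgebra 𝓘(ℝ, E) G) (q : Nilmanifold Γ) : ℂ :=
  (mfderiv 𝓘(ℝ, E) 𝓘(ℝ, ℂ) f q : E →L[ℝ] ℂ) (frame Γ q X)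

theorem fieldDeriv_const (c : ℂ) (X : GroupLieAlgebra 𝓘(ℝ, E) G) (q : Nilmanifold Γ) :
    fieldDeriv (fun _ => c) X q = 0 := by
  rw [fieldDeriv, mfderiv_const]
  rfl

variable [FiniteDimensional ℝ E]

theorem fderiv_chartField (q : Nilmanifold Γ) {y : E} (hy : y ∈ (chartAt E q).target)
    {f : Nilmanifold Γ → ℂ}
    (hf : MDifferentiableAt 𝓘(ℝ, E) 𝓘(ℝ, ℂ) f ((chartAt E q).symm y))
    (X : GroupLieAlgebra 𝓘(ℝ, E) G) :
    fderiv ℝ (fun z => f ((chartAt E q).symm z)) y (chartField q X y) =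
      fieldDeriv f X ((chartAt E q).symm y) := by
  have h1 : mfderiv 𝓘(ℝ, E) 𝓘(ℝ, ℂ) (f ∘ (chartAt E q).symm) y = _ :=
    mfderiv_comp y hf (mdifferentiableAt_atlas_symm (chart_mem_atlas E q) hy)
  rw [mfderiv_eq_fderiv] at h1
  have h2 := congrArg (fun l : E →L[ℝ] ℂ => l (chartField q X y)) h1
  refine Eq.trans h2 ?_
  exact congrArg (mfderiv 𝓘(ℝ, E) 𝓘(ℝ, ℂ) f ((chartAt E q).symm y) : E →L[ℝ] ℂ)
    (mfderiv_symm_chartField q hy X)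

theorem contMDiff_fieldDeriv {f : Nilmanifold Γ → ℂ} (hf : ContMDiff 𝓘(ℝ, E) 𝓘(ℝ, ℂ) ∞ f)
    (X : GroupLieAlgebra 𝓘(ℝ, E) G) : ContMDiff 𝓘(ℝ, E) 𝓘(ℝ, ℂ) ∞ (fieldDeriv f X) := by
  intro q
  have ht : (chartAt E q).target ∈ 𝓝 (chartAt E q q) :=
    (chartAt E q).open_target.mem_nhds (mem_chart_target E q)
  have h0 : ContMDiffOn 𝓘(ℝ, E) 𝓘(ℝ, ℂ) ∞ (fun z => f ((chartAt E q).symm z))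
      (chartAt E q).target := hf.comp_contMDiffOn
    (contMDiffOn_symm_of_mem_maximalAtlas (IsManifold.chart_mem_maximalAtlas q))
  have h1 : ContDiffAt ℝ ∞ (fderiv ℝ fun z => f ((chartAt E q).symm z)) (chartAt E q q) :=
    (h0.contDiffOn.contDiffAt ht).fderiv_right (by simp)
  have h2 : ContDiffAt ℝ ∞ (fun y => fderiv ℝ (fun z => f ((chartAt E q).symm z)) y
      (chartField q X y)) (chartAt E q q) :=
    h1.clm_apply ((contDiffOn_chartField q X).contDiffAt ht)
  have h3 : ContMDiffAt 𝓘(ℝ, E) 𝓘(ℝ, E) ∞ (chartAt E q) q :=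
    contMDiffAt_of_mem_maximalAtlas (IsManifold.chart_mem_maximalAtlas q) (mem_chart_source E q)
  refine (h2.contMDiffAt.comp q h3).congr_of_eventuallyEq ?_
  filter_upwards [chart_source_mem_nhds E q] with x hx
  have h4 := fderiv_chartField q ((chartAt E q).map_source hx)
    (hf.contMDiffAt.mdifferentiableAt (by simp)) X
  rw [(chartAt E q).left_inv hx] at h4
  exact h4.symm

/-- The exterior derivative of a form on `Γ \ G` in terms of the frame of left-invariant vector
fields. -/
theorem coeff_extD {α : RoughForm E (Nilmanifold Γ)} (hα : IsSmooth α) (q : Nilmanifold Γ) (p : ℕ)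
    (X : Fin (p + 1) → GroupLieAlgebra 𝓘(ℝ, E) G) :
    coeff (extD α) q (p + 1) X =
      ∑ i : Fin (p + 1), (-1 : ℤ) ^ (i : ℕ) • fieldDeriv (fun x => coeff α x p (i.removeNth X)) (X i) q +
        ceDiff (coeff α q) (p + 1) X := by
  set y := chartAt E q q with hy
  have hyt : y ∈ (chartAt E q).target := mem_chart_target E q
  have hn : (chartAt E q).target ∈ 𝓝 y := (chartAt E q).open_target.mem_nhds hyt
  have hyq : (chartAt E q).symm y = q := (chartAt E q).left_inv (mem_chart_source E q)
  have hV : ∀ i, DifferentiableAt ℝ (chartField q (X i)) y := fun i =>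
    ((contDiffOn_chartField q (X i)).contDiffAt hn).differentiableAt (by simp)
  have hω : DifferentiableAt ℝ (chartRep α q p) y := differentiableAt_chartRep hα q p hyt
  have hfr : ∀ i, (mfderiv 𝓘(ℝ, E) 𝓘(ℝ, E) (chartAt E q) q : E →L[ℝ] E) (frame Γ q (X i)) =
      chartField q (X i) y := fun i => by
    have : IsManifold 𝓘(ℝ, E) 1 (Nilmanifold Γ) := .of_le (n := ∞) (by simp)
    have h1 := (mdifferentiable_chart (I := 𝓘(ℝ, E)) q).comp_symm_deriv hyt
    have h2 := mfderiv_symm_chartField q hyt (X i)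
    rw [hyq] at h1 h2
    rw [← h2]
    exact congrArg (fun l : E →L[ℝ] E => l (chartField q (X i) y)) h1
  have hL : coeff (extD α) q (p + 1) X =
      extDeriv (chartRep α q p) y (fun i => chartField q (X i) y) :=
    congrArg (extDeriv (chartRep α q p) y) (funext hfr)
  have hD : ∀ i : Fin (p + 1),
      fderiv ℝ (fun z => chartRep α q p z (i.removeNth fun j => chartField q (X j) z)) y
        (chartField q (X i) y) =
      fieldDeriv (fun x => coeff α x p (i.removeNth X)) (X i) q := fun i => by
    have h1 : (fun z => chartRep α q p z (i.removeNth fun j => chartField q (X j) z)) =ᶠ[𝓝 y]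
        fun z => coeff α ((chartAt E q).symm z) p (i.removeNth X) := by
      filter_upwards [hn] with z hz
      exact chartRep_chartField α q hz p (i.removeNth X)
    rw [h1.fderiv_eq, fderiv_chartField q hyt (f := fun x => coeff α x p (i.removeNth X))
      ((contMDiff_coeff hα p _).contMDiffAt.mdifferentiableAt (by simp)), hyq]
  rw [hL]
  -- The formula for `d` on vector fields with bracket terms starts with one-forms. For functions
  -- there are no brackets, and `ceDiff` is zero in degree one.
  cases p with
  | zero =>
    have h0 : ceDiff (coeff α q) (0 + 1) = 0 := rfl
    rw [extDeriv_apply hω, h0, AlternatingMap.zero_apply, add_zero]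
    refine Finset.sum_congr rfl fun i _ => ?_
    rw [← hD i]
    -- Removing the only argument leaves an empty family, so freezing the fields at `y` changes
    -- nothing.
    have h1 : (fun z => chartRep α q 0 z (i.removeNth fun j => chartField q (X j) z)) =
        fun z => chartRep α q 0 z (i.removeNth fun j => chartField q (X j) y) :=
      funext fun z => congrArg (chartRep α q 0 z) (Subsingleton.elim _ _)
    rw [h1]
  | succ p =>
    rw [extDeriv_apply_vectorField hω hV, sub_eq_add_neg]
    congr 1
    · exact Finset.sum_congr rfl fun i _ => by rw [hD i]
    · refine Eq.trans ?_ (ceDiffPos_apply (coeff α q (p + 1)) X).symm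
      congr 1
      refine Finset.sum_congr rfl fun i _ => Finset.sum_congr rfl fun j _ => ?_
      congr 1
      have h1 : chartRep α q (p + 1) y (Matrix.vecCons
          (lieBracket (E := E) ℝ (chartField q (X i.castSucc)) (chartField q (X j.succ)) y)
          (j.removeNth (i.castSucc.removeNth fun k => chartField q (X k) y))) =
          coeff α ((chartAt E q).symm y) (p + 1) (Matrix.vecCons ⁅X i.castSucc, X j.succ⁆
            (j.removeNth (i.castSucc.removeNth X))) := by
        refine congrArg (α ((chartAt E q).symm y) (p + 1)) (funext fun k => ?_)
        refine Fin.cases ?_ (fun k => ?_) k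
        · refine (mfderiv_symm_lieBracket_chartField q (X i.castSucc) (X j.succ)).trans ?_
          change _ = (frame Γ ((chartAt E q).symm y) ⁅X i.castSucc, X j.succ⁆ : E)
          rw [hyq]
        · exact mfderiv_symm_chartField q hyt _
      rw [hyq] at h1
      exact h1

/-- An invariant form has constant coefficients, so the derivative terms of `coeff_extD` vanish. -/
theorem extD_invForm (a : Form (GroupLieAlgebra 𝓘(ℝ, E) G)) :
    extD (invForm Γ a) = invForm Γ (ceDiff a) := by
  refine coeff_injective (funext fun q => funext fun p => ?_)
  rw [coeff_invForm]
  cases p with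
  | zero => rfl
  | succ p =>
    ext X
    rw [coeff_extD (isSmooth_invForm Γ a)]
    simp only [coeff_invForm, fieldDeriv_const, smul_zero, Finset.sum_const_zero, zero_add]

theorem incl_ceDiff (a : Form (GroupLieAlgebra 𝓘(ℝ, E) G)) :
    incl Γ (ceDiff a) = smoothD E (Nilmanifold Γ) (incl Γ a) :=
  Subtype.ext (extD_invForm a).symm

end ExteriorDerivative

/-! ### Averaging over the frame and its compatibility with `d` -/

section Average

open MeasureTheory
open scoped Manifold ContDiff Topology

theorem integrable_of_continuous_of_compactSpace {M : Type*} [TopologicalSpace M] [CompactSpace M]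
    [MeasurableSpace M] [BorelSpace M] {ν : Measure M} [IsFiniteMeasure ν] {f : M → ℂ} (hf : Continuous f) : Integrable f ν := by
  obtain ⟨C, hC⟩ := isCompact_univ.exists_bound_of_continuousOn hf.continuousOn
  exact Integrable.of_bound hf.aestronglyMeasurable C (.of_forall fun q => hC q (Set.mem_univ q))

variable {E : Type*} [NormedAddCommGroup E] [NormedSpace ℝ E] [FiniteDimensional ℝ E]
  {G : Type*} [Group G] [TopologicalSpace G] [ChartedSpace E G] [LieGroup 𝓘(ℝ, E) ∞ G]
  {Γ : Subgroup G} [DiscreteTopology Γ]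

theorem hasDerivAt_comp_rightMul {f : Nilmanifold Γ → ℂ} (hf : ContMDiff 𝓘(ℝ, E) 𝓘(ℝ, ℂ) ∞ f)
    (X : GroupLieAlgebra 𝓘(ℝ, E) G) (q : Nilmanifold Γ) {γ : ℝ → G} {t : ℝ}
    (hγ : HasMFDerivAt 𝓘(ℝ, ℝ) 𝓘(ℝ, E) γ t
      ((1 : ℝ →L[ℝ] ℝ).smulRight (mulInvariantVectorField X (γ t)))) :
    HasDerivAt (fun s => f (rightMul q (γ s))) (fieldDeriv f X (rightMul q (γ t))) t := by
  have h1 : HasMFDerivAt 𝓘(ℝ, E) 𝓘(ℝ, E) (rightMul q) (γ t) _ :=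
    ((contMDiff_rightMul q).contMDiffAt.mdifferentiableAt (by simp)).hasMFDerivAt
  have h2 : HasMFDerivAt 𝓘(ℝ, E) 𝓘(ℝ, ℂ) f (rightMul q (γ t)) _ :=
    (hf.contMDiffAt.mdifferentiableAt (by simp)).hasMFDerivAt
  have h3 := h2.comp t (h1.comp t hγ)
  have h4 : HasFDerivAt (fun s => f (rightMul q (γ s))) (_ : ℝ →L[ℝ] ℂ) t :=
    hasMFDerivAt_iff_hasFDerivAt.mp h3
  refine HasDerivAt.congr_deriv h4.hasDerivAt ?_
  have h5 := mfderiv_rightMul_apply q (γ t) X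
  refine Eq.trans ?_ (congrArg
    (mfderiv 𝓘(ℝ, E) 𝓘(ℝ, ℂ) f (rightMul q (γ t)) : E →L[ℝ] ℂ) h5)
  refine congrArg (mfderiv 𝓘(ℝ, E) 𝓘(ℝ, ℂ) f (rightMul q (γ t)) : E →L[ℝ] ℂ) ?_
  refine congrArg (mfderiv 𝓘(ℝ, E) 𝓘(ℝ, E) (rightMul q) (γ t) : E →L[ℝ] E) ?_
  exact one_smul ℝ (mulInvariantVectorField X (γ t) : E)

/-- A local integral curve through `1` replaces the exponential map: only the derivative at time `0`
of an integral is taken. -/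
theorem exists_integralCurve (X : GroupLieAlgebra 𝓘(ℝ, E) G) : ∃ γ : ℝ → G, γ 0 = 1 ∧
    ∀ᶠ t in 𝓝 (0 : ℝ), HasMFDerivAt 𝓘(ℝ, ℝ) 𝓘(ℝ, E) γ t
      ((1 : ℝ →L[ℝ] ℝ).smulRight (mulInvariantVectorField X (γ t))) := by
  have : IsManifold 𝓘(ℝ, E) 1 G := .of_le (n := ∞) (by simp)
  exact exists_isMIntegralCurveAt_of_contMDiffAt_boundaryless (I := 𝓘(ℝ, E)) 0
    ((contMDiffAt_mulInvariantVectorField X (g := (1 : G))).of_le (by simp))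

variable [CompactSpace (Nilmanifold Γ)] [MeasurableSpace (Nilmanifold Γ)]
  [BorelSpace (Nilmanifold Γ)]

/-- By invariance of `ν`, the integral of `f (q γ(t))` does not depend on `t`, where `γ` is an
integral curve of `X` through `1`. Its derivative at `0`, taken under the integral sign, is the
integral in question. -/
theorem integral_fieldDeriv_eq_zero {ν : Measure (Nilmanifold Γ)} [IsFiniteMeasure ν]
    (hν : ∀ h : G, ν.map (fun q => rightMul q h) = ν) {f : Nilmanifold Γ → ℂ}
    (hf : ContMDiff 𝓘(ℝ, E) 𝓘(ℝ, ℂ) ∞ f) (X : GroupLieAlgebra 𝓘(ℝ, E) G) :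
    ∫ q, fieldDeriv f X q ∂ν = 0 := by
  have : IsTopologicalGroup G := topologicalGroup_of_lieGroup 𝓘(ℝ, E) ∞
  obtain ⟨γ, hγ0, hγ⟩ := exists_integralCurve X
  have hf' : Continuous (fieldDeriv f X) := (contMDiff_fieldDeriv hf X).continuous
  obtain ⟨C, hC⟩ := isCompact_univ.exists_bound_of_continuousOn hf'.continuousOn
  have hr : ∀ h : G, Continuous fun q : Nilmanifold Γ => rightMul q h := continuous_rightMul Γ
  -- The dominating function is the constant sup bound for the continuous function `fieldDeriv f X`
  -- on the compact quotient.
  have h1 := hasDerivAt_integral_of_dominated_loc_of_deriv_le (μ := ν) (𝕜 := ℝ)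
    (F := fun t q => f (rightMul q (γ t))) (F' := fun t q => fieldDeriv f X (rightMul q (γ t)))
    (bound := fun _ => C) (x₀ := 0) hγ
    (.of_forall fun t => (hf.continuous.comp (hr (γ t))).aestronglyMeasurable)
    (integrable_of_continuous_of_compactSpace (hf.continuous.comp (hr (γ 0))))
    (hf'.comp (hr (γ 0))).aestronglyMeasurable
    (.of_forall fun q t _ => hC _ (Set.mem_univ _)) (integrable_const C)
    (.of_forall fun q t ht => hasDerivAt_comp_rightMul hf X q ht)
  have h2 : ∀ t, ∫ q, f (rightMul q (γ t)) ∂ν = ∫ q, f q ∂ν := fun t => by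
    conv_rhs => rw [← hν (γ t)]
    exact (integral_map (hr (γ t)).aemeasurable hf.continuous.aestronglyMeasurable).symm
  have h3 := h1.2
  simp only [h2, hγ0, rightMul_one] at h3
  exact h3.unique (hasDerivAt_const 0 _)

theorem integrable_coeff (ν : Measure (Nilmanifold Γ)) [IsFiniteMeasure ν]
    (α : SmoothForm E (Nilmanifold Γ)) (p : ℕ) (X : Fin p → GroupLieAlgebra 𝓘(ℝ, E) G) :
    Integrable (fun q => coeff α.1 q p X) ν :=
  integrable_of_continuous_of_compactSpace (contMDiff_coeff α.2 p X).continuous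

/-- The average of a form on `Γ \ G` over the frame of left-invariant vector fields. -/
def average (ν : Measure (Nilmanifold Γ)) [IsFiniteMeasure ν] :
    SmoothForm E (Nilmanifold Γ) →ₗ[ℂ] Form (GroupLieAlgebra 𝓘(ℝ, E) G) where
  toFun α p :=
    { toFun := fun X => ∫ q, coeff α.1 q p X ∂ν
      map_update_add' := fun X i x y => by
        have h : ∀ q, coeff α.1 q p (Function.update X i (x + y)) =
            coeff α.1 q p (Function.update X i x) + coeff α.1 q p (Function.update X i y) :=
          fun q => (coeff α.1 q p).map_update_add X i x y
        simp only [h]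
        exact integral_add (integrable_coeff ν α p _) (integrable_coeff ν α p _)
      map_update_smul' := fun X i c x => by
        have h : ∀ q, coeff α.1 q p (Function.update X i (c • x)) =
            c • coeff α.1 q p (Function.update X i x) :=
          fun q => (coeff α.1 q p).map_update_smul X i c x
        simp only [h]
        exact integral_smul c _
      map_eq_zero_of_eq' := fun X i j h hij => by
        have h : ∀ q, coeff α.1 q p X = 0 :=
          fun q => (coeff α.1 q p).map_eq_zero_of_eq X h hij
        simp only [h, integral_zero] }
  map_add' α β := by
    funext p
    ext X
    exact integral_add (integrable_coeff ν α p X) (integrable_coeff ν β p X)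
  map_smul' c α := by
    funext p
    ext X
    exact integral_const_mul c _

theorem average_apply (ν : Measure (Nilmanifold Γ)) [IsFiniteMeasure ν]
    (α : SmoothForm E (Nilmanifold Γ)) (p : ℕ) (X : Fin p → GroupLieAlgebra 𝓘(ℝ, E) G) :
    average ν α p X = ∫ q, coeff α.1 q p X ∂ν := rfl

theorem average_incl (ν : Measure (Nilmanifold Γ)) [IsProbabilityMeasure ν]
    (a : Form (GroupLieAlgebra 𝓘(ℝ, E) G)) : average ν (incl Γ a) = a := by
  funext p
  ext X
  have h : ∀ q, coeff (incl Γ a).1 q = a := coeff_invForm a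
  simp [average_apply, h]

/-- In `coeff_extD` the derivative terms have integral zero, and the Chevalley–Eilenberg term is a
finite linear combination of coefficients, hence commutes with the integral. -/
theorem average_smoothD {ν : Measure (Nilmanifold Γ)} [IsFiniteMeasure ν]
    (hν : ∀ h : G, ν.map (fun q => rightMul q h) = ν) (α : SmoothForm E (Nilmanifold Γ)) :
    average ν (smoothD E (Nilmanifold Γ) α) = ceDiff (average ν α) := by
  funext p
  ext X
  rw [average_apply]
  change ∫ q, coeff (extD α.1) q p X ∂ν = _
  match p with
  | 0 => exact integral_zero _ _
  | p + 1 =>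
    have hs : ∀ i : Fin (p + 1), Integrable (fun q => (-1 : ℤ) ^ (i : ℕ) •
        fieldDeriv (fun x => coeff α.1 x p (i.removeNth X)) (X i) q) ν := fun i =>
      (integrable_of_continuous_of_compactSpace
        (contMDiff_fieldDeriv (contMDiff_coeff α.2 p _) (X i)).continuous).smul _
    have h0 : ∫ q, ∑ i : Fin (p + 1), (-1 : ℤ) ^ (i : ℕ) •
        fieldDeriv (fun x => coeff α.1 x p (i.removeNth X)) (X i) q ∂ν = 0 := by
      rw [integral_finsetSum _ fun i _ => hs i]
      refine Finset.sum_eq_zero fun i _ => ?_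
      simp only [zsmul_eq_mul]
      rw [integral_const_mul, integral_fieldDeriv_eq_zero hν (contMDiff_coeff α.2 p _), mul_zero]
    have hd : Integrable (fun q => ceDiff (coeff α.1 q) (p + 1) X) ν ∧
        ∫ q, ceDiff (coeff α.1 q) (p + 1) X ∂ν = ceDiff (average ν α) (p + 1) X := by
      cases p with
      | zero => exact ⟨integrable_zero _ _ _, integral_zero _ _⟩
      | succ p =>
        have h1 : ∀ a : Form (GroupLieAlgebra 𝓘(ℝ, E) G), ceDiff a (p + 1 + 1) X =
            -∑ i : Fin (p + 1), ∑ j ≥ i, (-1 : ℤ) ^ (i + j : ℕ) • a (p + 1)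
              (Matrix.vecCons ⁅X i.castSucc, X j.succ⁆ (j.removeNth <| i.castSucc.removeNth X)) :=
          fun a => ceDiffPos_apply (a (p + 1)) X
        have h2 : ∀ i j : Fin (p + 1), Integrable (fun q => (-1 : ℤ) ^ (i + j : ℕ) •
            coeff α.1 q (p + 1) (Matrix.vecCons ⁅X i.castSucc, X j.succ⁆
              (j.removeNth <| i.castSucc.removeNth X))) ν := fun i j =>
          (integrable_coeff ν α (p + 1) _).smul _
        simp only [h1]
        refine ⟨(integrable_finsetSum _ fun i _ => integrable_finsetSum _ fun j _ => h2 i j).neg, ?_⟩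
        rw [integral_neg, integral_finsetSum _ fun i _ => integrable_finsetSum _ fun j _ => h2 i j]
        congr 1
        refine Finset.sum_congr rfl fun i _ => ?_
        rw [integral_finsetSum _ fun j _ => h2 i j]
        refine Finset.sum_congr rfl fun j _ => ?_
        simp only [zsmul_eq_mul]
        rw [integral_const_mul]
        rfl
    simp only [coeff_extD α.2]
    rw [integral_add (integrable_finsetSum _ fun i _ => hs i) hd.1, h0, zero_add, hd.2]

end Average

/-! ### Naturality of the Clifford action, and finite dimension of the space of forms -/

section FormPullback

variable {V W : Type*} [AddCommGroup V] [Module ℝ V] [AddCommGroup W] [Module ℝ W]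

/-- The isomorphism `W ⊕ W* → V ⊕ V*` induced by an isomorphism `V → W`. -/
def Dbl.pullback (f : V ≃ₗ[ℝ] W) : Dbl W →ₗ[ℝ] Dbl V :=
  f.symm.toLinearMap.prodMap f.toLinearMap.dualMap

theorem pullback_act (f : V ≃ₗ[ℝ] W) (w : Dbl W) (a : Form W) :
    Form.pullback f.toLinearMap (act w a) =
      act (Dbl.pullback f w) (Form.pullback f.toLinearMap a) := by
  obtain ⟨X, ξ⟩ := w
  have h1 : Form.pullback f.toLinearMap (Form.contract X a) =
      Form.contract (f.symm X) (Form.pullback f.toLinearMap a) := by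
    funext p
    ext v
    refine congrArg (a (p + 1)) (funext fun i => ?_)
    refine Fin.cases ?_ (fun i => ?_) i
    · exact (f.apply_symm_apply X).symm
    · rfl
  have h2 : Form.pullback f.toLinearMap (Form.extMul ξ a) =
      Form.extMul (f.toLinearMap.dualMap ξ) (Form.pullback f.toLinearMap a) := by
    funext p
    ext v
    cases p with
    | zero => rfl
    | succ p =>
      change AlternatingMap.alternatizeUncurryFin (ξ.smulRight (a p)) _ =
        AlternatingMap.alternatizeUncurryFin (LinearMap.smulRight _ _) v
      rw [AlternatingMap.alternatizeUncurryFin_apply, AlternatingMap.alternatizeUncurryFin_apply]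
      rfl
  change Form.pullback f.toLinearMap (Form.contract X a + Form.extMul ξ a) = _
  rw [map_add, h1, h2]
  rfl

theorem actC_tmul (c : ℂ) (w : Dbl V) (a : Form V) : actC (c ⊗ₜ[ℝ] w) a = c • act w a := by
  rw [actC, LinearMap.liftBaseChange_tmul]
  rfl

theorem conjD_tmul (c : ℂ) (w : Dbl V) : conjD (c ⊗ₜ[ℝ] w) = (starRingEnd ℂ c) ⊗ₜ[ℝ] w := rfl

theorem pullback_actC (f : V ≃ₗ[ℝ] W) (w : DblC W) (a : Form W) :
    Form.pullback f.toLinearMap (actC w a) =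
      actC ((Dbl.pullback f).baseChange ℂ w) (Form.pullback f.toLinearMap a) := by
  induction w using TensorProduct.induction_on with
  | zero => simp
  | add x y hx hy => simp only [map_add, LinearMap.add_apply, hx, hy]
  | tmul c w =>
    rw [LinearMap.baseChange_tmul, actC_tmul, actC_tmul, map_smul, pullback_act]

theorem conjD_baseChange (f : Dbl W →ₗ[ℝ] Dbl V) (w : DblC W) :
    conjD (f.baseChange ℂ w) = f.baseChange ℂ (conjD w) := by
  induction w using TensorProduct.induction_on with
  | zero => simp
  | add x y hx hy => simp only [map_add, hx, hy]
  | tmul c w => rfl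

theorem mem_Ann {ρ : Form V} {v : DblC V} : v ∈ Ann ρ ↔ actC v ρ = 0 := Iff.rfl

/-- Everything in the definition of `U` is natural under isomorphisms: the Clifford action
(`pullback_actC`), complex conjugation, and hence the annihilator. -/
theorem pullback_mem_U (f : V ≃ₗ[ℝ] W) {n : ℕ} {ρ : Form W} {j : ℤ} {a : Form W}
    (ha : a ∈ U n ρ j) :
    Form.pullback f.toLinearMap a ∈ U n (Form.pullback f.toLinearMap ρ) j := by
  refine Submodule.span_induction ?_ (by simp) (fun x y _ _ hx hy => ?_) (fun c x _ hx => ?_) ha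
  · rintro _ ⟨r, v, hr, hv, rfl⟩
    refine Submodule.subset_span ⟨r, fun i => (Dbl.pullback f).baseChange ℂ (v i), hr,
      fun i => ?_, ?_⟩
    · rw [conjD_baseChange, mem_Ann, ← pullback_actC, mem_Ann.mp (hv i), map_zero]
    · have key : ∀ l : List (DblC W), Form.pullback f.toLinearMap ((l.map actC).prod ρ) =
          ((l.map fun w => actC ((Dbl.pullback f).baseChange ℂ w)).prod
            (Form.pullback f.toLinearMap ρ)) := fun l => by
        induction l with
        | nil => rfl
        | cons w l ih =>
          simp only [List.map_cons, List.prod_cons, Module.End.mul_apply]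
          rw [pullback_actC, ih]
      have h := key (List.ofFn v)
      rw [List.map_ofFn, List.map_ofFn] at h
      exact h
  · rw [map_add]
    exact Submodule.add_mem _ hx hy
  · rw [map_smul]
    exact Submodule.smul_mem _ c hx

variable [FiniteDimensional ℝ V]

theorem alternating_eq_zero_of_finrank_lt {p : ℕ} (hp : Module.finrank ℝ V < p)
    (a : V [⋀^Fin p]→ₗ[ℝ] ℂ) : a = 0 := by
  ext v
  refine a.map_linearDependent v fun h => ?_
  have := h.fintype_card_le_finrank
  simp at this
  omega

instance finiteDimensional_alternating (p : ℕ) : FiniteDimensional ℂ (V [⋀^Fin p]→ₗ[ℝ] ℂ) := by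
  have h : FiniteDimensional ℝ (V [⋀^Fin p]→ₗ[ℝ] ℂ) := by
    let K : (V [⋀^Fin p]→ₗ[ℝ] ℂ) →ₗ[ℝ] MultilinearMap ℝ (fun _ : Fin p => V) ℂ :=
      { toFun := fun f => f.toMultilinearMap, map_add' := fun _ _ => rfl,
        map_smul' := fun _ _ => rfl }
    exact FiniteDimensional.of_injective K AlternatingMap.coe_multilinearMap_injective
  exact Module.Finite.of_restrictScalars_finite ℝ ℂ _

/-- A form is a family over all degrees, but the degrees above `dim V` contribute nothing. -/
instance finiteDimensional_form : FiniteDimensional ℂ (Form V) := by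
  let K : Form V →ₗ[ℂ] ∀ p : Fin (Module.finrank ℝ V + 1), V [⋀^Fin (p : ℕ)]→ₗ[ℝ] ℂ :=
    { toFun := fun a p => a p, map_add' := fun _ _ => rfl, map_smul' := fun _ _ => rfl }
  refine FiniteDimensional.of_injective K fun a b h => funext fun p => ?_
  by_cases hp : p < Module.finrank ℝ V + 1
  · exact congrFun h ⟨p, hp⟩
  · rw [alternating_eq_zero_of_finrank_lt (by omega) (a p),
      alternating_eq_zero_of_finrank_lt (by omega) (b p)]

/-- The evaluation of the degree `p` part of a form. -/
def Form.eval (p : ℕ) (X : Fin p → V) : Module.Dual ℂ (Form V) where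
  toFun a := a p X
  map_add' _ _ := rfl
  map_smul' _ _ := rfl

/-- The evaluations separate forms, so in finite dimension they span the dual. -/
theorem Form.span_eval : Submodule.span ℂ {ℓ : Module.Dual ℂ (Form V) |
    ∃ (p : ℕ) (X : Fin p → V), ℓ = Form.eval p X} = ⊤ := by
  set S := Submodule.span ℂ {ℓ : Module.Dual ℂ (Form V) |
    ∃ (p : ℕ) (X : Fin p → V), ℓ = Form.eval p X}
  have h : S.dualCoannihilator = ⊥ := by
    refine (Submodule.eq_bot_iff _).mpr fun a ha => ?_
    rw [Submodule.mem_dualCoannihilator] at ha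
    funext p
    ext X
    exact ha (Form.eval p X) (Submodule.subset_span ⟨p, X, rfl⟩)
  rw [← Subspace.dualCoannihilator_dualAnnihilator_eq (W := S), h, Submodule.dualAnnihilator_bot]

/-- Reduces statements about a general functional of the coefficient function to those about the
scalar coefficients `coeff α q p X`. -/
theorem Form.dual_induction {P : Module.Dual ℂ (Form V) → Prop} (h0 : P 0)
    (heval : ∀ p X, P (Form.eval p X)) (hadd : ∀ ℓ ℓ', P ℓ → P ℓ' → P (ℓ + ℓ'))
    (hsmul : ∀ (c : ℂ) ℓ, P ℓ → P (c • ℓ)) (ℓ : Module.Dual ℂ (Form V)) : P ℓ := by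
  have h : ℓ ∈ (⊤ : Submodule ℂ (Module.Dual ℂ (Form V))) := Submodule.mem_top
  rw [← Form.span_eval] at h
  refine Submodule.span_induction ?_ h0 (fun x y _ _ => hadd x y) (fun c x _ => hsmul c x) h
  rintro _ ⟨p, X, rfl⟩
  exact heval p X

end FormPullback

/-! ### Homomorphisms of bi-differential complexes -/

section BiHom

variable {A B : Type*} [AddCommGroup A] [Module ℂ A] [AddCommGroup B] [Module ℂ B]
  {𝒰 : ℤ → Submodule ℂ A} {𝒱 : ℤ → Submodule ℂ B} {dA : A →ₗ[ℂ] A} {dB : B →ₗ[ℂ] B}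
  {f : A →ₗ[ℂ] B}

theorem component_apply_of_mem (h : DirectSum.IsInternal 𝒰) {i j : ℤ} {a : A} (ha : a ∈ 𝒰 i) :
    (component 𝒰 j a : A) = if i = j then a else 0 := by
  classical
  have h1 : (LinearEquiv.ofBijective (DirectSum.coeLinearMap 𝒰) h).symm a =
      DirectSum.lof ℂ ℤ (fun i => 𝒰 i) i ⟨a, ha⟩ := by
    rw [LinearEquiv.symm_apply_eq]
    exact (DirectSum.coeLinearMap_lof 𝒰 i ⟨a, ha⟩).symm
  have h2 : component 𝒰 j a =
      DirectSum.component ℂ ℤ (fun i => 𝒰 i) j (DirectSum.lof ℂ ℤ (fun i => 𝒰 i) i ⟨a, ha⟩) := by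
    rw [← h1, component, dif_pos h]
    rfl
  rw [h2]
  split_ifs with hij
  · subst hij
    rw [DirectSum.component.lof_self]
  · rw [DirectSum.component.of, dif_neg hij]
    rfl

theorem map_component (hA : DirectSum.IsInternal 𝒰) (hB : DirectSum.IsInternal 𝒱)
    (hf : ∀ j, ∀ a ∈ 𝒰 j, f a ∈ 𝒱 j) (j : ℤ) (a : A) :
    f (component 𝒰 j a) = component 𝒱 j (f a) := by
  have h : a ∈ iSup 𝒰 := hA.submodule_iSup_eq_top ▸ Submodule.mem_top
  refine Submodule.iSup_induction 𝒰 (motive := fun a => f (component 𝒰 j a) = component 𝒱 j (f a))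
    h (fun i a ha => ?_) (by simp) (fun x y hx hy => ?_)
  · rw [component_apply_of_mem hA ha, component_apply_of_mem hB (hf i a ha)]
    split_ifs <;> simp
  · simp only [map_add, Submodule.coe_add, hx, hy]

/-- A chain map between direct sums that respects the gradings commutes with `∂` and `∂̄`. -/
theorem IsBiHom.of_isInternal (hA : DirectSum.IsInternal 𝒰) (hB : DirectSum.IsInternal 𝒱)
    (hf : ∀ j, ∀ a ∈ 𝒰 j, f a ∈ 𝒱 j) (hd : ∀ a, f (dA a) = dB (f a)) :
    IsBiHom dA 𝒰 dB 𝒱 f where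
  map_mem := hf
  map_d := hd
  map_del _ a := (map_component hA hB hf _ _).trans
    (congrArg (fun b => (component 𝒱 _ b : B)) (hd a))
  map_delbar _ a := (map_component hA hB hf _ _).trans
    (congrArg (fun b => (component 𝒱 _ b : B)) (hd a))

/-- The map induced by `g` is a left inverse already on representatives. -/
theorem IsBiHom.mapGH_injective (hf : IsBiHom dA 𝒰 dB 𝒱 f) {g : B →ₗ[ℂ] A}
    (hg : IsBiHom dB 𝒱 dA 𝒰 g) (hgf : ∀ a, g (f a) = a) (j : ℤ) :
    Function.Injective (hf.mapGH j) := by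
  refine Function.LeftInverse.injective (g := hg.mapGH j) fun x => ?_
  obtain ⟨a, rfl⟩ := Submodule.Quotient.mk_surjective _ x
  refine congrArg (Submodule.Quotient.mk) ?_
  exact Subtype.ext (Subtype.ext (hgf a))

end BiHom

/-! ### Smooth sections of the bundles `Uʲ` -/

section Sections

open MeasureTheory
open scoped Manifold ContDiff Topology

variable {E : Type*} [NormedAddCommGroup E] [NormedSpace ℝ E] [FiniteDimensional ℝ E]

instance {G : Type*} [Group G] [TopologicalSpace G] [ChartedSpace E G] :
    FiniteDimensional ℝ (GroupLieAlgebra 𝓘(ℝ, E) G) := inferInstanceAs (FiniteDimensional ℝ E)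

/-- The product of a smooth function and a smooth form. -/
def smulForm {M : Type*} [TopologicalSpace M] [ChartedSpace E M] [IsManifold 𝓘(ℝ, E) ∞ M]
    (f : M → ℂ) (hf : ContMDiff 𝓘(ℝ, E) 𝓘(ℝ, ℂ) ∞ f) : SmoothForm E M →ₗ[ℂ] SmoothForm E M where
  toFun α := ⟨fun x => f x • α.1 x, fun x₀ p => by
    have h1 : ContDiffOn ℝ ∞ (fun y => f ((chartAt E x₀).symm y)) (chartAt E x₀).target :=
      (hf.comp_contMDiffOn (contMDiffOn_symm_of_mem_maximalAtlas
        (IsManifold.chart_mem_maximalAtlas x₀))).contDiffOn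
    exact h1.smul (α.2 x₀ p)⟩
  map_add' α β := Subtype.ext (funext fun x => smul_add (f x) (α.1 x) (β.1 x))
  map_smul' c α := Subtype.ext (funext fun x => smul_comm (f x) c (α.1 x))

variable {G : Type*} [Group G] [TopologicalSpace G] [ChartedSpace E G] [LieGroup 𝓘(ℝ, E) ∞ G]
  {Γ : Subgroup G} [DiscreteTopology Γ]

/-- The isomorphism from the Lie algebra to a tangent space of `Γ \ G` given by the frame. -/
def frameEquiv (q : Nilmanifold Γ) :
    GroupLieAlgebra 𝓘(ℝ, E) G ≃ₗ[ℝ] TangentSpace 𝓘(ℝ, E) q :=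
  LinearEquiv.ofLinearMap (frame Γ q).toLinearMap (frame Γ q).inverse.toLinearMap
    (LinearMap.ext (frame_apply_inverse q)) (LinearMap.ext (frame_inverse_apply q))

/-- The frame at `q` is a linear isomorphism that matches `ρ` with its induced form at `q`, so the
fibre condition becomes one on the Lie algebra that does not depend on `q`. -/
theorem mem_sectionU_invForm {n : ℕ} {ρ : Form (GroupLieAlgebra 𝓘(ℝ, E) G)} {j : ℤ}
    {α : SmoothForm E (Nilmanifold Γ)} :
    α ∈ sectionU n (invForm Γ ρ) j ↔ ∀ q, coeff α.1 q ∈ U n ρ j := by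
  refine forall_congr' fun q => ⟨fun h => ?_, fun h => ?_⟩
  · have h1 := pullback_mem_U (frameEquiv q) h
    change coeff α.1 q ∈ U n (coeff (invForm Γ ρ) q) j at h1
    rwa [coeff_invForm] at h1
  · have h1 := pullback_mem_U (frameEquiv q).symm h
    change Form.pullback (frame Γ q).inverse.toLinearMap (coeff α.1 q) ∈ U n (invForm Γ ρ q) j at h1
    rwa [pullback_inverse_coeff] at h1

theorem incl_mem_sectionU {n : ℕ} {ρ : Form (GroupLieAlgebra 𝓘(ℝ, E) G)} {j : ℤ}
    {a : Form (GroupLieAlgebra 𝓘(ℝ, E) G)} (ha : a ∈ U n ρ j) :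
    incl Γ a ∈ sectionU n (invForm Γ ρ) j :=
  mem_sectionU_invForm.mpr fun q => (coeff_invForm (Γ := Γ) a q).symm ▸ ha

theorem contMDiff_dual_coeff (α : SmoothForm E (Nilmanifold Γ))
    (ℓ : Module.Dual ℂ (Form (GroupLieAlgebra 𝓘(ℝ, E) G))) :
    ContMDiff 𝓘(ℝ, E) 𝓘(ℝ, ℂ) ∞ (fun q => ℓ (coeff α.1 q)) := by
  induction ℓ using Form.dual_induction with
  | h0 => exact contMDiff_const
  | heval p X => exact contMDiff_coeff α.2 p X
  | hadd ℓ ℓ' h h' => exact h.add h'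
  | hsmul c ℓ h => exact (contDiff_const_smul (𝕜 := ℝ) c).contMDiff.comp h

/-- A form on `Γ \ G` is a combination of left-invariant forms with smooth coefficients. -/
theorem eq_sum_smulForm (α : SmoothForm E (Nilmanifold Γ)) :
    let b := Module.finBasis ℂ (Form (GroupLieAlgebra 𝓘(ℝ, E) G))
    α = ∑ i, smulForm _ (contMDiff_dual_coeff α (b.coord i)) (incl Γ (b i)) := by
  intro b
  refine Subtype.ext (coeff_injective (funext fun q => ?_))
  let T : SmoothForm E (Nilmanifold Γ) →ₗ[ℂ] Form (GroupLieAlgebra 𝓘(ℝ, E) G) :=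
    { toFun := fun β => coeff β.1 q, map_add' := fun _ _ => rfl, map_smul' := fun _ _ => rfl }
  change T α = T _
  rw [map_sum]
  have h : ∀ i, T (smulForm _ (contMDiff_dual_coeff α (b.coord i)) (incl Γ (b i))) =
      b.coord i (T α) • b i := fun i => by
    have h1 : T (incl Γ (b i)) = b i := coeff_invForm (b i) q
    conv_rhs => rw [← h1]
    rfl
  simp only [h]
  exact (b.sum_repr (T α)).symm

/-- Independence is checked pointwise on coefficients. For spanning, a form is a sum of functions
times invariant forms; each invariant form splits into its `U` components, and multiplication by a
function preserves the sections of each. -/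
theorem isInternal_sectionU {n : ℕ} {ρ : Form (GroupLieAlgebra 𝓘(ℝ, E) G)}
    (h : DirectSum.IsInternal (U n ρ)) :
    DirectSum.IsInternal (sectionU n (invForm Γ ρ)) := by
  classical
  rw [DirectSum.isInternal_submodule_iff_iSupIndep_and_iSup_eq_top] at h ⊢
  constructor
  · rw [iSupIndep_iff_finsetSum_eq_zero_imp_eq_zero]
    intro s v hv hsum i hi
    refine Subtype.ext (coeff_injective (funext fun q => ?_))
    let T : SmoothForm E (Nilmanifold Γ) →ₗ[ℂ] Form (GroupLieAlgebra 𝓘(ℝ, E) G) :=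
      { toFun := fun β => coeff β.1 q, map_add' := fun _ _ => rfl, map_smul' := fun _ _ => rfl }
    have h1 := (iSupIndep_iff_finsetSum_eq_zero_imp_eq_zero (U n ρ)).mp h.1 s (fun j => T (v j))
      (fun j hj => mem_sectionU_invForm.mp (hv j hj) q) (by rw [← map_sum, hsum, map_zero]) i hi
    exact h1
  · refine (Submodule.eq_top_iff'.mpr fun α => ?_)
    rw [eq_sum_smulForm α]
    refine Submodule.sum_mem _ fun i _ => ?_
    have h1 : ∀ (f : Nilmanifold Γ → ℂ) (hf : ContMDiff 𝓘(ℝ, E) 𝓘(ℝ, ℂ) ∞ f)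
        (a : Form (GroupLieAlgebra 𝓘(ℝ, E) G)),
        smulForm f hf (incl Γ a) ∈ ⨆ j, sectionU n (invForm Γ ρ) j := fun f hf a => by
      have ha : a ∈ iSup (U n ρ) := h.2 ▸ Submodule.mem_top
      refine Submodule.iSup_induction (U n ρ)
        (motive := fun a => smulForm f hf (incl Γ a) ∈ ⨆ j, sectionU n (invForm Γ ρ) j) ha
        (fun j a ha => ?_) (by simp) (fun x y hx hy => ?_)
      · refine Submodule.mem_iSup_of_mem j fun q => ?_
        exact (U n (invForm Γ ρ q) j).smul_mem (f q) (incl_mem_sectionU ha q)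
      · rw [map_add, map_add]
        exact Submodule.add_mem _ hx hy
    exact h1 _ _ _

variable [CompactSpace (Nilmanifold Γ)] [MeasurableSpace (Nilmanifold Γ)]
  [BorelSpace (Nilmanifold Γ)]

theorem dual_average (ν : Measure (Nilmanifold Γ)) [IsFiniteMeasure ν]
    (α : SmoothForm E (Nilmanifold Γ)) (ℓ : Module.Dual ℂ (Form (GroupLieAlgebra 𝓘(ℝ, E) G))) :
    ℓ (average ν α) = ∫ q, ℓ (coeff α.1 q) ∂ν := by
  have hint : ∀ ℓ : Module.Dual ℂ (Form (GroupLieAlgebra 𝓘(ℝ, E) G)),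
      Integrable (fun q => ℓ (coeff α.1 q)) ν := fun ℓ =>
    integrable_of_continuous_of_compactSpace (contMDiff_dual_coeff α ℓ).continuous
  induction ℓ using Form.dual_induction with
  | h0 => simp
  | heval p X => rfl
  | hadd ℓ ℓ' h h' =>
    rw [LinearMap.add_apply, h, h']
    exact (integral_add (hint ℓ) (hint ℓ')).symm
  | hsmul c ℓ h =>
    rw [LinearMap.smul_apply, h]
    exact (integral_const_mul c _).symm

/-- A functional that kills the subspace kills every value of the coefficient function, hence its
integral. Functionals separate a point from a subspace. -/
theorem average_mem_U (ν : Measure (Nilmanifold Γ)) [IsFiniteMeasure ν] {n : ℕ}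
    {ρ : Form (GroupLieAlgebra 𝓘(ℝ, E) G)} {j : ℤ} {α : SmoothForm E (Nilmanifold Γ)}
    (hα : α ∈ sectionU n (invForm Γ ρ) j) : average ν α ∈ U n ρ j := by
  by_contra h
  obtain ⟨ℓ, h1, h2⟩ := Submodule.exists_le_ker_of_notMem h
  refine h1 ?_
  rw [dual_average]
  have h3 : ∀ q, ℓ (coeff α.1 q) = 0 := fun q => h2 (mem_sectionU_invForm.mp hα q)
  simp [h3]

end Sections

/-! ### Wedge products as alternatizations of products of multilinear maps -/

section Wedge

open MultilinearMap (alternatization)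

theorem alternatization_domDomCongr {ι ι' V N : Type*} [Fintype ι] [Fintype ι'] [DecidableEq ι]
    [DecidableEq ι'] [AddCommGroup V] [Module ℝ V] [AddCommGroup N] [Module ℝ N] (e : ι ≃ ι')
    (m : MultilinearMap ℝ (fun _ : ι => V) N) :
    alternatization (m.domDomCongr e) = (alternatization m).domDomCongr e := by
  ext v
  rw [AlternatingMap.domDomCongr_apply, MultilinearMap.alternatization_apply, MultilinearMap.alternatization_apply]
  refine (Fintype.sum_equiv e.permCongr _ _ fun σ => ?_).symm
  rw [Equiv.Perm.sign_permCongr]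
  congr 1
  simp only [MultilinearMap.domDomCongr_apply]
  congr 1
  funext i
  simp [Equiv.permCongr_apply]

theorem alternatization_domDomCongr_perm {ι V N : Type*} [Fintype ι] [DecidableEq ι]
    [AddCommGroup V] [Module ℝ V] [AddCommGroup N] [Module ℝ N] (σ : Equiv.Perm ι)
    (m : MultilinearMap ℝ (fun _ : ι => V) N) :
    alternatization (m.domDomCongr σ) = Equiv.Perm.sign σ • alternatization m := by
  rw [alternatization_domDomCongr, AlternatingMap.domDomCongr_perm]

variable {V : Type*} [AddCommGroup V] [Module ℝ V]

/-- `(v₀, …, vₚ) ↦ ξ (v₀) f (v₁, …, vₚ)`. -/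
def consMul (ξ : Module.Dual ℝ V) {p : ℕ} (f : MultilinearMap ℝ (fun _ : Fin p => V) ℂ) :
    MultilinearMap ℝ (fun _ : Fin (p + 1) => V) ℂ :=
  LinearMap.uncurryLeft (M := fun _ : Fin (p + 1) => V) (ξ.smulRight f)

theorem consMul_apply (ξ : Module.Dual ℝ V) {p : ℕ} (f : MultilinearMap ℝ (fun _ : Fin p => V) ℂ)
    (v : Fin (p + 1) → V) : consMul ξ f v = ξ (v 0) • f (fun i => v i.succ) := rfl

/-- Both sides agree after multiplication by `(p + 1)!`. The left side is a signed sum of `p + 1`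
permuted copies of `consMul ξ (Alt f)`, all with the same alternatization, which is `p!` times that
of `consMul ξ f`. -/
theorem alternatizeUncurryFin_smulRight_alternatization (ξ : Module.Dual ℝ V) {p : ℕ}
    (f : MultilinearMap ℝ (fun _ : Fin p => V) ℂ) :
    AlternatingMap.alternatizeUncurryFin (ξ.smulRight (alternatization f)) =
      alternatization (consMul ξ f) := by
  -- The permutation `i.cycleRange.symm` moves `i` to the front and keeps the order of the rest; its
  -- sign is `(-1)^i`.
  have h1 : ∀ g : V [⋀^Fin p]→ₗ[ℝ] ℂ,
      ((AlternatingMap.alternatizeUncurryFin (ξ.smulRight g) : V [⋀^Fin (p + 1)]→ₗ[ℝ] ℂ) :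
        MultilinearMap ℝ (fun _ : Fin (p + 1) => V) ℂ) =
      ∑ i : Fin (p + 1), Equiv.Perm.sign i.cycleRange.symm •
        (consMul ξ (g : MultilinearMap ℝ (fun _ : Fin p => V) ℂ)).domDomCongr
          i.cycleRange.symm := fun g => by
    ext v
    rw [AlternatingMap.coe_multilinearMap, AlternatingMap.alternatizeUncurryFin_apply,
      sum_apply]
    refine Finset.sum_congr rfl fun i _ => ?_
    rw [smul_apply, MultilinearMap.domDomCongr_apply, consMul_apply, Fin.cycleRange_symm_zero,
      Equiv.Perm.sign_symm, Fin.sign_cycleRange]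
    have h2 : (fun j : Fin p => v (i.cycleRange.symm j.succ)) = i.removeNth v := by
      funext j
      rw [Fin.cycleRange_symm_succ]
      rfl
    rw [h2]
    simp [Units.smul_def]
  -- The inner alternatization permutes the last `p` arguments. Such a permutation is one of `Fin (p
  -- + 1)` fixing `0`, of the same sign, and is absorbed by the outer one.
  have h2 : alternatization (consMul ξ (alternatization f : V [⋀^Fin p]→ₗ[ℝ] ℂ).toMultilinearMap) =
      (p.factorial : ℕ) • alternatization (consMul ξ f) := by
    have h3 : consMul ξ (alternatization f : V [⋀^Fin p]→ₗ[ℝ] ℂ).toMultilinearMap =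
        ∑ σ : Equiv.Perm (Fin p), Equiv.Perm.sign σ •
          (consMul ξ f).domDomCongr (Equiv.Perm.decomposeFin.symm (0, σ)) := by
      ext v
      rw [consMul_apply, AlternatingMap.coe_multilinearMap, MultilinearMap.alternatization_apply,
        sum_apply, Finset.smul_sum]
      refine Finset.sum_congr rfl fun σ _ => ?_
      rw [smul_apply, MultilinearMap.domDomCongr_apply, MultilinearMap.domDomCongr_apply, consMul_apply, smul_comm]
      have h0 : Equiv.Perm.decomposeFin.symm ((0 : Fin (p + 1)), σ) 0 = 0 :=
        Equiv.Perm.decomposeFin_symm_apply_zero 0 σ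
      have hs : ∀ j : Fin p, Equiv.Perm.decomposeFin.symm ((0 : Fin (p + 1)), σ) j.succ =
          (σ j).succ := fun j => by
        rw [Equiv.Perm.decomposeFin_symm_apply_succ, Equiv.swap_self, Equiv.refl_apply]
      rw [h0]
      exact congrArg (fun w => Equiv.Perm.sign σ • ξ (v 0) • f w)
        (funext fun j => congrArg v (hs j).symm)
    rw [h3, map_sum]
    have h4 : ∀ σ : Equiv.Perm (Fin p), alternatization (Equiv.Perm.sign σ •
        (consMul ξ f).domDomCongr (Equiv.Perm.decomposeFin.symm (0, σ))) =
        alternatization (consMul ξ f) := fun σ => by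
      rw [Units.smul_def, map_zsmul, ← Units.smul_def, alternatization_domDomCongr_perm, smul_smul]
      simp [Equiv.Perm.decomposeFin.symm_sign]
    simp [h4, Finset.card_univ, Fintype.card_perm]
  have h5 := AlternatingMap.coe_alternatization
    (AlternatingMap.alternatizeUncurryFin (ξ.smulRight (alternatization f)) :
      V [⋀^Fin (p + 1)]→ₗ[ℝ] ℂ)
  rw [h1, map_sum] at h5
  have h6 : ∀ i : Fin (p + 1), alternatization (Equiv.Perm.sign i.cycleRange.symm •
      (consMul ξ (alternatization f : V [⋀^Fin p]→ₗ[ℝ] ℂ).toMultilinearMap).domDomCongr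
        i.cycleRange.symm) = (p.factorial : ℕ) • alternatization (consMul ξ f) := fun i => by
    rw [Units.smul_def, map_zsmul, ← Units.smul_def, alternatization_domDomCongr_perm, smul_smul, h2]
    simp
  simp only [h6, Finset.sum_const, Finset.card_univ, Fintype.card_fin, smul_smul] at h5
  rw [← Nat.factorial_succ] at h5
  exact (smul_right_injective _ (Nat.factorial_ne_zero (p + 1)) h5).symm

/-- The product of two multilinear maps in disjoint sets of variables. -/
def prodMul {p q : ℕ} (f : MultilinearMap ℝ (fun _ : Fin p => V) ℂ)
    (g : MultilinearMap ℝ (fun _ : Fin q => V) ℂ) :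
    MultilinearMap ℝ (fun _ : Fin (p + q) => V) ℂ :=
  ((LinearMap.mul' ℝ ℂ).compMultilinearMap (MultilinearMap.domCoprod f g)).domDomCongr
    finSumFinEquiv

theorem prodMul_apply {p q : ℕ} (f : MultilinearMap ℝ (fun _ : Fin p => V) ℂ)
    (g : MultilinearMap ℝ (fun _ : Fin q => V) ℂ) (v : Fin (p + q) → V) :
    prodMul f g v = f (fun i => v (i.castAdd q)) * g (fun i => v (i.natAdd p)) := by
  simp [prodMul, MultilinearMap.domCoprod]

/-- With `exists_eq_alternatization`, this replaces sums over shuffles by plain products, for which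
bilinearity and associativity are evident. -/
theorem wedge_alternatization {p q : ℕ} (f : MultilinearMap ℝ (fun _ : Fin p => V) ℂ)
    (g : MultilinearMap ℝ (fun _ : Fin q => V) ℂ) :
    Form.wedge (alternatization f) (alternatization g) = alternatization (prodMul f g) := by
  rw [Form.wedge, prodMul, alternatization_domDomCongr, ← MultilinearMap.domCoprod_alternization,
    LinearMap.compMultilinearMap_alternatization]

theorem exists_eq_alternatization {p : ℕ} (a : V [⋀^Fin p]→ₗ[ℝ] ℂ) :
    ∃ f : MultilinearMap ℝ (fun _ : Fin p => V) ℂ, a = alternatization f := by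
  refine ⟨((p.factorial : ℝ)⁻¹ • a).toMultilinearMap, ?_⟩
  rw [AlternatingMap.coe_alternatization, Fintype.card_fin, ← Nat.cast_smul_eq_nsmul ℝ, smul_smul,
    mul_inv_cancel₀ (Nat.cast_ne_zero.mpr (Nat.factorial_ne_zero p)), one_smul]

/-- Associativity with a one-form on the left: both sides are the alternatization of `ξ ⊗ f ⊗ g`.
The general case follows by induction on generators. -/
theorem wedge_alternatizeUncurryFin (ξ : Module.Dual ℝ V) {p q : ℕ} (a : V [⋀^Fin p]→ₗ[ℝ] ℂ)
    (b : V [⋀^Fin q]→ₗ[ℝ] ℂ) :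
    Form.wedge (AlternatingMap.alternatizeUncurryFin (ξ.smulRight a)) b =
      (AlternatingMap.alternatizeUncurryFin (ξ.smulRight (Form.wedge a b))).domDomCongr
        (finCongr (Nat.add_right_comm p q 1)) := by
  obtain ⟨f, rfl⟩ := exists_eq_alternatization a
  obtain ⟨g, rfl⟩ := exists_eq_alternatization b
  rw [wedge_alternatization, alternatizeUncurryFin_smulRight_alternatization,
    alternatizeUncurryFin_smulRight_alternatization, wedge_alternatization,
    ← alternatization_domDomCongr]
  congr 1
  ext v
  rw [MultilinearMap.domDomCongr_apply, consMul_apply, prodMul_apply, prodMul_apply, consMul_apply,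
    smul_mul_assoc]
  refine congrArg₂ (fun x y => ξ (v 0) • (x * y)) ?_ ?_
  · rfl
  · refine congrArg g (funext fun i => congrArg v (Fin.ext ?_))
    simp
    omega

theorem wedge_constOfIsEmpty (c : ℂ) {q : ℕ} (b : V [⋀^Fin q]→ₗ[ℝ] ℂ) :
    Form.wedge (AlternatingMap.constOfIsEmpty ℝ V (Fin 0) c) b =
      (c • b).domDomCongr (finCongr (Nat.zero_add q).symm) := by
  obtain ⟨g, rfl⟩ := exists_eq_alternatization b
  have h1 : AlternatingMap.constOfIsEmpty ℝ V (Fin 0) c =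
      alternatization (MultilinearMap.constOfIsEmpty ℝ (fun _ : Fin 0 => V) c) := by
    ext v
    simp [MultilinearMap.alternatization_apply]
  have h2 : c • alternatization g = alternatization (c • g) := by
    ext v
    simp [MultilinearMap.alternatization_apply, Finset.mul_sum, mul_smul_comm]
  rw [h1, wedge_alternatization, h2, ← alternatization_domDomCongr]
  congr 1
  ext v
  rw [prodMul_apply, MultilinearMap.domDomCongr_apply]
  refine congrArg (fun x => c * g x) (funext fun i => congrArg v (Fin.ext ?_))
  simp

end Wedge

/-! ### Exterior multiplication, contraction and Euler's identity -/

section Mul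

variable {V : Type*} [AddCommGroup V] [Module ℝ V]

namespace Form

theorem extMul_apply_zero (ξ : Module.Dual ℝ V) (a : Form V) : extMul ξ a 0 = 0 := rfl

theorem extMul_apply_succ (ξ : Module.Dual ℝ V) (a : Form V) (p : ℕ) :
    extMul ξ a (p + 1) = AlternatingMap.alternatizeUncurryFin (ξ.smulRight (a p)) := rfl

theorem extMul_apply_apply (ξ : Module.Dual ℝ V) (a : Form V) (p : ℕ) (v : Fin (p + 1) → V) :
    extMul ξ a (p + 1) v =
      ∑ i : Fin (p + 1), (-1 : ℤ) ^ (i : ℕ) • ξ (v i) • a p (i.removeNth v) := by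
  rw [extMul_apply_succ, AlternatingMap.alternatizeUncurryFin_apply]
  rfl

theorem contract_apply (X : V) (a : Form V) (p : ℕ) (v : Fin p → V) :
    contract X a p v = a (p + 1) (Matrix.vecCons X v) := rfl

theorem alternating_sum_apply {ι : Type*} {p : ℕ} (s : Finset ι) (f : ι → V [⋀^Fin p]→ₗ[ℝ] ℂ)
    (v : Fin p → V) : (∑ i ∈ s, f i) v = ∑ i ∈ s, f i v :=
  map_sum (⟨⟨fun f => f v, rfl⟩, fun _ _ => rfl⟩ : (V [⋀^Fin p]→ₗ[ℝ] ℂ) →+ ℂ) f s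

theorem ofDegree_same {p : ℕ} (a : V [⋀^Fin p]→ₗ[ℝ] ℂ) : ofDegree a p = a :=
  Pi.single_eq_same (M := fun p => V [⋀^Fin p]→ₗ[ℝ] ℂ) p a

theorem ofDegree_of_ne {p q : ℕ} (a : V [⋀^Fin p]→ₗ[ℝ] ℂ) (h : q ≠ p) : ofDegree a q = 0 :=
  Pi.single_eq_of_ne (M := fun p => V [⋀^Fin p]→ₗ[ℝ] ℂ) h a

theorem ofDegree_domDomCongr {p q : ℕ} (h : p = q) (a : V [⋀^Fin p]→ₗ[ℝ] ℂ) :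
    ofDegree (a.domDomCongr (finCongr h)) = ofDegree a := by
  subst h
  rfl

theorem wedge_add_left {p q : ℕ} (a a' : V [⋀^Fin p]→ₗ[ℝ] ℂ) (b : V [⋀^Fin q]→ₗ[ℝ] ℂ) :
    wedge (a + a') b = wedge a b + wedge a' b := by
  obtain ⟨f, rfl⟩ := exists_eq_alternatization a
  obtain ⟨f', rfl⟩ := exists_eq_alternatization a'
  obtain ⟨g, rfl⟩ := exists_eq_alternatization b
  rw [← map_add, wedge_alternatization, wedge_alternatization, wedge_alternatization, ← map_add]
  congr 1
  ext v
  simp [prodMul_apply, add_mul]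

theorem wedge_add_right {p q : ℕ} (a : V [⋀^Fin p]→ₗ[ℝ] ℂ) (b b' : V [⋀^Fin q]→ₗ[ℝ] ℂ) :
    wedge a (b + b') = wedge a b + wedge a b' := by
  obtain ⟨f, rfl⟩ := exists_eq_alternatization a
  obtain ⟨g, rfl⟩ := exists_eq_alternatization b
  obtain ⟨g', rfl⟩ := exists_eq_alternatization b'
  rw [← map_add, wedge_alternatization, wedge_alternatization, wedge_alternatization, ← map_add]
  congr 1
  ext v
  simp [prodMul_apply, mul_add]

theorem alternatization_smul {p : ℕ} (c : ℂ) (f : MultilinearMap ℝ (fun _ : Fin p => V) ℂ) :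
    MultilinearMap.alternatization (c • f) = c • MultilinearMap.alternatization f := by
  ext v
  simp [MultilinearMap.alternatization_apply, Finset.mul_sum, mul_smul_comm]

theorem wedge_smul_left {p q : ℕ} (c : ℂ) (a : V [⋀^Fin p]→ₗ[ℝ] ℂ) (b : V [⋀^Fin q]→ₗ[ℝ] ℂ) :
    wedge (c • a) b = c • wedge a b := by
  obtain ⟨f, rfl⟩ := exists_eq_alternatization a
  obtain ⟨g, rfl⟩ := exists_eq_alternatization b
  rw [← alternatization_smul, wedge_alternatization, wedge_alternatization, ← alternatization_smul]
  congr 1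
  ext v
  simp [prodMul_apply, mul_assoc]

theorem wedge_smul_right {p q : ℕ} (c : ℂ) (a : V [⋀^Fin p]→ₗ[ℝ] ℂ) (b : V [⋀^Fin q]→ₗ[ℝ] ℂ) :
    wedge a (c • b) = c • wedge a b := by
  obtain ⟨f, rfl⟩ := exists_eq_alternatization a
  obtain ⟨g, rfl⟩ := exists_eq_alternatization b
  rw [← alternatization_smul, wedge_alternatization, wedge_alternatization, ← alternatization_smul]
  congr 1
  ext v
  simp [prodMul_apply, mul_left_comm]

theorem wedge_zero_left {p q : ℕ} (b : V [⋀^Fin q]→ₗ[ℝ] ℂ) :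
    wedge (0 : V [⋀^Fin p]→ₗ[ℝ] ℂ) b = 0 := by
  simpa using wedge_smul_left 0 (0 : V [⋀^Fin p]→ₗ[ℝ] ℂ) b

theorem wedge_zero_right {p q : ℕ} (a : V [⋀^Fin p]→ₗ[ℝ] ℂ) :
    wedge a (0 : V [⋀^Fin q]→ₗ[ℝ] ℂ) = 0 := by
  simpa using wedge_smul_right 0 a (0 : V [⋀^Fin q]→ₗ[ℝ] ℂ)

/-- Left multiplication by a form, as a bilinear map. -/
def mulL : Form V →ₗ[ℂ] Form V →ₗ[ℂ] Form V :=
  LinearMap.mk₂ ℂ mul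
    (fun a a' b => by
      funext p
      ext v
      simp [mul, wedge_add_left, Finset.sum_add_distrib])
    (fun c a b => by
      funext p
      rw [Pi.smul_apply, mul, mul, Finset.smul_sum]
      refine Finset.sum_congr rfl fun x _ => ?_
      rw [Pi.smul_apply, wedge_smul_left]
      rfl)
    (fun a b b' => by
      funext p
      ext v
      simp [mul, wedge_add_right, Finset.sum_add_distrib])
    (fun c a b => by
      funext p
      rw [Pi.smul_apply, mul, mul, Finset.smul_sum]
      refine Finset.sum_congr rfl fun x _ => ?_
      rw [Pi.smul_apply, wedge_smul_right]
      rfl)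

theorem mulL_apply (a b : Form V) : mulL a b = mul a b := rfl

theorem mul_apply_eq_zero {a b : Form V} {r : ℕ} (h : ∀ i j, i + j = r → a i = 0 ∨ b j = 0) :
    mul a b r = 0 := by
  refine Finset.sum_eq_zero fun x _ => ?_
  rcases h x.1.1 x.1.2 (Finset.HasAntidiagonal.mem_antidiagonal.mp x.2) with h | h
  · rw [h, wedge_zero_left]
    rfl
  · rw [h, wedge_zero_right]
    rfl

theorem mul_ofDegree {p q : ℕ} (a : V [⋀^Fin p]→ₗ[ℝ] ℂ) (b : V [⋀^Fin q]→ₗ[ℝ] ℂ) :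
    mul (ofDegree a) (ofDegree b) = ofDegree (wedge a b) := by
  funext r
  by_cases h : r = p + q
  · subst h
    rw [ofDegree_same]
    refine (Finset.sum_eq_single ⟨(p, q), Finset.HasAntidiagonal.mem_antidiagonal.mpr rfl⟩
      (fun x _ hx => ?_) (fun h => absurd (Finset.mem_univ _) h)).trans ?_
    · have h1 : x.1.1 ≠ p ∨ x.1.2 ≠ q := by
        by_contra hne
        push Not at hne
        exact hx (Subtype.ext (Prod.ext hne.1 hne.2))
      rcases h1 with h1 | h1
      · rw [ofDegree_of_ne a h1, wedge_zero_left]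
        rfl
      · rw [ofDegree_of_ne b h1, wedge_zero_right]
        rfl
    · rw [ofDegree_same, ofDegree_same]
      rfl
  · rw [ofDegree_of_ne _ h]
    refine mul_apply_eq_zero fun i j hij => ?_
    by_cases hi : i = p
    · exact Or.inr (ofDegree_of_ne b (by omega))
    · exact Or.inl (ofDegree_of_ne a hi)

theorem extMul_ofDegree (ξ : Module.Dual ℝ V) {p : ℕ} (a : V [⋀^Fin p]→ₗ[ℝ] ℂ) :
    extMul ξ (ofDegree a) = ofDegree (AlternatingMap.alternatizeUncurryFin (ξ.smulRight a)) := by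
  funext r
  cases r with
  | zero => exact (ofDegree_of_ne _ (Nat.zero_ne_add_one p)).symm
  | succ r =>
    rw [extMul_apply_succ]
    by_cases h : r = p
    · subst h
      rw [ofDegree_same, ofDegree_same]
    · rw [ofDegree_of_ne _ h, ofDegree_of_ne _ (by omega)]
      ext v
      simp [AlternatingMap.alternatizeUncurryFin_apply]

/-- In the alternating sum the term `i = 0` evaluates `ξ` on `X`; in the others `X` stays the first
argument of `a`, and the index shift changes the sign. -/
theorem contract_extMul (X : V) (ξ : Module.Dual ℝ V) (a : Form V) :
    contract X (extMul ξ a) = (ξ X : ℂ) • a - extMul ξ (contract X a) := by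
  funext p
  ext v
  change extMul ξ a (p + 1) (Matrix.vecCons X v) =
    (ξ X : ℂ) * a p v - extMul ξ (contract X a) p v
  rw [extMul_apply_apply, Fin.sum_univ_succ, sub_eq_add_neg]
  congr 1
  · rw [Fin.val_zero, pow_zero, one_smul, Complex.real_smul]
    rfl
  · cases p with
    | zero => simp [extMul_apply_zero]
    | succ p =>
      rw [extMul_apply_apply, ← Finset.sum_neg_distrib]
      refine Finset.sum_congr rfl fun i _ => ?_
      rw [contract_apply, Fin.val_succ, pow_succ, mul_neg_one, neg_smul]
      congr 3
      refine congrArg (a (p + 1)) (funext fun j => ?_)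
      refine Fin.cases rfl (fun j => ?_) j
      simp [Fin.removeNth, Fin.succ_succAbove_succ]

theorem contract_contract (X Y : V) (a : Form V) :
    contract X (contract Y a) = -contract Y (contract X a) := by
  funext p
  ext v
  change a (p + 2) (Matrix.vecCons Y (Matrix.vecCons X v)) =
    -a (p + 2) (Matrix.vecCons X (Matrix.vecCons Y v))
  have h := (a (p + 2)).map_swap (Matrix.vecCons X (Matrix.vecCons Y v))
    (i := 0) (j := 1) (by simp)
  rw [← h]
  refine congrArg (a (p + 2)) (funext fun j => ?_)
  refine Fin.cases (by simp) (fun j => Fin.cases (by simp) (fun j => ?_) j) j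
  rw [Function.comp_apply, Equiv.swap_apply_of_ne_of_ne (Fin.succ_ne_zero _)
    (by simp [Fin.ext_iff])]
  rfl

/-- Induction on the degree: contracting with the first argument reduces the claim for `a` to the
claim for its contraction, and the scalar terms cancel. -/
theorem extMul_extMul (ξ η : Module.Dual ℝ V) (a : Form V) :
    extMul ξ (extMul η a) = -extMul η (extMul ξ a) := by
  have h : ∀ (p : ℕ) (a : Form V), extMul ξ (extMul η a) p = -extMul η (extMul ξ a) p := by
    intro p
    induction p with
    | zero => simp [extMul_apply_zero]
    | succ p ih =>
      intro a
      ext v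
      have h2 : Matrix.vecCons (v 0) (fun i => v i.succ) = v := Matrix.cons_head_tail v
      have h3 : ∀ b : Form V, b (p + 1) v = contract (v 0) b p (fun i => v i.succ) := fun b => by
        rw [contract_apply, h2]
      rw [AlternatingMap.neg_apply, h3, h3, contract_extMul, contract_extMul, contract_extMul,
        contract_extMul]
      have h4 := congrArg (fun b => b (fun i => v i.succ)) (ih (contract (v 0) a))
      simp only [map_sub, map_smul, Pi.sub_apply, Pi.smul_apply, AlternatingMap.sub_apply,
        AlternatingMap.smul_apply, AlternatingMap.neg_apply] at h4 ⊢
      rw [h4]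
      ring
  exact funext fun p => h p a

/-- Euler's identity. -/
theorem sum_extMul_contract {ι : Type*} [Fintype ι] (b : Module.Basis ι ℝ V) {p : ℕ}
    (a : V [⋀^Fin p]→ₗ[ℝ] ℂ) :
    ∑ i, extMul (b.coord i) (contract (b i) (ofDegree a)) = (p : ℂ) • ofDegree a := by
  classical
  funext r
  rw [Finset.sum_apply, Pi.smul_apply]
  cases r with
  | zero =>
    simp only [extMul_apply_zero, Finset.sum_const_zero]
    cases p with
    | zero => simp
    | succ p => rw [ofDegree_of_ne _ (Nat.zero_ne_add_one p), smul_zero]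
  | succ r =>
    ext v
    rw [alternating_sum_apply]
    simp only [extMul_apply_apply, contract_apply]
    rw [Finset.sum_comm]
    -- Summing over the basis reassembles `v j` as first argument; moving it back to position `j`
    -- absorbs the sign, so each `j` contributes one copy of `a v`.
    have h1 : ∀ j : Fin (r + 1), ∑ i, (-1 : ℤ) ^ (j : ℕ) • b.coord i (v j) •
        ofDegree a (r + 1) (Matrix.vecCons (b i) (j.removeNth v)) = ofDegree a (r + 1) v :=
      fun j => by
        rw [← Finset.smul_sum]
        have h2 : ∑ i, b.coord i (v j) • ofDegree a (r + 1) (Matrix.vecCons (b i) (j.removeNth v)) =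
            (ofDegree a (r + 1)).curryLeft (∑ i, b.repr (v j) i • b i) (j.removeNth v) := by
          rw [map_sum, alternating_sum_apply]
          refine Finset.sum_congr rfl fun i _ => ?_
          rw [map_smul]
          rfl
        rw [h2, b.sum_repr, AlternatingMap.curryLeft_apply_apply]
        have h3 := (ofDegree a (r + 1)).map_insertNth j (v j) (j.removeNth v)
        rw [Fin.insertNth_self_removeNth] at h3
        exact h3.symm
    simp only [h1, Finset.sum_const, Finset.card_univ, Fintype.card_fin]
    by_cases h : r + 1 = p
    · subst h
      simp
    · rw [ofDegree_of_ne a h]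
      simp

variable [FiniteDimensional ℝ V]

theorem eq_sum_ofDegree (a : Form V) :
    a = ∑ p ∈ Finset.range (Module.finrank ℝ V + 1), ofDegree (a p) := by
  funext r
  rw [Finset.sum_apply]
  by_cases h : r < Module.finrank ℝ V + 1
  · rw [Finset.sum_eq_single r (fun p _ hp => ofDegree_of_ne _ hp.symm)
      (fun hr => absurd (Finset.mem_range.mpr h) hr), ofDegree_same]
  · rw [alternating_eq_zero_of_finrank_lt (by omega) (a r), Finset.sum_eq_zero]
    intro p hp
    exact ofDegree_of_ne _ (by rw [Finset.mem_range] at hp; omega)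

theorem induction_ofDegree {P : Form V → Prop} (h0 : P 0) (hadd : ∀ a b, P a → P b → P (a + b))
    (h : ∀ p (a : V [⋀^Fin p]→ₗ[ℝ] ℂ), P (ofDegree a)) (a : Form V) : P a := by
  rw [eq_sum_ofDegree a]
  exact Finset.sum_induction _ P hadd h0 fun p _ => h p (a p)

end Form
end Mul

/-! ### The associative algebra of forms, with contraction as an antiderivation -/

section Algebra

variable {V : Type*} [AddCommGroup V] [Module ℝ V]

namespace Form

theorem contract_ofDegree (X : V) {p : ℕ} (a : V [⋀^Fin (p + 1)]→ₗ[ℝ] ℂ) :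
    contract X (ofDegree a) = ofDegree (a.curryLeft X) := by
  funext r
  by_cases h : r = p
  · subst h
    rw [ofDegree_same]
    change (ofDegree a (r + 1)).curryLeft X = _
    rw [ofDegree_same]
  · rw [ofDegree_of_ne _ h]
    change (ofDegree a (r + 1)).curryLeft X = 0
    rw [ofDegree_of_ne a (by omega)]
    rfl

theorem contract_one (X : V) : contract X (one : Form V) = 0 := by
  funext r
  change (one (r + 1)).curryLeft X = 0
  rw [one, ofDegree_of_ne _ (Nat.succ_ne_zero r)]
  rfl

theorem ofDegree_zero_eq_smul_one (a : V [⋀^Fin 0]→ₗ[ℝ] ℂ) : ofDegree a = a ![] • (one : Form V) := by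
  have h : a = a ![] • AlternatingMap.constOfIsEmpty ℝ V (Fin 0) (1 : ℂ) := by
    ext v
    rw [Subsingleton.elim v ![]]
    simp
  rw [one, ofDegree, ofDegree, ← Pi.single_smul, ← h]

/-- The sign of the degree. -/
def parity : Form V →ₗ[ℂ] Form V where
  toFun a p := (-1 : ℂ) ^ p • a p
  map_add' a b := funext fun p => smul_add _ (a p) (b p)
  map_smul' c a := funext fun p => smul_comm _ c (a p)

theorem parity_ofDegree {p : ℕ} (a : V [⋀^Fin p]→ₗ[ℝ] ℂ) :
    parity (ofDegree a) = (-1 : ℂ) ^ p • ofDegree a := by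
  funext r
  by_cases h : r = p
  · subst h
    rfl
  · change (-1 : ℂ) ^ r • ofDegree a r = (-1 : ℂ) ^ p • ofDegree a r
    rw [ofDegree_of_ne a h, smul_zero, smul_zero]

theorem parity_one : parity (one : Form V) = one := by
  rw [one, parity_ofDegree, pow_zero, one_smul]

theorem parity_extMul (ξ : Module.Dual ℝ V) (a : Form V) :
    parity (extMul ξ a) = -extMul ξ (parity a) := by
  funext r
  cases r with
  | zero => simp [parity, extMul_apply_zero]
  | succ r =>
    ext v
    change (-1 : ℂ) ^ (r + 1) • extMul ξ a (r + 1) v = -extMul ξ (parity a) (r + 1) v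
    rw [extMul_apply_apply, extMul_apply_apply, Finset.smul_sum, ← Finset.sum_neg_distrib]
    refine Finset.sum_congr rfl fun i _ => ?_
    change _ = -((-1 : ℤ) ^ (i : ℕ) • ξ (v i) • ((-1 : ℂ) ^ r • a r (i.removeNth v)))
    rw [pow_succ, mul_neg_one, neg_smul, smul_comm _ ((-1 : ℤ) ^ (i : ℕ)), smul_comm _ (ξ (v i))]

theorem conj_add (a b : Form V) : conj (a + b) = conj a + conj b := by
  funext p
  ext v
  exact map_add (starRingEnd ℂ) _ _

theorem conj_smul (c : ℂ) (a : Form V) : conj (c • a) = starRingEnd ℂ c • conj a := by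
  funext p
  ext v
  exact map_mul (starRingEnd ℂ) _ _

theorem conj_zero : conj (0 : Form V) = 0 := by
  funext p
  ext v
  exact map_zero (starRingEnd ℂ)

theorem conj_ofDegree {p : ℕ} (a : V [⋀^Fin p]→ₗ[ℝ] ℂ) :
    conj (ofDegree a) = ofDegree (Complex.conjAe.toLinearMap.compAlternatingMap a) := by
  funext r
  by_cases h : r = p
  · subst h
    rw [ofDegree_same]
    change Complex.conjAe.toLinearMap.compAlternatingMap (ofDegree a r) = _
    rw [ofDegree_same]
  · rw [ofDegree_of_ne _ h]
    change Complex.conjAe.toLinearMap.compAlternatingMap (ofDegree a r) = _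
    rw [ofDegree_of_ne _ h]
    ext v
    exact map_zero (starRingEnd ℂ)

theorem conj_one : conj (one : Form V) = one := by
  rw [one, conj_ofDegree]
  congr 1
  ext v
  exact map_one (starRingEnd ℂ)

theorem conj_contract (X : V) (a : Form V) : conj (contract X a) = contract X (conj a) := rfl

theorem conj_extMul (ξ : Module.Dual ℝ V) (a : Form V) :
    conj (extMul ξ a) = extMul ξ (conj a) := by
  funext r
  cases r with
  | zero =>
    ext v
    exact map_zero (starRingEnd ℂ)
  | succ r =>
    ext v
    change starRingEnd ℂ (extMul ξ a (r + 1) v) = extMul ξ (conj a) (r + 1) v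
    rw [extMul_apply_apply, extMul_apply_apply, map_sum]
    refine Finset.sum_congr rfl fun i _ => ?_
    change _ = (-1 : ℤ) ^ (i : ℕ) • ξ (v i) • starRingEnd ℂ (a r (i.removeNth v))
    rw [map_zsmul, Complex.real_smul, Complex.real_smul, map_mul, Complex.conj_ofReal]

theorem mul_apply_eq_zero_of_lt {a b : Form V} {i j : ℕ} (ha : ∀ r < i, a r = 0)
    (hb : ∀ r < j, b r = 0) : ∀ r < i + j, mul a b r = 0 := fun r hr =>
  mul_apply_eq_zero fun s t hst => by
    by_cases hs : s < i
    · exact Or.inl (ha s hs)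
    · exact Or.inr (hb t (by omega))

variable [FiniteDimensional ℝ V]

/-- The algebra of forms is generated by the real one-forms. -/
theorem induction_extMul {P : Form V → Prop} (hadd : ∀ a b, P a → P b → P (a + b))
    (hsmul : ∀ (c : ℂ) a, P a → P (c • a)) (hone : P one)
    (hext : ∀ (ξ : Module.Dual ℝ V) a, P a → P (extMul ξ a)) (a : Form V) : P a := by
  have h0 : P 0 := by simpa using hsmul 0 one hone
  refine induction_ofDegree h0 hadd (fun p => ?_) a
  induction p with
  | zero =>
    intro a
    rw [ofDegree_zero_eq_smul_one]
    exact hsmul _ _ hone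
  | succ p ih =>
    intro a
    -- Euler's identity expresses a form of degree `p + 1` by products of one-forms with forms of
    -- degree `p`.
    have h1 := sum_extMul_contract (Module.finBasis ℝ V) a
    have h2 : ofDegree a = ((p + 1 : ℕ) : ℂ)⁻¹ • ∑ i, extMul ((Module.finBasis ℝ V).coord i)
        (contract (Module.finBasis ℝ V i) (ofDegree a)) := by
      rw [h1, smul_smul, inv_mul_cancel₀ (Nat.cast_ne_zero.mpr (Nat.succ_ne_zero p)), one_smul]
    rw [h2]
    refine hsmul _ _ (Finset.sum_induction _ P hadd h0 fun i _ => hext _ _ ?_)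
    rw [contract_ofDegree]
    exact ih _

theorem extMul_mul (ξ : Module.Dual ℝ V) (a b : Form V) :
    mul (extMul ξ a) b = extMul ξ (mul a b) := by
  change mulL (extMul ξ a) b = extMul ξ (mulL a b)
  induction a using induction_ofDegree with
  | h0 => simp
  | hadd a a' h h' => simp only [map_add, LinearMap.add_apply, h, h']
  | h p a =>
    induction b using induction_ofDegree with
    | h0 => simp
    | hadd b b' h h' => simp only [map_add, h, h']
    | h q b =>
      rw [mulL_apply, mulL_apply, extMul_ofDegree, mul_ofDegree, mul_ofDegree, extMul_ofDegree,
        wedge_alternatizeUncurryFin, ofDegree_domDomCongr]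

theorem one_mul (b : Form V) : mul one b = b := by
  change mulL one b = b
  induction b using induction_ofDegree with
  | h0 => simp
  | hadd b b' h h' => rw [map_add, h, h']
  | h q b =>
    rw [mulL_apply, one, mul_ofDegree, wedge_constOfIsEmpty, ofDegree_domDomCongr, one_smul]

/-- Exterior multiplication by a one-form passes out of the left factor (`extMul_mul`), so induction
on generators of `a` applies. `contract_mul` and `mul_extMul` are proved in the same way. -/
theorem mul_assoc (a b d : Form V) : mul (mul a b) d = mul a (mul b d) := by
  change mulL (mulL a b) d = mulL a (mulL b d)
  induction a using induction_extMul with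
  | hadd a a' h h' => simp only [map_add, LinearMap.add_apply, h, h']
  | hsmul c a h => simp only [map_smul, LinearMap.smul_apply, h]
  | hone => simp only [mulL_apply, one_mul]
  | hext ξ a h => simp only [mulL_apply, extMul_mul] at h ⊢; rw [h]

theorem contract_mul (X : V) (a b : Form V) :
    contract X (mul a b) = mul (contract X a) b + mul (parity a) (contract X b) := by
  change contract X (mulL a b) = mulL (contract X a) b + mulL (parity a) (contract X b)
  induction a using induction_extMul with
  | hadd a a' h h' =>
    simp only [map_add, LinearMap.add_apply, h, h']
    abel
  | hsmul c a h => simp only [map_smul, LinearMap.smul_apply, h, smul_add]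
  | hone => simp only [mulL_apply, one_mul, contract_one, parity_one, map_zero,
      LinearMap.zero_apply, zero_add]
  | hext ξ a h =>
    rw [contract_extMul, parity_extMul, map_sub, map_neg, map_smul]
    simp only [mulL_apply, LinearMap.sub_apply, LinearMap.neg_apply, LinearMap.smul_apply,
      extMul_mul, contract_extMul] at h ⊢
    rw [h, map_add]
    abel

theorem mul_extMul (a : Form V) (ξ : Module.Dual ℝ V) (b : Form V) :
    mul a (extMul ξ b) = extMul ξ (mul (parity a) b) := by
  change mulL a (extMul ξ b) = extMul ξ (mulL (parity a) b)
  induction a using induction_extMul with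
  | hadd a a' h h' => simp only [map_add, LinearMap.add_apply, h, h']
  | hsmul c a h => simp only [map_smul, LinearMap.smul_apply, h]
  | hone => simp only [mulL_apply, one_mul, parity_one]
  | hext η a h =>
    rw [parity_extMul, map_neg]
    simp only [mulL_apply, LinearMap.neg_apply, extMul_mul] at h ⊢
    rw [h, extMul_extMul, map_neg]

theorem parity_mul (a b : Form V) : parity (mul a b) = mul (parity a) (parity b) := by
  change parity (mulL a b) = mulL (parity a) (parity b)
  induction a using induction_extMul with
  | hadd a a' h h' => simp only [map_add, LinearMap.add_apply, h, h']
  | hsmul c a h => simp only [map_smul, LinearMap.smul_apply, h]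
  | hone => simp only [mulL_apply, one_mul, parity_one]
  | hext η a h =>
    rw [parity_extMul, map_neg]
    simp only [mulL_apply, LinearMap.neg_apply, extMul_mul, parity_extMul] at h ⊢
    rw [h]

end Form
end Algebra

/-! ### The Clifford module of forms and its decomposition by `L` and `L̄` -/

section Clifford

variable {V : Type*} [AddCommGroup V] [Module ℝ V]

/-- The symmetric pairing `(X + ξ, Y + η) ↦ ξ Y + η X` on `V ⊕ V*`. -/
def pairing : LinearMap.BilinForm ℝ (Dbl V) :=
  LinearMap.mk₂ ℝ (fun u w => u.2 w.1 + w.2 u.1)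
    (fun u u' w => by
      simp only [Prod.fst_add, Prod.snd_add, map_add, LinearMap.add_apply]
      ring)
    (fun c u w => by
      simp only [Prod.smul_fst, Prod.smul_snd, map_smul, LinearMap.smul_apply, smul_eq_mul]
      ring)
    (fun u w w' => by
      simp only [Prod.fst_add, Prod.snd_add, map_add, LinearMap.add_apply]
      ring)
    (fun c u w => by
      simp only [Prod.smul_fst, Prod.smul_snd, map_smul, LinearMap.smul_apply, smul_eq_mul]
      ring)

theorem pairing_apply (u w : Dbl V) : pairing u w = u.2 w.1 + w.2 u.1 := rfl

/-- The complex bilinear extension of the pairing to `(V ⊕ V*) ⊗ ℂ`. -/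
def pairingC : LinearMap.BilinForm ℂ (DblC V) := pairing.baseChange ℂ

theorem pairingC_tmul (c d : ℂ) (u w : Dbl V) :
    pairingC (c ⊗ₜ[ℝ] u) (d ⊗ₜ[ℝ] w) = (pairing u w : ℂ) * (c * d) := by
  rw [pairingC, LinearMap.BilinForm.baseChange_tmul, Algebra.smul_def]
  rw [mul_comm c d]
  rfl

theorem conjD_conjD (u : DblC V) : conjD (conjD u) = u := by
  induction u using TensorProduct.induction_on with
  | zero => simp
  | add x y hx hy => simp only [map_add, hx, hy]
  | tmul d u => simp [conjD_tmul]

theorem pairingC_conjD (u w : DblC V) :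
    pairingC (conjD u) (conjD w) = starRingEnd ℂ (pairingC u w) := by
  induction u using TensorProduct.induction_on with
  | zero => simp
  | add x y hx hy => simp only [map_add, LinearMap.add_apply, hx, hy]
  | tmul c u =>
    induction w using TensorProduct.induction_on with
    | zero => simp
    | add x y hx hy => simp only [map_add, hx, hy]
    | tmul d w => simp [conjD_tmul, pairingC_tmul]

theorem exists_eq_add_I_tmul (u : DblC V) :
    ∃ a b : Dbl V, u = (1 : ℂ) ⊗ₜ[ℝ] a + Complex.I ⊗ₜ[ℝ] b := by
  induction u using TensorProduct.induction_on with
  | zero => exact ⟨0, 0, by simp⟩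
  | add x y hx hy =>
    obtain ⟨a, b, rfl⟩ := hx
    obtain ⟨a', b', rfl⟩ := hy
    exact ⟨a + a', b + b', by rw [TensorProduct.tmul_add, TensorProduct.tmul_add]; abel⟩
  | tmul c u =>
    refine ⟨c.re • u, c.im • u, ?_⟩
    rw [← TensorProduct.smul_tmul, ← TensorProduct.smul_tmul, ← TensorProduct.add_tmul]
    congr 1
    apply Complex.ext <;> simp

/-- The Clifford relation: contractions anticommute, one-forms anticommute, and the mixed terms give
the pairing. -/
theorem act_act_add [FiniteDimensional ℝ V] (u w : Dbl V) (a : Form V) :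
    act u (act w a) + act w (act u a) = (pairing u w : ℂ) • a := by
  obtain ⟨X, ξ⟩ := u
  obtain ⟨Y, η⟩ := w
  have h : ∀ (X : V) (ξ : Module.Dual ℝ V) (a : Form V),
      act (X, ξ) a = Form.contract X a + Form.extMul ξ a := fun _ _ _ => rfl
  simp only [h, map_add, Form.contract_extMul, pairing_apply]
  rw [Form.contract_contract X Y, Form.extMul_extMul ξ η]
  push_cast
  rw [add_smul]
  abel

theorem conj_act (w : Dbl V) (a : Form V) : (act w a).conj = act w a.conj := by
  change Form.conj (Form.contract w.1 a + Form.extMul w.2 a) = _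
  rw [Form.conj_add, Form.conj_contract, Form.conj_extMul]
  rfl

theorem conj_actC (u : DblC V) (a : Form V) : (actC u a).conj = actC (conjD u) a.conj := by
  induction u using TensorProduct.induction_on with
  | zero => simp [Form.conj_zero]
  | add x y hx hy => simp only [map_add, LinearMap.add_apply, Form.conj_add, hx, hy]
  | tmul c w => rw [conjD_tmul, actC_tmul, actC_tmul, Form.conj_smul, conj_act]

theorem Form.conj_conj (a : Form V) : a.conj.conj = a := by
  funext p
  ext v
  exact Complex.conj_conj (a p v)

/-- Turns `L̄` into the annihilator of the conjugate form, so that `L` and `L̄` can be handled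
symmetrically. -/
theorem conjD_mem_Ann {ρ : Form V} {v : DblC V} : conjD v ∈ Ann ρ ↔ v ∈ Ann ρ.conj := by
  rw [mem_Ann, mem_Ann]
  constructor <;> intro h
  · rw [← conjD_conjD v, ← conj_actC, h, Form.conj_zero]
  · rw [← Form.conj_conj ρ, ← conj_actC, h, Form.conj_zero]

theorem pairingC_comm (u w : DblC V) : pairingC u w = pairingC w u := by
  induction u using TensorProduct.induction_on with
  | zero => simp
  | add x y hx hy => simp only [map_add, LinearMap.add_apply, hx, hy]
  | tmul c u =>
    induction w using TensorProduct.induction_on with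
    | zero => simp
    | add x y hx hy => simp only [map_add, LinearMap.add_apply, hx, hy]
    | tmul d w =>
      rw [pairingC_tmul, pairingC_tmul, pairing_apply, pairing_apply, mul_comm c, add_comm]

theorem prod_actC_mem_U {n : ℕ} {ρ : Form V} (l : List (DblC V)) (hl : ∀ v ∈ l, v ∈ Ann ρ.conj) :
    (l.map fun v => actC v).prod ρ ∈ U n ρ (n - l.length) := by
  refine Submodule.subset_span ⟨l.length, l.get, rfl, fun i => ?_, ?_⟩
  · exact conjD_mem_Ann.mpr (hl _ (l.get_mem i))
  · congr 2
    conv_lhs => rw [← List.ofFn_get l, List.map_ofFn]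
    rfl

theorem U_induction {n : ℕ} {ρ : Form V} {j : ℤ} {P : Form V → Prop} (h0 : P 0)
    (hadd : ∀ a b, P a → P b → P (a + b)) (hsmul : ∀ (c : ℂ) a, P a → P (c • a))
    (h : ∀ l : List (DblC V), (∀ v ∈ l, v ∈ Ann ρ.conj) → (n : ℤ) - l.length = j →
      P ((l.map fun v => actC v).prod ρ)) {a : Form V} (ha : a ∈ U n ρ j) : P a := by
  refine Submodule.span_induction ?_ h0 (fun x y _ _ => hadd x y) (fun c x _ => hsmul c x) ha
  rintro _ ⟨r, v, hr, hv, rfl⟩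
  have h1 := h (List.ofFn v) (fun u hu => by
    obtain ⟨i, rfl⟩ := List.mem_ofFn.mp hu
    exact conjD_mem_Ann.mp (hv i)) (by rwa [List.length_ofFn])
  rwa [List.map_ofFn] at h1

theorem Form.conj_ne_zero {a : Form V} (ha : a ≠ 0) : a.conj ≠ 0 := fun h => ha (by
  rw [← Form.conj_conj a, h, Form.conj_zero])

theorem actC_mem_U_of_mem_Ann_conj {n : ℕ} {ρ : Form V} {v : DblC V} (hv : v ∈ Ann ρ.conj) {j : ℤ}
    {a : Form V} (ha : a ∈ U n ρ j) : actC v a ∈ U n ρ (j - 1) := by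
  refine U_induction (P := fun a => actC v a ∈ U n ρ (j - 1)) ?_ (fun a b h h' => ?_)
    (fun c a h => ?_) (fun l hl hj => ?_) ha
  · rw [map_zero]
    exact zero_mem _
  · rw [map_add]
    exact add_mem h h'
  · rw [map_smul]
    exact Submodule.smul_mem _ c h
  · have := prod_actC_mem_U (n := n) (v :: l) (List.forall_mem_cons.mpr ⟨hv, hl⟩)
    rw [List.length_cons, Nat.cast_succ, ← sub_sub, hj, List.map_cons, List.prod_cons] at this
    exact this

variable [FiniteDimensional ℝ V]

theorem actC_actC_add (u w : DblC V) (a : Form V) :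
    actC u (actC w a) + actC w (actC u a) = pairingC u w • a := by
  induction u using TensorProduct.induction_on with
  | zero => simp
  | add x y hx hy =>
    simp only [map_add, LinearMap.add_apply, add_smul, ← hx, ← hy]
    abel
  | tmul c u =>
    induction w using TensorProduct.induction_on with
    | zero => simp
    | add x y hx hy =>
      simp only [map_add, LinearMap.add_apply, add_smul, ← hx, ← hy]
      abel
    | tmul d w =>
      simp only [actC_tmul, map_smul, pairingC_tmul]
      rw [smul_comm d c, smul_smul, smul_smul, ← smul_add, act_act_add, smul_smul, mul_comm]

theorem actC_actC_comm (u w : DblC V) (a : Form V) :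
    actC u (actC w a) = pairingC u w • a - actC w (actC u a) :=
  eq_sub_of_add_eq (actC_actC_add u w a)

theorem pairing_eq_zero {u : Dbl V} (h : ∀ w, pairing u w = 0) : u = 0 := by
  refine Prod.ext ?_ (LinearMap.ext fun Y => ?_)
  · refine (Module.forall_dual_apply_eq_zero_iff ℝ u.1).mp fun η => ?_
    simpa [pairing_apply] using h (0, η)
  · simpa [pairing_apply] using h (Y, 0)

theorem eq_zero_of_pairingC_eq_zero {u : DblC V} (h : ∀ w, pairingC u w = 0) : u = 0 := by
  obtain ⟨a, b, rfl⟩ := exists_eq_add_I_tmul u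
  have h1 : ∀ w, pairing a w = 0 ∧ pairing b w = 0 := fun w => by
    have := h ((1 : ℂ) ⊗ₜ[ℝ] w)
    rw [map_add, LinearMap.add_apply, pairingC_tmul, pairingC_tmul] at this
    exact ⟨by simpa using congrArg Complex.re this, by simpa using congrArg Complex.im this⟩
  rw [pairing_eq_zero fun w => (h1 w).1, pairing_eq_zero fun w => (h1 w).2]
  simp

/-- The annihilator of a nonzero form is isotropic. -/
theorem pairingC_eq_zero_of_mem_Ann {ρ : Form V} (hρ : ρ ≠ 0) {u w : DblC V} (hu : u ∈ Ann ρ)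
    (hw : w ∈ Ann ρ) : pairingC u w = 0 := by
  have h := actC_actC_add u w ρ
  rw [mem_Ann.mp hu, mem_Ann.mp hw, map_zero, map_zero, add_zero] at h
  exact (smul_eq_zero.mp h.symm).resolve_right hρ

/-- `∧ V*_ℂ` is an irreducible Clifford module. -/
theorem eq_top_of_actC_mem {S : Submodule ℂ (Form V)} (hS : S ≠ ⊥)
    (h : ∀ u, ∀ a ∈ S, actC u a ∈ S) : S = ⊤ := by
  have hc : ∀ X, ∀ a ∈ S, Form.contract X a ∈ S := fun X a ha => by
    have := h ((1 : ℂ) ⊗ₜ[ℝ] (X, 0)) a ha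
    rw [actC_tmul, one_smul] at this
    simpa [act] using this
  have he : ∀ ξ, ∀ a ∈ S, Form.extMul ξ a ∈ S := fun ξ a ha => by
    have := h ((1 : ℂ) ⊗ₜ[ℝ] (0, ξ)) a ha
    rw [actC_tmul, one_smul] at this
    simpa [act] using this
  -- Contracting with a vector on which the top-degree part is nonzero lowers the degree without
  -- killing the form; the process ends at a nonzero constant. Exterior multiplication then
  -- generates everything from `1`.
  have key : ∀ (q : ℕ) (b : Form V), b ∈ S → b ≠ 0 → (∀ p, q < p → b p = 0) → Form.one ∈ S := by
    intro q
    induction q with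
    | zero =>
      intro b hb hb0 hp
      have h1 : b = b 0 ![] • Form.one := by
        rw [← Form.ofDegree_zero_eq_smul_one]
        funext p
        by_cases hp0 : p = 0
        · subst hp0
          rw [Form.ofDegree_same]
        · rw [Form.ofDegree_of_ne _ hp0, hp p (Nat.pos_of_ne_zero hp0)]
      have h2 : b 0 ![] ≠ 0 := fun h0 => hb0 (by rw [h1, h0, zero_smul])
      rw [h1] at hb
      exact (S.smul_mem_iff h2).mp hb
    | succ q ih =>
      intro b hb hb0 hp
      by_cases hq : b (q + 1) = 0
      · refine ih b hb hb0 fun p hpq => ?_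
        rcases Nat.lt_or_ge (q + 1) p with h' | h'
        · exact hp p h'
        · rwa [show p = q + 1 by omega]
      · obtain ⟨v, hv⟩ : ∃ v, b (q + 1) v ≠ 0 := by
          by_contra! hv
          exact hq (AlternatingMap.ext hv)
        refine ih (Form.contract (v 0) b) (hc _ b hb) (fun h0 => hv ?_) fun p hpq => ?_
        · have := congrArg (fun a : Form V => a q (Fin.tail v)) h0
          change b (q + 1) (Fin.cons (v 0) (Fin.tail v)) = 0 at this
          rwa [Fin.cons_self_tail] at this
        · change (b (p + 1)).curryLeft (v 0) = 0
          rw [hp (p + 1) (by omega)]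
          rfl
  obtain ⟨b, hb, hb0⟩ := S.ne_bot_iff.mp hS
  have hone := key (Module.finrank ℝ V) b hb hb0 fun p hp => alternating_eq_zero_of_finrank_lt hp _
  exact Submodule.eq_top_iff'.mpr fun a => Form.induction_extMul (P := fun a => a ∈ S)
    (fun _ _ => S.add_mem) (fun c _ => S.smul_mem c) hone he a

/-- Move `u` past the factors from `L̄`: each exchange costs a scalar times a product with one
factor less, and finally `u` reaches `ρ` and kills it. -/
theorem actC_mem_U_of_mem_Ann {n : ℕ} {ρ : Form V} {u : DblC V} (hu : u ∈ Ann ρ) {j : ℤ}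
    {a : Form V} (ha : a ∈ U n ρ j) : actC u a ∈ U n ρ (j + 1) := by
  refine U_induction (P := fun a => actC u a ∈ U n ρ (j + 1)) ?_ (fun a b h h' => ?_)
    (fun c a h => ?_) (fun l hl hj => ?_) ha
  · rw [map_zero]
    exact zero_mem _
  · rw [map_add]
    exact add_mem h h'
  · rw [map_smul]
    exact Submodule.smul_mem _ c h
  · clear ha
    induction l generalizing j with
    | nil =>
      rw [List.map_nil, List.prod_nil, Module.End.one_apply, mem_Ann.mp hu]
      exact zero_mem _
    | cons v l ih =>
      obtain ⟨hv, hl⟩ := List.forall_mem_cons.mp hl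
      rw [List.length_cons, Nat.cast_succ] at hj
      have hj' : (n : ℤ) - l.length = j + 1 := by omega
      rw [List.map_cons, List.prod_cons, Module.End.mul_apply, actC_actC_comm]
      refine sub_mem (Submodule.smul_mem _ _ ?_) ?_
      · rw [← hj']
        exact prod_actC_mem_U l hl
      · have := actC_mem_U_of_mem_Ann_conj hv (ih hl hj')
        rwa [add_sub_cancel_right] at this

/-- The sum contains `ρ` and is stable under both `L` and `L̄`, hence under the whole Clifford
action, which is irreducible. -/
theorem iSup_U_eq_top {n : ℕ} {ρ : Form V} (hρ : ρ ≠ 0) (h : Ann ρ ⊔ Ann ρ.conj = ⊤) :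
    ⨆ j, U n ρ j = ⊤ := by
  refine eq_top_of_actC_mem ?_ fun u a ha => ?_
  · refine (Submodule.ne_bot_iff _).mpr ⟨ρ, ?_, hρ⟩
    exact Submodule.mem_iSup_of_mem _ (prod_actC_mem_U (n := n) [] (by simp))
  · obtain ⟨v, hv, w, hw, rfl⟩ := Submodule.mem_sup.mp (h ▸ Submodule.mem_top : u ∈ _)
    refine Submodule.iSup_induction _ (motive := fun a => actC (v + w) a ∈ ⨆ j, U n ρ j) ha
      (fun j a ha => ?_) (by rw [map_zero]; exact zero_mem _) (fun a b h h' => by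
        rw [map_add]
        exact add_mem h h')
    rw [map_add, LinearMap.add_apply]
    exact add_mem (Submodule.mem_iSup_of_mem _ (actC_mem_U_of_mem_Ann hv ha))
      (Submodule.mem_iSup_of_mem _ (actC_mem_U_of_mem_Ann_conj hw ha))

/-- `L` and `L̄` are isotropic and together span a space with a nondegenerate pairing, so they are
in perfect duality. -/
theorem exists_dual_basis_Ann {ρ : Form V} (hρ : ρ ≠ 0) (h : Ann ρ ⊔ Ann ρ.conj = ⊤) :
    ∃ (m : ℕ) (w v : Fin m → DblC V), (∀ i, w i ∈ Ann ρ.conj) ∧ (∀ i, v i ∈ Ann ρ) ∧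
      ∀ u ∈ Ann ρ.conj, ∑ i, pairingC (v i) u • w i = u := by
  have hinj : ∀ {σ τ : Form V}, σ ≠ 0 → Ann σ ⊔ Ann τ = ⊤ → ∀ u ∈ Ann σ,
      (∀ w ∈ Ann τ, pairingC u w = 0) → u = 0 := fun hσ hστ u hu hw => by
    refine eq_zero_of_pairingC_eq_zero fun x => ?_
    obtain ⟨y, hy, z, hz, rfl⟩ := Submodule.mem_sup.mp (hστ ▸ Submodule.mem_top : x ∈ _)
    rw [map_add, pairingC_eq_zero_of_mem_Ann hσ hu hy, hw z hz, add_zero]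
  let p : Ann ρ →ₗ[ℂ] Ann ρ.conj →ₗ[ℂ] ℂ := pairingC.domRestrict₁₂ (Ann ρ) (Ann ρ.conj)
  have h1 : Function.Injective p := (injective_iff_map_eq_zero p).mpr fun u hu =>
    Subtype.ext (hinj hρ h u u.2 fun w hw => LinearMap.congr_fun hu ⟨w, hw⟩)
  have h2 : Function.Injective p.flip := (injective_iff_map_eq_zero p.flip).mpr fun u hu =>
    Subtype.ext (hinj (Form.conj_ne_zero hρ) (by rwa [sup_comm]) u u.2 fun w hw =>
      (pairingC_comm _ _).trans (LinearMap.congr_fun hu ⟨w, hw⟩))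
  have hp : p.IsPerfPair := .of_injective h1 h2
  let b := Module.finBasis ℂ (Ann ρ.conj)
  choose v hv using fun i => hp.bijective_left.surjective (b.coord i)
  refine ⟨_, fun i => b i, fun i => v i, fun i => (b i).2, fun i => (v i).2, fun u hu => ?_⟩
  have h3 : ∀ i, pairingC (v i : DblC V) u = b.repr ⟨u, hu⟩ i := fun i =>
    LinearMap.congr_fun (hv i) ⟨u, hu⟩
  simp only [h3]
  have := congrArg (Ann ρ.conj).subtype (b.sum_repr ⟨u, hu⟩)
  rw [map_sum] at this
  exact this

/-- The number operator `N = ∑ wᵢ vᵢ` built from dual bases of `L̄` and `L` kills `ρ` and satisfies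
`[N, u] = u` for `u ∈ L̄`. It thus counts factors: it acts on `Uʲ` by `n - j`. -/
theorem iSupIndep_U {n : ℕ} {ρ : Form V} (hρ : ρ ≠ 0) (h : Ann ρ ⊔ Ann ρ.conj = ⊤) :
    iSupIndep (U n ρ) := by
  obtain ⟨m, w, v, hw, hv, hu⟩ := exists_dual_basis_Ann hρ h
  let N : Module.End ℂ (Form V) := ∑ i, actC (w i) * actC (v i)
  have hN : ∀ a, N a = ∑ i, actC (w i) (actC (v i) a) := fun a => by
    simp [N, LinearMap.sum_apply]
  have hcomm : ∀ u ∈ Ann ρ.conj, ∀ a, N (actC u a) = actC u (N a) + actC u a := fun u hu' a => by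
    have h1 : ∀ i, actC (w i) (actC (v i) (actC u a)) =
        actC u (actC (w i) (actC (v i) a)) + actC (pairingC (v i) u • w i) a := fun i => by
      rw [actC_actC_comm (v i) u, map_sub, map_smul, actC_actC_comm (w i) u,
        pairingC_eq_zero_of_mem_Ann (Form.conj_ne_zero hρ) (hw i) hu', zero_smul, zero_sub,
        sub_neg_eq_add, add_comm, map_smul]
      rfl
    rw [hN, hN, map_sum, Finset.sum_congr rfl fun i _ => h1 i, Finset.sum_add_distrib]
    congr 1
    rw [← LinearMap.sum_apply, ← map_sum, hu u hu']
  have hU : ∀ j, U n ρ j ≤ N.eigenspace ((n : ℂ) - j) := fun j a ha => by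
    refine U_induction (P := fun a => a ∈ N.eigenspace ((n : ℂ) - j)) (zero_mem _)
      (fun _ _ => add_mem) (fun c _ => Submodule.smul_mem _ c) (fun l hl hj => ?_) ha
    rw [Module.End.mem_eigenspace_iff]
    have h1 : (n : ℂ) - j = l.length := by
      rw [← hj]
      push_cast
      ring
    rw [h1]
    clear h1 hj
    induction l with
    | nil =>
      rw [List.map_nil, List.prod_nil, Module.End.one_apply, hN]
      simp [mem_Ann.mp (hv _)]
    | cons u l ih =>
      obtain ⟨hu', hl⟩ := List.forall_mem_cons.mp hl
      rw [List.map_cons, List.prod_cons, Module.End.mul_apply, hcomm u hu', ih hl, map_smul,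
        List.length_cons, Nat.cast_succ, add_smul, one_smul]
  refine (N.eigenspaces_iSupIndep.comp (f := fun j : ℤ => (n : ℂ) - j) fun i j hij => ?_).mono hU
  simpa using hij

theorem isInternal_U_of_sup_eq_top {n : ℕ} {ρ : Form V} (hρ : ρ ≠ 0)
    (h : Ann ρ ⊔ Ann ρ.conj = ⊤) : DirectSum.IsInternal (U n ρ) :=
  DirectSum.isInternal_submodule_of_iSupIndep_of_iSup_eq_top (iSupIndep_U hρ h) (iSup_U_eq_top hρ h)

/-- It suffices to test `L + L̄ = (V ⊕ V*) ⊗ ℂ` on the real vectors orthogonal to `L`. -/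
theorem Ann_sup_Ann_conj_eq_top {ρ : Form V}
    (h : ∀ w : Dbl V, (∀ v ∈ Ann ρ, pairingC ((1 : ℂ) ⊗ₜ[ℝ] w) v = 0) → w = 0) :
    Ann ρ ⊔ Ann ρ.conj = ⊤ := by
  have hb : Function.Bijective (pairingC : DblC V →ₗ[ℂ] Module.Dual ℂ (DblC V)) := by
    have hi : Function.Injective (pairingC : DblC V →ₗ[ℂ] Module.Dual ℂ (DblC V)) :=
      (injective_iff_map_eq_zero _).mpr fun u hu =>
        eq_zero_of_pairingC_eq_zero (LinearMap.congr_fun hu)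
    exact ⟨hi, (LinearMap.injective_iff_surjective_of_finrank_eq_finrank
      Subspace.dual_finrank_eq.symm).mp hi⟩
  by_contra hne
  -- A nonzero functional vanishing on `L + L̄` is the pairing with some `u = a + i b`. Because `L +
  -- L̄` is stable under conjugation, `a` and `b` are each orthogonal to `L`.
  obtain ⟨f, hf, hfS⟩ := Submodule.exists_le_ker_of_lt_top _ (lt_top_iff_ne_top.mpr hne)
  obtain ⟨u, rfl⟩ := hb.2 f
  refine hf ?_
  obtain ⟨a, b, rfl⟩ := exists_eq_add_I_tmul u
  have h1 : ∀ v ∈ Ann ρ, pairingC ((1 : ℂ) ⊗ₜ[ℝ] a) v = 0 ∧ pairingC ((1 : ℂ) ⊗ₜ[ℝ] b) v = 0 := by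
    intro v hv
    have e1 : pairingC ((1 : ℂ) ⊗ₜ[ℝ] a + Complex.I ⊗ₜ[ℝ] b) v = 0 :=
      hfS (Submodule.mem_sup_left hv)
    have e2 : pairingC ((1 : ℂ) ⊗ₜ[ℝ] a + Complex.I ⊗ₜ[ℝ] b) (conjD v) = 0 :=
      hfS (Submodule.mem_sup_right (conjD_mem_Ann.mp (by rwa [conjD_conjD])))
    have e3 := congrArg (starRingEnd ℂ) e2
    rw [← pairingC_conjD, conjD_conjD, map_add, conjD_tmul, conjD_tmul, map_one, Complex.conj_I,
      map_zero] at e3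
    have hI : ∀ c : ℂ, c ⊗ₜ[ℝ] b = c • ((1 : ℂ) ⊗ₜ[ℝ] b) := fun c => by
      rw [TensorProduct.smul_tmul', smul_eq_mul, mul_one]
    rw [hI] at e1 e3
    rw [map_add, LinearMap.add_apply, map_smul, LinearMap.smul_apply, smul_eq_mul] at e1 e3
    constructor
    · linear_combination (e1 + e3) / 2
    · have : Complex.I * pairingC ((1 : ℂ) ⊗ₜ[ℝ] b) v = 0 := by linear_combination (e1 - e3) / 2
      exact (mul_eq_zero.mp this).resolve_left Complex.I_ne_zero
  rw [h a fun v hv => (h1 v hv).1, h b fun v hv => (h1 v hv).2]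
  simp

end Clifford

/-! ### Complex one-forms and vectors acting on forms -/

section OneForms

variable {V : Type*} [AddCommGroup V] [Module ℝ V]

/-- A complex-valued one-form as an element of `(V ⊕ V*) ⊗ ℂ`. -/
def formVec : (V →ₗ[ℝ] ℂ) →ₗ[ℂ] DblC V where
  toFun ψ := (1 : ℂ) ⊗ₜ[ℝ] (0, Complex.reLm ∘ₗ ψ) + Complex.I ⊗ₜ[ℝ] (0, Complex.imLm ∘ₗ ψ)
  map_add' ψ φ := by
    have h : ∀ ξ η : Module.Dual ℝ V, ((0, ξ + η) : Dbl V) = (0, ξ) + (0, η) := fun ξ η => by simp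
    rw [LinearMap.comp_add, LinearMap.comp_add, h, h, TensorProduct.tmul_add,
      TensorProduct.tmul_add]
    abel
  map_smul' c ψ := by
    have h1 : ((0, Complex.reLm ∘ₗ (c • ψ)) : Dbl V) =
        c.re • (0, Complex.reLm ∘ₗ ψ) - c.im • (0, Complex.imLm ∘ₗ ψ) := by
      refine Prod.ext (by simp) (LinearMap.ext fun X => ?_)
      simp
    have h2 : ((0, Complex.imLm ∘ₗ (c • ψ)) : Dbl V) =
        c.re • (0, Complex.imLm ∘ₗ ψ) + c.im • (0, Complex.reLm ∘ₗ ψ) := by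
      refine Prod.ext (by simp) (LinearMap.ext fun X => ?_)
      simp
    have hr : ∀ (z : ℂ) (r : ℝ) (w : Dbl V), z ⊗ₜ[ℝ] (r • w) = (z * r) • ((1 : ℂ) ⊗ₜ[ℝ] w) :=
      fun z r w => by
        rw [← TensorProduct.smul_tmul, TensorProduct.smul_tmul', smul_eq_mul, mul_one,
          Complex.real_smul, mul_comm]
    have hI : ∀ w : Dbl V, Complex.I ⊗ₜ[ℝ] w = Complex.I • ((1 : ℂ) ⊗ₜ[ℝ] w) := fun w => by
      rw [TensorProduct.smul_tmul', smul_eq_mul, mul_one]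
    rw [h1, h2, RingHom.id_apply, TensorProduct.tmul_sub, TensorProduct.tmul_add, hr, hr, hr, hr,
      hI]
    conv_rhs => rw [← Complex.re_add_im c, smul_add, smul_smul, add_mul, mul_assoc (c.im : ℂ),
      Complex.I_mul_I]
    module

theorem formVec_apply (ψ : V →ₗ[ℝ] ℂ) : formVec ψ =
    (1 : ℂ) ⊗ₜ[ℝ] (0, Complex.reLm ∘ₗ ψ) + Complex.I ⊗ₜ[ℝ] (0, Complex.imLm ∘ₗ ψ) := rfl

/-- Exterior multiplication by a complex-valued one-form. -/
def extC : (V →ₗ[ℝ] ℂ) →ₗ[ℂ] Module.End ℂ (Form V) := actC ∘ₗ formVec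

theorem extC_apply (ψ : V →ₗ[ℝ] ℂ) (a : Form V) : extC ψ a =
    Form.extMul (Complex.reLm ∘ₗ ψ) a + Complex.I • Form.extMul (Complex.imLm ∘ₗ ψ) a := by
  change actC (formVec ψ) a = _
  rw [formVec_apply, map_add, LinearMap.add_apply, actC_tmul, actC_tmul, one_smul]
  simp [act]

theorem actC_formVec (ψ : V →ₗ[ℝ] ℂ) : actC (formVec ψ) = extC ψ := rfl

theorem conjD_formVec (ψ : V →ₗ[ℝ] ℂ) :
    conjD (formVec ψ) = formVec (Complex.conjAe.toLinearMap ∘ₗ ψ) := by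
  have h : Complex.imLm ∘ₗ (Complex.conjAe.toLinearMap ∘ₗ ψ) = -(Complex.imLm ∘ₗ ψ) := by
    ext X
    simp
  have h' : Complex.reLm ∘ₗ (Complex.conjAe.toLinearMap ∘ₗ ψ) = Complex.reLm ∘ₗ ψ := by
    ext X
    simp
  have h2 : ((0, -(Complex.imLm ∘ₗ ψ)) : Dbl V) = -(0, Complex.imLm ∘ₗ ψ) := by simp
  rw [formVec_apply, formVec_apply, map_add, conjD_tmul, conjD_tmul, map_one, Complex.conj_I, h, h',
    h2, TensorProduct.neg_tmul, TensorProduct.tmul_neg]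

theorem conj_extC (ψ : V →ₗ[ℝ] ℂ) (a : Form V) :
    (extC ψ a).conj = extC (Complex.conjAe.toLinearMap ∘ₗ ψ) a.conj := by
  rw [← actC_formVec, conj_actC, conjD_formVec, actC_formVec]

theorem pairingC_formVec_formVec (ψ φ : V →ₗ[ℝ] ℂ) : pairingC (formVec ψ) (formVec φ) = 0 := by
  simp [formVec_apply, pairingC_tmul, pairing_apply]

theorem pairingC_tmul_formVec (z : ℂ) (w : Dbl V) (ψ : V →ₗ[ℝ] ℂ) :
    pairingC (z ⊗ₜ[ℝ] w) (formVec ψ) = z * ψ w.1 := by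
  rw [formVec_apply, map_add, pairingC_tmul, pairingC_tmul, pairing_apply, pairing_apply]
  apply Complex.ext <;> simp <;> ring

/-- A complex tangent vector as an element of `(V ⊕ V*) ⊗ ℂ`. -/
def vecC : ℂ ⊗[ℝ] V →ₗ[ℂ] DblC V := (LinearMap.inl ℝ V (Module.Dual ℝ V)).baseChange ℂ

theorem actC_vecC_tmul (z : ℂ) (X : V) (a : Form V) :
    actC (vecC (z ⊗ₜ[ℝ] X)) a = z • Form.contract X a := by
  rw [vecC, LinearMap.baseChange_tmul, actC_tmul]
  simp [act]

theorem pairingC_vecC_formVec (X : ℂ ⊗[ℝ] V) (ψ : V →ₗ[ℝ] ℂ) :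
    pairingC (vecC X) (formVec ψ) = ψ.liftBaseChange ℂ X := by
  induction X using TensorProduct.induction_on with
  | zero => simp
  | add x y hx hy => simp only [map_add, LinearMap.add_apply, hx, hy]
  | tmul z X =>
    rw [vecC, LinearMap.baseChange_tmul, pairingC_tmul_formVec]
    simp

/-- The one-form `ι_X c`, for a two-form `c`. -/
def contrTwo (c : V [⋀^Fin 2]→ₗ[ℝ] ℂ) : V →ₗ[ℝ] V →ₗ[ℝ] ℂ :=
  LinearMap.mk₂ ℝ (fun X Y => c ![X, Y])
    (fun X X' Y => c.toMultilinearMap.cons_add ![Y] X X')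
    (fun r X Y => c.toMultilinearMap.cons_smul ![Y] r X)
    (fun X Y Y' => (c.curryLeft X).toMultilinearMap.cons_add ![] Y Y')
    (fun r X Y => (c.curryLeft X).toMultilinearMap.cons_smul ![] r Y)

theorem contrTwo_apply (c : V [⋀^Fin 2]→ₗ[ℝ] ℂ) (X Y : V) : contrTwo c X Y = c ![X, Y] := rfl

theorem contrTwo_swap (c : V [⋀^Fin 2]→ₗ[ℝ] ℂ) (X Y : V) : contrTwo c X Y = -contrTwo c Y X := by
  rw [contrTwo_apply, contrTwo_apply, ← c.map_swap _ (Fin.zero_ne_one)]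
  congr 1
  ext i
  fin_cases i <;> simp

theorem contract_ofDegree_two (c : V [⋀^Fin 2]→ₗ[ℝ] ℂ) (X : V) :
    Form.contract X (Form.ofDegree c) =
      Form.ofDegree (AlternatingMap.ofSubsingleton ℝ V ℂ (0 : Fin 1) (contrTwo c X)) := by
  rw [Form.contract_ofDegree]
  congr 1
  ext v
  refine congrArg c (funext fun i => ?_)
  fin_cases i <;> rfl

/-- An element orthogonal to all the `ψ` anticommutes with each of them, so it moves through the
product and acts on `a`. -/
theorem actC_list_prod_eq_zero [FiniteDimensional ℝ V] {u : DblC V} {l : List (V →ₗ[ℝ] ℂ)}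
    {a : Form V} (hl : ∀ ψ ∈ l, pairingC u (formVec ψ) = 0) (ha : actC u a = 0) :
    actC u ((l.map fun ψ => extC ψ).prod a) = 0 := by
  induction l with
  | nil => exact ha
  | cons ψ l ih =>
    obtain ⟨hψ, hl⟩ := List.forall_mem_cons.mp hl
    rw [List.map_cons, List.prod_cons, Module.End.mul_apply, ← actC_formVec, actC_actC_comm, hψ,
      zero_smul, ih hl, map_zero, sub_zero]

theorem extC_extC_self [FiniteDimensional ℝ V] (ψ : V →ₗ[ℝ] ℂ) (a : Form V) :
    extC ψ (extC ψ a) = 0 := by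
  have h := actC_actC_add (formVec ψ) (formVec ψ) a
  rw [pairingC_formVec_formVec, zero_smul, ← two_smul ℂ] at h
  exact (smul_eq_zero.mp h).resolve_left two_ne_zero

theorem extC_list_prod_of_mem_span [FiniteDimensional ℝ V] {l : List (V →ₗ[ℝ] ℂ)}
    {φ : V →ₗ[ℝ] ℂ} (hφ : φ ∈ Submodule.span ℂ {ψ | ψ ∈ l}) (a : Form V) :
    extC φ ((l.map fun ψ => extC ψ).prod a) = 0 := by
  refine Submodule.span_induction (p := fun φ _ => extC φ ((l.map fun ψ => extC ψ).prod a) = 0)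
    (fun φ hφ => ?_) (by simp) (fun x y _ _ hx hy => by
      rw [map_add, LinearMap.add_apply, hx, hy, add_zero])
    (fun c x _ hx => by rw [map_smul, LinearMap.smul_apply, hx, smul_zero]) hφ
  obtain ⟨s, t, rfl⟩ := List.append_of_mem hφ
  rw [List.map_append, List.map_cons, List.prod_append, List.prod_cons, Module.End.mul_apply,
    Module.End.mul_apply]
  exact actC_list_prod_eq_zero (fun ψ _ => pairingC_formVec_formVec φ ψ) (extC_extC_self φ _)

theorem extC_list_prod_eq_zero [FiniteDimensional ℝ V] {l : List (V →ₗ[ℝ] ℂ)} {φ : V →ₗ[ℝ] ℂ}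
    {a : Form V} (ha : extC φ a = 0) : extC φ ((l.map fun ψ => extC ψ).prod a) = 0 :=
  actC_list_prod_eq_zero (fun ψ _ => pairingC_formVec_formVec φ ψ) ha

/-- If `φ ∧ a = 0` and `ψ₁ ∧ ⋯ ∧ ψₖ ∧ a ≠ 0`, then `φ ∈ span (ψ₁, …, ψₖ)` only for `φ = 0`. -/
theorem eq_zero_of_mem_span_of_extC_eq_zero [FiniteDimensional ℝ V] {l : List (V →ₗ[ℝ] ℂ)}
    {φ : V →ₗ[ℝ] ℂ} {a : Form V} (hφ : φ ∈ Submodule.span ℂ {ψ | ψ ∈ l}) (ha : extC φ a = 0)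
    (hl : (l.map fun ψ => extC ψ).prod a ≠ 0) : φ = 0 := by
  induction l generalizing φ with
  | nil => simpa using hφ
  | cons t l ih =>
    have hs : {ψ | ψ ∈ t :: l} = insert t {ψ | ψ ∈ l} := by
      ext
      simp
    rw [List.map_cons, List.prod_cons, Module.End.mul_apply] at hl
    obtain ⟨c, φ', hφ', rfl⟩ := Submodule.mem_span_insert.mp (hs ▸ hφ)
    -- Wedge `φ = c t + φ'` with the product over the tail: the left side is zero by `ha` and `φ'`
    -- contributes nothing, so `c = 0` since the full product is nonzero.
    have h1 := extC_list_prod_eq_zero (l := l) ha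
    rw [map_add, map_smul, LinearMap.add_apply, LinearMap.smul_apply,
      extC_list_prod_of_mem_span hφ', add_zero] at h1
    have hc : c = 0 := (smul_eq_zero.mp h1).resolve_right hl
    rw [hc, zero_smul, zero_add] at ha hφ ⊢
    exact ih hφ' ha fun h0 => hl (by rw [h0, map_zero])

theorem conj_list_prod (l : List (V →ₗ[ℝ] ℂ)) (a : Form V) :
    Form.conj ((l.map fun ψ => extC ψ).prod a) =
      ((l.map fun ψ => Complex.conjAe.toLinearMap ∘ₗ ψ).map fun ψ => extC ψ).prod a.conj := by
  induction l with
  | nil => rfl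
  | cons ψ l ih =>
    simp only [List.map_cons, List.prod_cons, Module.End.mul_apply]
    rw [conj_extC, ih]

theorem extC_apply_eq_zero (ψ : V →ₗ[ℝ] ℂ) {a : Form V} {i : ℕ} (ha : ∀ r < i, a r = 0) :
    ∀ r < i + 1, extC ψ a r = 0 := fun r hr => by
  rw [extC_apply]
  cases r with
  | zero => simp [Form.extMul_apply_zero]
  | succ r =>
    have h : ∀ ξ : Module.Dual ℝ V, Form.extMul ξ a (r + 1) = 0 := fun ξ => by
      ext v
      rw [Form.extMul_apply_apply, ha r (by omega)]
      simp
    rw [Pi.add_apply, Pi.smul_apply, h, h, smul_zero, add_zero]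

theorem list_prod_apply_eq_zero (l : List (V →ₗ[ℝ] ℂ)) {a : Form V} {i : ℕ}
    (ha : ∀ r < i, a r = 0) : ∀ r < i + l.length, (l.map fun ψ => extC ψ).prod a r = 0 := by
  induction l with
  | nil => exact ha
  | cons ψ l ih => exact extC_apply_eq_zero ψ ih

theorem extC_one (ψ : V →ₗ[ℝ] ℂ) : extC ψ Form.one =
    Form.ofDegree (AlternatingMap.ofSubsingleton ℝ V ℂ (0 : Fin 1) ψ) := by
  rw [extC_apply, Form.one, Form.extMul_ofDegree, Form.extMul_ofDegree, Form.ofDegree,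
    Form.ofDegree, Form.ofDegree, ← Pi.single_smul, ← Pi.single_add]
  congr 1
  ext v
  have h : ∀ ξ : Module.Dual ℝ V, AlternatingMap.alternatizeUncurryFin
      (ξ.smulRight (AlternatingMap.constOfIsEmpty ℝ V (Fin 0) (1 : ℂ))) v = ξ (v 0) := fun ξ => by
    rw [AlternatingMap.alternatizeUncurryFin_apply]
    simp
  rw [AlternatingMap.add_apply, AlternatingMap.smul_apply, h, h]
  simp [mul_comm Complex.I]

variable [FiniteDimensional ℝ V]

theorem extC_mul (ψ : V →ₗ[ℝ] ℂ) (a b : Form V) :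
    (extC ψ a).mul b = extC ψ (a.mul b) := by
  rw [extC_apply, extC_apply, ← Form.mulL_apply, map_add, map_smul, LinearMap.add_apply,
    LinearMap.smul_apply, Form.mulL_apply, Form.mulL_apply, Form.extMul_mul, Form.extMul_mul]

theorem mul_extC (a : Form V) (ψ : V →ₗ[ℝ] ℂ) (b : Form V) :
    a.mul (extC ψ b) = extC ψ ((Form.parity a).mul b) := by
  rw [extC_apply, extC_apply, ← Form.mulL_apply, map_add, map_smul, Form.mulL_apply,
    Form.mulL_apply, Form.mul_extMul, Form.mul_extMul]

theorem mul_ofSubsingleton (ψ : V →ₗ[ℝ] ℂ) (a : Form V) :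
    (Form.ofDegree (AlternatingMap.ofSubsingleton ℝ V ℂ (0 : Fin 1) ψ)).mul a = extC ψ a := by
  rw [← extC_one, extC_mul, Form.one_mul]

theorem list_prod_mul (l : List (V →ₗ[ℝ] ℂ)) (a b : Form V) :
    Form.mul ((l.map fun ψ => extC ψ).prod a) b = (l.map fun ψ => extC ψ).prod (a.mul b) := by
  induction l with
  | nil => rfl
  | cons ψ l ih =>
    simp only [List.map_cons, List.prod_cons, Module.End.mul_apply]
    rw [extC_mul, ih]

theorem prodOneForms_eq {k : ℕ} (θ : Fin k → (V →ₗ[ℝ] ℂ)) :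
    Form.prodOneForms θ = ((List.ofFn θ).map fun ψ => extC ψ).prod Form.one := by
  rw [Form.prodOneForms]
  induction List.ofFn θ with
  | nil => rfl
  | cons ψ l ih =>
    simp only [List.map_cons, List.prod_cons, Module.End.mul_apply, List.foldr_cons]
    rw [ih, mul_ofSubsingleton]

theorem actC_vecC_mul (X : ℂ ⊗[ℝ] V) (a b : Form V) :
    actC (vecC X) (a.mul b) =
      (actC (vecC X) a).mul b + (Form.parity a).mul (actC (vecC X) b) := by
  rw [← Form.mulL_apply, ← Form.mulL_apply, ← Form.mulL_apply]
  induction X using TensorProduct.induction_on with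
  | zero => simp
  | add x y hx hy =>
    simp only [map_add, LinearMap.add_apply, hx, hy]
    abel
  | tmul z X =>
    simp only [actC_vecC_tmul, map_smul, LinearMap.smul_apply, Form.mulL_apply, Form.contract_mul,
      smul_add]

end OneForms

/-! ### Nondegenerate pure forms satisfy `L + L̄ = (V ⊕ V*) ⊗ ℂ` -/

section Pure

variable {V : Type*} [AddCommGroup V] [Module ℝ V]

theorem mem_span_of_liftBaseChange_eq_zero {k : ℕ} {θ : Fin k → (V →ₗ[ℝ] ℂ)} {ψ : V →ₗ[ℝ] ℂ}
    (h : ∀ X : ℂ ⊗[ℝ] V, (∀ i, (θ i).liftBaseChange ℂ X = 0) → ψ.liftBaseChange ℂ X = 0) :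
    ψ ∈ Submodule.span ℂ (Set.range θ) := by
  let e : (V →ₗ[ℝ] ℂ) ≃ₗ[ℂ] (ℂ ⊗[ℝ] V →ₗ[ℂ] ℂ) := LinearMap.liftBaseChangeEquiv ℂ
  have h1 : e ψ ∈ Submodule.span ℂ (Set.range fun i => e (θ i)) := by
    refine mem_span_of_iInf_ker_le_ker fun X hX => ?_
    rw [Submodule.mem_iInf] at hX
    exact h X hX
  have h2 : (Set.range fun i => e (θ i)) = e.toLinearMap '' Set.range θ := Set.range_comp e θ
  rw [h2, Submodule.span_image] at h1
  obtain ⟨φ, hφ, he⟩ := Submodule.mem_map.mp h1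
  rwa [← e.injective he]

theorem conj_mem_span {S : Set (V →ₗ[ℝ] ℂ)} {ψ : V →ₗ[ℝ] ℂ} (h : ψ ∈ Submodule.span ℂ S) :
    Complex.conjAe.toLinearMap ∘ₗ ψ ∈
      Submodule.span ℂ ((fun φ => Complex.conjAe.toLinearMap ∘ₗ φ) '' S) := by
  refine Submodule.span_induction (p := fun ψ _ => Complex.conjAe.toLinearMap ∘ₗ ψ ∈
      Submodule.span ℂ ((fun φ => Complex.conjAe.toLinearMap ∘ₗ φ) '' S))
    (fun φ hφ => Submodule.subset_span ⟨φ, hφ, rfl⟩) ?_ (fun x y _ _ hx hy => ?_)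
    (fun c x _ hx => ?_) h
  · rw [LinearMap.comp_zero]
    exact zero_mem _
  · rw [LinearMap.comp_add]
    exact add_mem hx hy
  · have : Complex.conjAe.toLinearMap ∘ₗ (c • x) =
        starRingEnd ℂ c • (Complex.conjAe.toLinearMap ∘ₗ x) := by
      ext X
      exact map_mul (starRingEnd ℂ) _ _
    rw [this]
    exact Submodule.smul_mem _ _ hx

/-- The vectors `X - ι_X c` with `θᵢ(X) = 0` lie in the annihilator of `e^c Ω`. Orthogonality of `Y
+ η` to them is a condition on the one-form `η + ι_Y c`; antisymmetry of `c` flips the sign. -/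
theorem pairingC_sub_eq_liftBaseChange (Y : V) (η : Module.Dual ℝ V) (c : V [⋀^Fin 2]→ₗ[ℝ] ℂ)
    (X : ℂ ⊗[ℝ] V) :
    pairingC ((1 : ℂ) ⊗ₜ[ℝ] ((Y, η) : Dbl V))
        (vecC X - formVec ((contrTwo c).liftBaseChange ℂ X)) =
      (Complex.ofRealCLM.toLinearMap ∘ₗ η + contrTwo c Y).liftBaseChange ℂ X := by
  rw [map_sub, pairingC_tmul_formVec]
  induction X using TensorProduct.induction_on with
  | zero => simp
  | add x y hx hy =>
    rw [map_add (LinearMap.liftBaseChange ℂ (Complex.ofRealCLM.toLinearMap ∘ₗ η + contrTwo c Y)),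
      ← hx, ← hy, map_add vecC, map_add (pairingC _), map_add, LinearMap.add_apply]
    ring
  | tmul z X =>
    rw [vecC, LinearMap.baseChange_tmul, pairingC_tmul, pairing_apply,
      LinearMap.liftBaseChange_tmul, LinearMap.liftBaseChange_tmul, LinearMap.smul_apply,
      LinearMap.add_apply, contrTwo_swap c X Y]
    simp
    ring

namespace Form

theorem pow_succ (a : Form V) (m : ℕ) : a.pow (m + 1) = a.mul (a.pow m) :=
  Function.iterate_succ_apply' _ _ _

theorem parity_ofDegree_two (c : V [⋀^Fin 2]→ₗ[ℝ] ℂ) : parity (ofDegree c) = ofDegree c := by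
  rw [parity_ofDegree]
  norm_num

theorem pow_ofDegree_two_apply_eq_zero (c : V [⋀^Fin 2]→ₗ[ℝ] ℂ) (m : ℕ) :
    ∀ r < 2 * m, (ofDegree c).pow m r = 0 := by
  induction m with
  | zero => simp
  | succ m ih =>
    rw [pow_succ, show 2 * (m + 1) = 2 + 2 * m by ring]
    exact mul_apply_eq_zero_of_lt (fun r hr => ofDegree_of_ne _ hr.ne) ih

variable [FiniteDimensional ℝ V]

theorem parity_pow (c : V [⋀^Fin 2]→ₗ[ℝ] ℂ) (m : ℕ) :
    parity ((ofDegree c).pow m) = (ofDegree c).pow m := by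
  induction m with
  | zero => exact parity_one
  | succ m ih => rw [pow_succ, parity_mul, ih, parity_ofDegree_two]

theorem contract_pow (X : V) (c : V [⋀^Fin 2]→ₗ[ℝ] ℂ) (m : ℕ) :
    contract X ((ofDegree c).pow (m + 1)) =
      ((m + 1 : ℕ) : ℂ) • extC (contrTwo c X) ((ofDegree c).pow m) := by
  have h : ∀ m, contract X ((ofDegree c).pow (m + 1)) = extC (contrTwo c X) ((ofDegree c).pow m) +
      (ofDegree c).mul (contract X ((ofDegree c).pow m)) := fun m => by
    rw [pow_succ, contract_mul, parity_ofDegree_two, contract_ofDegree_two, mul_ofSubsingleton]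
  induction m with
  | zero =>
    rw [h]
    change _ + mulL (ofDegree c) (contract X one) = _
    rw [contract_one, map_zero, add_zero, Nat.cast_one, one_smul]
  | succ m ih =>
    rw [h, ih, ← mulL_apply, map_smul, mulL_apply, mul_extC, parity_ofDegree_two, ← pow_succ,
      Nat.cast_succ (m + 1), add_smul, one_smul, add_comm]

/-- The degree-dependent truncation in the definition becomes a uniform one: `c^m` starts in degree
`2 m`, and nothing survives above `dim V`. -/
theorem exp_eq_sum (c : V [⋀^Fin 2]→ₗ[ℝ] ℂ) {N : ℕ} (hN : Module.finrank ℝ V < N) :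
    exp c = ∑ m ∈ Finset.range N, ((m.factorial : ℂ)⁻¹) • (ofDegree c).pow m := by
  funext p
  rw [Finset.sum_apply]
  by_cases hp : Module.finrank ℝ V < p
  · rw [alternating_eq_zero_of_finrank_lt hp (exp c p)]
    exact (Finset.sum_eq_zero fun m _ => alternating_eq_zero_of_finrank_lt hp _).symm
  · refine Finset.sum_subset (Finset.range_mono (by omega)) fun m _ hm => ?_
    rw [Finset.mem_range, not_lt] at hm
    rw [pow_ofDegree_two_apply_eq_zero c m p (by omega), smul_zero]

theorem contract_exp (X : V) (c : V [⋀^Fin 2]→ₗ[ℝ] ℂ) :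
    contract X (exp c) = extC (contrTwo c X) (exp c) := by
  -- One more term is taken on the left, since contraction lowers the power of `c` by one.
  conv_lhs => rw [exp_eq_sum c (N := Module.finrank ℝ V + 1 + 1) (by omega)]
  rw [exp_eq_sum c (Nat.lt_succ_self _), Finset.sum_range_succ', map_add, map_sum, map_sum]
  have h0 : contract X (((Nat.factorial 0 : ℂ)⁻¹) • (ofDegree c).pow 0) = 0 := by
    rw [map_smul]
    exact (congrArg _ (contract_one X)).trans (smul_zero _)
  rw [h0, add_zero]
  refine Finset.sum_congr rfl fun m _ => ?_
  rw [map_smul, map_smul, contract_pow, smul_smul, Nat.factorial_succ, Nat.cast_mul, mul_inv,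
    mul_comm, ← _root_.mul_assoc, mul_inv_cancel₀ (Nat.cast_ne_zero.mpr m.succ_ne_zero),
    _root_.one_mul]

theorem parity_exp (c : V [⋀^Fin 2]→ₗ[ℝ] ℂ) : parity (exp c) = exp c := by
  rw [exp_eq_sum c (Nat.lt_succ_self _), map_sum]
  simp only [map_smul, parity_pow]

/-- `e^c` is injective, as a multiplication operator. -/
theorem eq_zero_of_exp_mul_eq_zero {c : V [⋀^Fin 2]→ₗ[ℝ] ℂ} {a : Form V}
    (h : (exp c).mul a = 0) : a = 0 := by
  let e : Form V := ∑ m ∈ Finset.range (Module.finrank ℝ V + 1),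
    (((m + 1).factorial : ℂ)⁻¹) • (ofDegree c).pow m
  have he : exp c = one + (ofDegree c).mul e := by
    rw [exp_eq_sum c (N := Module.finrank ℝ V + 1 + 1) (by omega), Finset.sum_range_succ',
      Nat.factorial_zero, Nat.cast_one, inv_one, one_smul, add_comm, ← mulL_apply, map_sum]
    congr 1
    refine Finset.sum_congr rfl fun m _ => ?_
    rw [map_smul, mulL_apply, pow_succ]
  have ha : a = -(ofDegree c).mul (e.mul a) := by
    rw [he, ← mulL_apply, map_add, LinearMap.add_apply, mulL_apply, mulL_apply, one_mul,
      mul_assoc] at h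
    exact eq_neg_of_add_eq_zero_left h
  -- The identity `a = -c ∧ e ∧ a` raises the order of vanishing of `a` by at least two, so every
  -- component vanishes.
  have key : ∀ j, ∀ r < j, a r = 0 := fun j => by
    induction j with
    | zero => simp
    | succ j ih =>
      intro r hr
      have h2 : ∀ r < 0 + j, e.mul a r = 0 :=
        mul_apply_eq_zero_of_lt (fun r hr => absurd hr (Nat.not_lt_zero r)) ih
      have h3 := mul_apply_eq_zero_of_lt (a := ofDegree c) (i := 2)
        (fun r hr => ofDegree_of_ne _ hr.ne) h2 r (by omega)
      rw [ha, Pi.neg_apply, h3, neg_zero]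
  funext r
  exact key (r + 1) r r.lt_succ_self

end Form

variable [FiniteDimensional ℝ V]

/-- A form of degree `≥ dim V` vanishes if its contraction with a nonzero vector does. -/
theorem eq_zero_of_contract_eq_zero {X : V} (hX : X ≠ 0) {a : Form V}
    (ha : ∀ r < Module.finrank ℝ V, a r = 0) (h : Form.contract X a = 0) : a = 0 := by
  obtain ⟨ξ, hξ⟩ : ∃ ξ : Module.Dual ℝ V, ξ X ≠ 0 := by
    by_contra! h0
    exact hX ((Module.forall_dual_apply_eq_zero_iff ℝ X).mp h0)
  -- The product has degree above `dim V`. Contracting it with `X` then recovers `ξ(X) a`.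
  have h1 : Form.extMul ξ a = 0 := by
    funext r
    cases r with
    | zero => rfl
    | succ r =>
      rcases Nat.lt_or_ge r (Module.finrank ℝ V) with hr | hr
      · ext v
        rw [Form.extMul_apply_apply, ha r hr]
        simp
      · exact alternating_eq_zero_of_finrank_lt (Nat.lt_succ_of_le hr) _
  have h2 := Form.contract_extMul X ξ a
  rw [h1, h, map_zero, map_zero, sub_zero] at h2
  exact (smul_eq_zero.mp h2.symm).resolve_left (Complex.ofReal_ne_zero.mpr hξ)

theorem actC_vecC_exp (X : ℂ ⊗[ℝ] V) (c : V [⋀^Fin 2]→ₗ[ℝ] ℂ) :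
    actC (vecC X) (Form.exp c) = extC ((contrTwo c).liftBaseChange ℂ X) (Form.exp c) := by
  induction X using TensorProduct.induction_on with
  | zero => simp
  | add x y hx hy => simp only [map_add, LinearMap.add_apply, hx, hy]
  | tmul z X =>
    rw [actC_vecC_tmul, Form.contract_exp, LinearMap.liftBaseChange_tmul, map_smul]
    rfl

theorem IsNondegeneratePure.ne_zero {n k : ℕ} {ρ : Form V} (hρ : IsNondegeneratePure n k ρ) :
    ρ ≠ 0 := by
  obtain ⟨-, B, ω, θ, rfl, hT⟩ := hρ
  intro h
  refine hT ?_
  rw [Form.eq_zero_of_exp_mul_eq_zero h, ← Form.mulL_apply, ← Form.mulL_apply, map_zero,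
    LinearMap.zero_apply, map_zero]

/-- Let `Y + η` be real and orthogonal to `L`. Pairing with the `θᵢ` gives `θᵢ(Y) = 0`, and pairing
with the `X - ι_X c` puts `ψ = η + ι_Y c` in the span of the `θᵢ`. Since `ψ - ψ̄ = 2i ι_Y ω`, the
form `ι_Y ω` is killed by `Ω ∧ Ω̄`. So `Y` contracts the top-degree form `ω^{n-k} ∧ Ω ∧ Ω̄ ≠ 0` to
zero, whence `Y = 0`. Then `ψ = η` is real and lies in the spans of both the `θᵢ` and the `θ̄ᵢ`,
which meet in zero as `Ω ∧ Ω̄ ≠ 0`. -/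
theorem IsNondegeneratePure.Ann_sup_Ann_conj {n k : ℕ} {ρ : Form V}
    (hρ : IsNondegeneratePure n k ρ) (hn : Module.finrank ℝ V = 2 * n) :
    Ann ρ ⊔ Ann ρ.conj = ⊤ := by
  obtain ⟨hk, B, ω, θ, rfl, hT⟩ := hρ
  set c := Form.complexify B + Complex.I • Form.complexify ω with hc
  set l := List.ofFn θ with hl
  set l' := l.map fun ψ => Complex.conjAe.toLinearMap ∘ₗ ψ with hl'
  set P := (l.map fun ψ => extC ψ).prod ((l'.map fun ψ => extC ψ).prod (Form.one : Form V)) with hP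
  have hmem : ∀ i, θ i ∈ l := fun i => List.mem_ofFn.mpr ⟨i, rfl⟩
  have hrange : {ψ | ψ ∈ l} = Set.range θ := by
    ext ψ
    exact List.mem_ofFn
  have hΩ : (Form.prodOneForms θ).mul (Form.prodOneForms θ).conj = P := by
    rw [prodOneForms_eq, conj_list_prod, Form.conj_one, list_prod_mul, Form.one_mul]
  rw [hΩ] at hT
  have hP0 : P ≠ 0 := fun h0 => hT (by rw [h0, ← Form.mulL_apply, map_zero])
  have hθ : ∀ i, formVec (θ i) ∈ Ann ((Form.exp c).mul (Form.prodOneForms θ)) := fun i => by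
    rw [mem_Ann, actC_formVec, ← Form.parity_exp c, ← mul_extC, prodOneForms_eq,
      extC_list_prod_of_mem_span (Submodule.subset_span (hmem i)), ← Form.mulL_apply, map_zero]
  -- The contraction by `X` kills `Ω` and acts on `e^c` as exterior multiplication by `ι_X c`, which
  -- the second term subtracts.
  have hX : ∀ X : ℂ ⊗[ℝ] V, (∀ i, (θ i).liftBaseChange ℂ X = 0) →
      vecC X - formVec ((contrTwo c).liftBaseChange ℂ X) ∈
        Ann ((Form.exp c).mul (Form.prodOneForms θ)) := fun X hX => by
    have h1 : actC (vecC X) (Form.prodOneForms θ) = 0 := by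
      rw [prodOneForms_eq]
      refine actC_list_prod_eq_zero (fun ψ hψ => ?_) ?_
      · obtain ⟨i, rfl⟩ := List.mem_ofFn.mp hψ
        rw [pairingC_vecC_formVec, hX i]
      · clear hX
        induction X using TensorProduct.induction_on with
        | zero => simp
        | add x y hx hy => rw [map_add, map_add, LinearMap.add_apply, hx, hy, add_zero]
        | tmul z X => rw [actC_vecC_tmul, Form.contract_one, smul_zero]
    rw [mem_Ann, map_sub, LinearMap.sub_apply, actC_vecC_mul, h1, ← Form.mulL_apply (Form.parity _),
      map_zero, add_zero, actC_vecC_exp, extC_mul, actC_formVec, sub_self]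
  refine Ann_sup_Ann_conj_eq_top fun w hw => ?_
  obtain ⟨Y, η⟩ := w
  have hθY : ∀ i, θ i Y = 0 := fun i => by
    have := hw _ (hθ i)
    rwa [pairingC_tmul_formVec, _root_.one_mul] at this
  set ψ := Complex.ofRealCLM.toLinearMap ∘ₗ η + contrTwo c Y with hψ
  have hψl : ψ ∈ Submodule.span ℂ {ψ | ψ ∈ l} := by
    rw [hrange]
    refine mem_span_of_liftBaseChange_eq_zero fun X hX' => ?_
    rw [hψ, ← pairingC_sub_eq_liftBaseChange]
    exact hw _ (hX X hX')
  have hψl' : Complex.conjAe.toLinearMap ∘ₗ ψ ∈ Submodule.span ℂ {ψ | ψ ∈ l'} := by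
    have := conj_mem_span hψl
    convert this using 2
    ext φ
    simp [hl']
  have hkl : ∀ φ ∈ Submodule.span ℂ {ψ | ψ ∈ l}, extC φ P = 0 := fun φ hφ =>
    extC_list_prod_of_mem_span hφ _
  have hkl' : ∀ φ ∈ Submodule.span ℂ {ψ | ψ ∈ l'},
      extC φ ((l'.map fun ψ => extC ψ).prod (Form.one : Form V)) = 0 := fun φ hφ =>
    extC_list_prod_of_mem_span hφ _
  have hωY : extC (contrTwo (Form.complexify ω) Y) P = 0 := by
    have h1 : (2 * Complex.I) • contrTwo (Form.complexify ω) Y =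
        ψ - Complex.conjAe.toLinearMap ∘ₗ ψ := by
      ext X
      have h2 : ψ X = (η X : ℂ) + ((B ![Y, X] : ℂ) + Complex.I * (ω ![Y, X] : ℂ)) := rfl
      have h3 : (Complex.conjAe.toLinearMap ∘ₗ ψ) X = starRingEnd ℂ (ψ X) := rfl
      have h4 : contrTwo (Form.complexify ω) Y X = (ω ![Y, X] : ℂ) := rfl
      rw [LinearMap.sub_apply, LinearMap.smul_apply, h3, h2, h4]
      simp
      ring
    have h2 := congrArg (fun φ => extC φ P) h1
    simp only [map_smul, map_sub, LinearMap.smul_apply, LinearMap.sub_apply] at h2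
    rw [hkl ψ hψl, hP, extC_list_prod_eq_zero (hkl' _ hψl'), sub_zero, ← hP] at h2
    exact (smul_eq_zero.mp h2).resolve_left (by simp)
  have hY : Y = 0 := by
    by_contra hY
    refine hT (eq_zero_of_contract_eq_zero hY ?_ ?_)
    · have h1 : ∀ r < 0 + l'.length + l.length, P r = 0 :=
        list_prod_apply_eq_zero l (list_prod_apply_eq_zero l' fun r hr => by omega)
      have h2 := Form.mul_apply_eq_zero_of_lt
        (Form.pow_ofDegree_two_apply_eq_zero (Form.complexify ω) (n - k)) h1
      intro r hr
      refine h2 r ?_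
      simp only [hl', hl, List.length_map, List.length_ofFn]
      omega
    · have hcP : Form.contract Y P = 0 := by
        have h1 : ∀ a, actC ((1 : ℂ) ⊗ₜ[ℝ] ((Y, 0) : Dbl V)) a = Form.contract Y a := fun a => by
          rw [actC_tmul, one_smul]
          simp [act]
        rw [← h1, hP]
        refine actC_list_prod_eq_zero (fun φ hφ => ?_)
          (actC_list_prod_eq_zero (fun φ hφ => ?_) ?_)
        · obtain ⟨i, rfl⟩ := List.mem_ofFn.mp hφ
          rw [pairingC_tmul_formVec, hθY, mul_zero]
        · obtain ⟨φ', hφ', rfl⟩ := List.mem_map.mp hφ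
          obtain ⟨i, rfl⟩ := List.mem_ofFn.mp hφ'
          rw [pairingC_tmul_formVec]
          simp [hθY]
        · rw [h1, Form.contract_one]
      rw [Form.contract_mul, hcP, ← Form.mulL_apply (Form.parity _), map_zero, add_zero]
      -- For exponent zero the power is the constant `1`; otherwise its contraction contains the
      -- factor `ι_Y ω`, which kills `Ω ∧ Ω̄`.
      cases n - k with
      | zero =>
        change Form.mulL (Form.contract Y Form.one) P = 0
        rw [Form.contract_one, map_zero, LinearMap.zero_apply]
      | succ m =>
        rw [Form.contract_pow, ← Form.mulL_apply, map_smul, LinearMap.smul_apply, Form.mulL_apply,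
          extC_mul, ← Form.parity_pow, ← mul_extC, hωY, ← Form.mulL_apply, map_zero, smul_zero]
  subst hY
  have hψη : ψ = Complex.ofRealCLM.toLinearMap ∘ₗ η := by rw [hψ, map_zero, add_zero]
  have hconj : Complex.conjAe.toLinearMap ∘ₗ ψ = ψ := by
    rw [hψη]
    ext X
    exact Complex.conj_ofReal (η X)
  rw [hconj] at hψl'
  have hψ0 := eq_zero_of_mem_span_of_extC_eq_zero hψl (hkl' _ hψl') hP0
  rw [hψη] at hψ0
  refine Prod.ext rfl (LinearMap.ext fun X => ?_)
  exact Complex.ofReal_eq_zero.mp (LinearMap.congr_fun hψ0 X)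

/-- The decomposition `∧ V*_ℂ = ⨁ j, Uʲ`. -/
theorem IsNondegeneratePure.isInternal_U {n k : ℕ} {ρ : Form V}
    (hρ : IsNondegeneratePure n k ρ) (hn : Module.finrank ℝ V = 2 * n) :
    DirectSum.IsInternal (U n ρ) :=
  isInternal_U_of_sup_eq_top hρ.ne_zero (hρ.Ann_sup_Ann_conj hn)

end Pure

end GenCx

end

/-! ### The theorem -/

open GenCx MeasureTheory in
open scoped Manifold ContDiff in
theorem mainTheorem7
    {E : Type*} [NormedAddCommGroup E] [NormedSpace ℝ E] [FiniteDimensional ℝ E]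
    {G : Type*} [Group G] [TopologicalSpace G] [T2Space G] [SecondCountableTopology G]
    [ChartedSpace E G] [LieGroup 𝓘(ℝ, E) ∞ G] [SimplyConnectedSpace G] [Group.IsNilpotent G]
    (Γ : Subgroup G) [DiscreteTopology Γ] [CompactSpace (Nilmanifold Γ)]
    [MeasurableSpace (Nilmanifold Γ)] [BorelSpace (Nilmanifold Γ)]
    (n k : ℕ) (hn : Module.finrank ℝ E = 2 * n)
    (ρ : Form (GroupLieAlgebra 𝓘(ℝ, E) G))
    (hρ : IsNondegeneratePure n k ρ) (hint : IsIntegrable ρ) :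
    ∃ hι : IsBiHom ceDiff (U n ρ) (smoothD E (Nilmanifold Γ)) (sectionU n (invForm Γ ρ)) (incl Γ),
      (∃ (ν : Measure (Nilmanifold Γ))
          (μ : SmoothForm E (Nilmanifold Γ) →ₗ[ℂ] Form (GroupLieAlgebra 𝓘(ℝ, E) G)),
        IsProbabilityMeasure ν ∧
        (∀ h : G, ν.map (fun q => rightMul q h) = ν) ∧
        (∀ (α : SmoothForm E (Nilmanifold Γ)) (p : ℕ) (X : Fin p → GroupLieAlgebra 𝓘(ℝ, E) G),
          μ α p X = ∫ q, α.1 q p (fun i => frame Γ q (X i)) ∂ν) ∧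
        IsBiHom (smoothD E (Nilmanifold Γ)) (sectionU n (invForm Γ ρ)) ceDiff (U n ρ) μ ∧
        ∀ a, μ (incl Γ a) = a) ∧
      ∀ j : ℤ, Function.Injective (hι.mapGH j) := by
  have : IsTopologicalGroup G := topologicalGroup_of_lieGroup 𝓘(ℝ, E) ∞
  have : LocallyCompactSpace G := Manifold.locallyCompact_of_finiteDimensional 𝓘(ℝ, E)
  have hU : DirectSum.IsInternal (U n ρ) := hρ.isInternal_U hn
  have hU' : DirectSum.IsInternal (sectionU n (invForm Γ ρ)) := isInternal_sectionU hU
  obtain ⟨ν, hν, hinv⟩ := exists_invariant_probabilityMeasure Γ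
  have hι : IsBiHom ceDiff (U n ρ) (smoothD E (Nilmanifold Γ)) (sectionU n (invForm Γ ρ))
      (incl Γ) :=
    .of_isInternal hU hU' (fun _ _ => incl_mem_sectionU) incl_ceDiff
  have hμ : IsBiHom (smoothD E (Nilmanifold Γ)) (sectionU n (invForm Γ ρ)) ceDiff (U n ρ)
      (average ν) :=
    .of_isInternal hU' hU (fun _ _ => average_mem_U ν) (average_smoothD hinv)
  exact ⟨hι, ⟨ν, average ν, hν, hinv, fun _ _ _ => rfl, hμ, average_incl ν⟩,
    hι.mapGH_injective hμ (average_incl ν)⟩
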